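/- Consider the class of equations $$u_{tt}=f(x,u_x)\,u_{xx}+g(x,u_x),$$ where $(f,g)$ are real-valued smooth functions of $(x,u_x)$ on an open set, $f$ has no zeros, and the equation is nonlinear in the sense that the pair $(f_{u_x},g_{u_xu_x})$ does not vanish identically on any nonempty open subset of the domain of $(f,g)$. All considerations are local (transformations are taken in a neighbourhood of a first-order jet $(t,x,u,u_t,u_x)$ with $(x,u_x)$ in the domain of $(f,g)$, and may be restricted to smaller neighbourhoods). For $\theta=(f,g)$ let $\mathcal L_\theta$ be the corresponding submanifold of the second-order jet space, and let $\mathrm T(\theta,\tilde\theta)$ be the set of local point transformations (local diffeomorphisms) $\varphi$ of the space of $(t,x,u)$ whose second prolongation is defined near the jet considered and maps $\mathcal L_\theta$ to $\mathcal L_{\tilde\theta}$; the point symmetry pseudogroup of $\mathcal L_\theta$ is $G_\theta=\mathrm T(\theta,\theta)$. The equivalence (pseudo)group $G^\sim$ of the class consists of the local point transformations $\Phi$ of the space of $(t,x,u,u_t,u_x,u_{tt},u_{tx},u_{xx},f,g)$ that project to the jet space as the second prolongation of a point transformation $\Phi|_{(t,x,u)}$ and that, together with their inverses, preserve the class: wherever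 the graph of an element $\theta$ of the class meets the domain of $\Phi$, it is mapped locally to the graph of an element $\Phi\theta$ of the class, and $\Phi|_{(t,x,u)}\in\mathrm T(\theta,\Phi\theta)$. Then: (1) The class is semi-normalized: for all elements $\theta,\tilde\theta$ of the class and every $\varphi\in\mathrm T(\theta,\tilde\theta)$ near a first-order jet there exist $\Phi\in G^\sim$ and $\tilde\varphi\in G_\theta$ such that, locally, $\tilde\theta=\Phi\theta$ and $\varphi=\Phi|_{(t,x,u)}\circ\tilde\varphi$. (2) Consequently, group classification of the class up to $G^\sim$-equivalence coincides with group classification up to general point equivalence. That is, for two equations of the class, each considered near a first-order jet, there is a point transformation mapping one equation to the other and its jet to the other jet if and only if there is such a transformation induced by $G^\sim$; and hence a family of sets of such localized equations solves the group classification problem up to $G^\sim$-equivalence if and only if it solves it up to general point equivalence. Here a family $(\mathcal S_\gamma)_{\gamma\in\Gamma}$ solves the group classification problem up to an equivalence relation if each listed equation has a maximal Lie invariance algebra $\mathfrak g_\theta$ different from the kernel algebra $\mathfrak g^\cap=\bigcap_\theta\mathfrak g_\theta$ of the class, the algebras $\mathfrak g_\theta$ of the equations in the same $\mathcal S_\gamma$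 have the same dimension, every equation of the class with $\mathfrak g_\theta\ne\mathfrak g^\cap$ is equivalent to a listed one, and distinct listed equations are inequivalent. (All Lie algebras are algebras of germs of smooth vector fields in $(t,x,u)$ and intersections are taken over all elements of the class defined near the given jet.) -/

import Mathlib

open scoped ContDiff Topology

/-! ## Jet coordinates

One dependent variable `u` and two independent variables `t`, `x`. -/

/-- Points `(t, x, u)`. -/
abbrev J0 : Type := ℝ × ℝ × ℝ

/-- First-order jets `((t, x, u), (u_t, u_x))`. -/
abbrev J1 : Type := J0 × (ℝ × ℝ)

/-- Second-order jets `(((t, x, u), (u_t, u_x)), (u_tt, u_tx, u_xx))`. -/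
abbrev J2 : Type := J1 × (ℝ × ℝ × ℝ)

/-- The pair `(x, u_x)`, the argument of the arbitrary elements. -/
def jetArg (j : J1) : ℝ × ℝ := (j.1.2.1, j.2.2)

/-- The second-order jets whose underlying first-order jet is near `j`
(with no restriction on the second-order derivatives). -/
def nearJet (j : J1) : Filter J2 := (𝓝 j).comap Prod.fst

/-! ## Total derivatives and prolongation of point transformations -/

/-- The total derivative `D_t F` of a function `F (t, x, u)`. -/
noncomputable def totalT (F : J0 → ℝ) (j : J1) : ℝ := fderiv ℝ F j.1 (1, 0, j.2.1)

/-- The total derivative `D_x F` of a function `F (t, x, u)`. -/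
noncomputable def totalX (F : J0 → ℝ) (j : J1) : ℝ := fderiv ℝ F j.1 (0, 1, j.2.2)

/-- The total derivative `D_t F` of a function `F` of the first-order jet. -/
noncomputable def totalT' (F : J1 → ℝ) (k : J2) : ℝ :=
  fderiv ℝ F k.1 ((1, 0, k.1.2.1), (k.2.1, k.2.2.1))

/-- The total derivative `D_x F` of a function `F` of the first-order jet. -/
noncomputable def totalX' (F : J1 → ℝ) (k : J2) : ℝ :=
  fderiv ℝ F k.1 ((0, 1, k.1.2.2), (k.2.2.1, k.2.2.2))

section Prolongation

variable (φ : J0 → J0)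

/-- The component `T` of `(t, x, u) ↦ (T, X, U)`. -/
def compT (z : J0) : ℝ := (φ z).1

/-- The component `X` of `(t, x, u) ↦ (T, X, U)`. -/
def compX (z : J0) : ℝ := (φ z).2.1

/-- The component `U` of `(t, x, u) ↦ (T, X, U)`. -/
def compU (z : J0) : ℝ := (φ z).2.2

/-- The total Jacobian `D_t T · D_x X - D_x T · D_t X`; the prolongation of `φ` is defined at the
jets where it does not vanish. -/
noncomputable def totalJac (j : J1) : ℝ :=
  totalT (compT φ) j * totalX (compX φ) j - totalX (compT φ) j * totalT (compX φ) j

/-- The derivative with respect to the new variable `t̃ = T` of a function with total derivatives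
`a = D_t F`, `b = D_x F`. -/
noncomputable def newDerivT (j : J1) (a b : ℝ) : ℝ :=
  (a * totalX (compX φ) j - b * totalT (compX φ) j) / totalJac φ j

/-- The derivative with respect to the new variable `x̃ = X` of a function with total derivatives
`a = D_t F`, `b = D_x F`. -/
noncomputable def newDerivX (j : J1) (a b : ℝ) : ℝ :=
  (b * totalT (compT φ) j - a * totalX (compT φ) j) / totalJac φ j

/-- The transformed derivative `ũ_t̃`. -/
noncomputable def newUt (j : J1) : ℝ := newDerivT φ j (totalT (compU φ) j) (totalX (compU φ) j)

/-- The transformed derivative `ũ_x̃`. -/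
noncomputable def newUx (j : J1) : ℝ := newDerivX φ j (totalT (compU φ) j) (totalX (compU φ) j)

/-- The first prolongation of `φ`. -/
noncomputable def prolong1 (j : J1) : J1 := (φ j.1, (newUt φ j, newUx φ j))

/-- The second prolongation of `φ`. -/
noncomputable def prolong2 (k : J2) : J2 :=
  (prolong1 φ k.1,
    (newDerivT φ k.1 (totalT' (newUt φ) k) (totalX' (newUt φ) k),
     newDerivX φ k.1 (totalT' (newUt φ) k) (totalX' (newUt φ) k),
     newDerivX φ k.1 (totalT' (newUx φ) k) (totalX' (newUx φ) k)))

end Prolongation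

/-- A (local) point transformation in the space `E`: a smooth invertible map between open subsets
of `E` with smooth inverse. -/
structure PointTransformation (E : Type) [NormedAddCommGroup E] [NormedSpace ℝ E] extends
    OpenPartialHomeomorph E E where
  smooth_toFun : ContDiffOn ℝ ∞ toFun source
  smooth_invFun : ContDiffOn ℝ ∞ invFun target

/-- The inverse point transformation. -/
def PointTransformation.inverse {E : Type} [NormedAddCommGroup E] [NormedSpace ℝ E]
    (φ : PointTransformation E) : PointTransformation E where
  toOpenPartialHomeomorph := φ.toOpenPartialHomeomorph.symm
  smooth_toFun := φ.smooth_invFun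
  smooth_invFun := φ.smooth_toFun

/-! ## Equations `u_tt = f(x, u_x) u_xx + g(x, u_x)` -/

/-- A pair of arbitrary elements `θ = (f, g)`: smooth functions of `(x, u_x)` on an open set. -/
structure ArbElem where
  dom : Set (ℝ × ℝ)
  isOpen_dom : IsOpen dom
  f : ℝ × ℝ → ℝ
  g : ℝ × ℝ → ℝ
  smooth_f : ContDiffOn ℝ ∞ f dom
  smooth_g : ContDiffOn ℝ ∞ g dom

/-- The value `(f, g)` of the arbitrary elements at a jet. -/
def ArbElem.val (θ : ArbElem) (j : J1) : ℝ × ℝ := (θ.f (jetArg j), θ.g (jetArg j))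

/-- The equation `u_tt = f(x, u_x) u_xx + g(x, u_x)` as a submanifold of the second-order jets. -/
def ArbElem.eqn (θ : ArbElem) : Set J2 :=
  {k | jetArg k.1 ∈ θ.dom ∧ k.2.1 = θ.f (jetArg k.1) * k.2.2.2 + θ.g (jetArg k.1)}

/-- Partial derivative with respect to `u_x` of a function of `(x, u_x)`. -/
noncomputable def partialUx (F : ℝ × ℝ → ℝ) (b : ℝ × ℝ) : ℝ := fderiv ℝ F b (0, 1)

/-- The class of nonlinear equations `u_tt = f(x, u_x) u_xx + g(x, u_x)`: `f` has no zeros and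
`(f_{u_x}, g_{u_x u_x})` does not vanish identically on any nonempty open subset of the domain,
i.e. the equation is not linear on any piece of its domain. -/
def waveClass : Set ArbElem :=
  {θ | (∀ b ∈ θ.dom, θ.f b ≠ 0) ∧
    ∀ V : Set (ℝ × ℝ), IsOpen V → V.Nonempty → V ⊆ θ.dom →
      ∃ b ∈ V, (partialUx θ.f b, partialUx (partialUx θ.g) b) ≠ (0, 0)}

/-! ## Admissible transformations, equivalence group, semi-normalization -/

/-- `φ ∈ T(θ, θ')` near the first-order jet `j`: the prolongation of the point transformation `φ`
is defined near `j` and maps the equation with arbitrary elements `θ` to the equation with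
arbitrary elements `θ'`. For `θ' = θ` this says that `φ` belongs to the maximal point symmetry
pseudogroup `G_θ`. -/
def AdmissibleAt (θ θ' : ArbElem) (φ : PointTransformation J0) (j : J1) : Prop :=
  j.1 ∈ φ.source ∧ jetArg j ∈ θ.dom ∧ totalJac φ.toFun j ≠ 0 ∧
    ∀ᶠ k in nearJet j, k ∈ θ.eqn ↔ prolong2 φ.toFun k ∈ θ'.eqn

/-- `θ' = Φ θ` along the filter `l` of jets: the transformation `Φ` of the space of
`(t, x, u_(2), f, g)`, whose restriction to the space of `(t, x, u)` is `φ`, maps the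
graph of `θ` to the graph of `θ'`. -/
def Transforms (Φ : PointTransformation (J2 × (ℝ × ℝ))) (φ : PointTransformation J0)
    (θ θ' : ArbElem) (l : Filter J2) : Prop :=
  ∀ᶠ k in l, (k, θ.val k.1) ∈ Φ.source ∧ jetArg (prolong1 φ.toFun k.1) ∈ θ'.dom ∧
    Φ.toFun (k, θ.val k.1) = (prolong2 φ.toFun k, θ'.val (prolong1 φ.toFun k.1))

/-- `Φ` preserves the class `S`: wherever the graph of some `θ ∈ S` meets the domain of `Φ`, it is
mapped to the graph of some `θ' ∈ S`, and `(θ, θ', φ)` is an admissible transformation. -/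
def PreservesClass (S : Set ArbElem) (Φ : PointTransformation (J2 × (ℝ × ℝ)))
    (φ : PointTransformation J0) : Prop :=
  ∀ θ ∈ S, ∀ k : J2, jetArg k.1 ∈ θ.dom → (k, θ.val k.1) ∈ Φ.source →
    ∃ θ' ∈ S, Transforms Φ φ θ θ' (𝓝 k) ∧ AdmissibleAt θ θ' φ k.1

/-- `Φ` belongs to the usual equivalence pseudogroup of the class `S`, and `φ` is its restriction
to the space of `(t, x, u)`: `Φ` is a point transformation in the space of
`(t, x, u_(2), f, g)` that projects to the space of jets as the second prolongation of `φ` (hence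
also to the spaces of lower-order jets), and `Φ` and its inverse preserve the class. -/
structure IsEquivTransformation (S : Set ArbElem) (Φ : PointTransformation (J2 × (ℝ × ℝ)))
    (φ : PointTransformation J0) : Prop where
  prolongs : ∀ w ∈ Φ.source, w.1.1.1 ∈ φ.source ∧ totalJac φ.toFun w.1.1 ≠ 0 ∧
    (Φ.toFun w).1 = prolong2 φ.toFun w.1
  preserves : PreservesClass S Φ φ
  preserves_inverse : PreservesClass S Φ.inverse φ.inverse

/-- The class `S` is semi-normalized: every admissible transformation `(θ, θ', φ)` is (locally)
of the form `φ = Φ|_(t,x,u) ∘ σ` with `σ` in the point symmetry pseudogroup of the equation with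
arbitrary elements `θ`, and `Φ` in the equivalence pseudogroup with `θ' = Φ θ`. -/
def SemiNormalized (S : Set ArbElem) : Prop :=
  ∀ θ ∈ S, ∀ θ' ∈ S, ∀ (φ : PointTransformation J0) (j : J1), AdmissibleAt θ θ' φ j →
    ∃ (Φ : PointTransformation (J2 × (ℝ × ℝ))) (φΦ σ : PointTransformation J0),
      IsEquivTransformation S Φ φΦ ∧
      AdmissibleAt θ θ σ j ∧
      Transforms Φ φΦ θ θ' (nearJet (prolong1 σ.toFun j)) ∧
      ∀ᶠ z in 𝓝 j.1, φ.toFun z = φΦ.toFun (σ.toFun z)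

/-! ## Lie symmetries -/

section LieSymmetries

variable (Q : J0 → J0)

/-- The coefficient of `∂_{u_t}` in the prolongation of the vector field
`Q = τ ∂_t + ξ ∂_x + η ∂_u`. -/
noncomputable def coefT (j : J1) : ℝ :=
  totalT (compU Q) j - j.2.1 * totalT (compT Q) j - j.2.2 * totalT (compX Q) j

/-- The coefficient of `∂_{u_x}`. -/
noncomputable def coefX (j : J1) : ℝ :=
  totalX (compU Q) j - j.2.1 * totalX (compT Q) j - j.2.2 * totalX (compX Q) j

/-- The coefficient of `∂_{u_tt}`. -/
noncomputable def coefTT (k : J2) : ℝ :=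
  totalT' (coefT Q) k - k.2.1 * totalT (compT Q) k.1 - k.2.2.1 * totalT (compX Q) k.1

/-- The coefficient of `∂_{u_xx}`. -/
noncomputable def coefXX (k : J2) : ℝ :=
  totalX' (coefX Q) k - k.2.2.1 * totalX (compT Q) k.1 - k.2.2.2 * totalX (compX Q) k.1

/-- The second prolongation of `Q` applied to `u_tt - f u_xx - g`. -/
noncomputable def prolongedAction (θ : ArbElem) (k : J2) : ℝ :=
  coefTT Q k
    - fderiv ℝ θ.f (jetArg k.1) (compX Q k.1.1, coefX Q k.1) * k.2.2.2
    - θ.f (jetArg k.1) * coefXX Q k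
    - fderiv ℝ θ.g (jetArg k.1) (compX Q k.1.1, coefX Q k.1)

end LieSymmetries


lemma smooth_comps {Q : J0 → J0} {z : J0} (hQ : ContDiffAt ℝ ∞ Q z) :
    ContDiffAt ℝ ∞ (compT Q) z ∧ ContDiffAt ℝ ∞ (compX Q) z ∧ ContDiffAt ℝ ∞ (compU Q) z := by
  unfold compT compX compU
  exact ⟨hQ.fst, hQ.snd.fst, hQ.snd.snd⟩

lemma differentiableAt_totalT {F : J0 → ℝ} {j : J1} (hF : ContDiffAt ℝ ∞ F j.1) :
    DifferentiableAt ℝ (totalT F) j := by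
  have h1 : DifferentiableAt ℝ (fderiv ℝ F) j.1 :=
    (hF.fderiv_right (m := 1) (by norm_cast)).differentiableAt (by norm_num)
  have h2 : DifferentiableAt ℝ (fun j : J1 => fderiv ℝ F j.1) j :=
    DifferentiableAt.comp (g := fderiv ℝ F) j h1 differentiableAt_fst
  unfold totalT
  exact h2.clm_apply (by fun_prop)

lemma differentiableAt_totalX {F : J0 → ℝ} {j : J1} (hF : ContDiffAt ℝ ∞ F j.1) :
    DifferentiableAt ℝ (totalX F) j := by
  have h1 : DifferentiableAt ℝ (fderiv ℝ F) j.1 :=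
    (hF.fderiv_right (m := 1) (by norm_cast)).differentiableAt (by norm_num)
  have h2 : DifferentiableAt ℝ (fun j : J1 => fderiv ℝ F j.1) j :=
    DifferentiableAt.comp (g := fderiv ℝ F) j h1 differentiableAt_fst
  unfold totalX
  exact h2.clm_apply (by fun_prop)

lemma differentiableAt_coefs {Q : J0 → J0} {j : J1} (hQ : ContDiffAt ℝ ∞ Q j.1) :
    DifferentiableAt ℝ (coefT Q) j ∧ DifferentiableAt ℝ (coefX Q) j := by
  obtain ⟨h1, h2, h3⟩ := smooth_comps hQ
  have a1 := differentiableAt_totalT h1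
  have a2 := differentiableAt_totalT h2
  have a3 := differentiableAt_totalT h3
  have b1 := differentiableAt_totalX h1
  have b2 := differentiableAt_totalX h2
  have b3 := differentiableAt_totalX h3
  unfold coefT coefX
  constructor <;> fun_prop

lemma totals_lin {F G : J0 → ℝ} {j : J1} (a b : ℝ) (hF : DifferentiableAt ℝ F j.1)
    (hG : DifferentiableAt ℝ G j.1) :
    totalT (a • F + b • G) j = a * totalT F j + b * totalT G j ∧
      totalX (a • F + b • G) j = a * totalX F j + b * totalX G j := by
  unfold totalT totalX
  rw [fderiv_add (hF.const_smul a) (hG.const_smul b), fderiv_const_smul hF, fderiv_const_smul hG]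
  simp

lemma coefs_lin {Q R : J0 → J0} {j : J1} (a b : ℝ) (hQ : ContDiffAt ℝ ∞ Q j.1)
    (hR : ContDiffAt ℝ ∞ R j.1) :
    coefT (a • Q + b • R) j = a * coefT Q j + b * coefT R j ∧
      coefX (a • Q + b • R) j = a * coefX Q j + b * coefX R j := by
  obtain ⟨h1, h2, h3⟩ := smooth_comps hQ
  obtain ⟨k1, k2, k3⟩ := smooth_comps hR
  have e : (∞ : WithTop ℕ∞) ≠ 0 := by simp
  have l1 := totals_lin a b (h1.differentiableAt e) (k1.differentiableAt e)
  have l2 := totals_lin a b (h2.differentiableAt e) (k2.differentiableAt e)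
  have l3 := totals_lin a b (h3.differentiableAt e) (k3.differentiableAt e)
  have c1 : compT (a • Q + b • R) = a • compT Q + b • compT R := by ext z; simp [compT]
  have c2 : compX (a • Q + b • R) = a • compX Q + b • compX R := by ext z; simp [compX]
  have c3 : compU (a • Q + b • R) = a • compU Q + b • compU R := by ext z; simp [compU]
  unfold coefT coefX
  rw [c1, c2, c3, l1.1, l1.2, l2.1, l2.2, l3.1, l3.2]
  constructor <;> ring

lemma prolongedAction_lin {Q R : J0 → J0} (θ : ArbElem) {k : J2} (a b : ℝ)
    (hQ : ∀ᶠ z in 𝓝 k.1.1, ContDiffAt ℝ ∞ Q z) (hR : ∀ᶠ z in 𝓝 k.1.1, ContDiffAt ℝ ∞ R z) :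
    prolongedAction (a • Q + b • R) θ k = a * prolongedAction Q θ k + b * prolongedAction R θ k := by
  have hQ0 := hQ.self_of_nhds
  have hR0 := hR.self_of_nhds
  have t1 : Filter.Tendsto (fun j : J1 => j.1) (𝓝 k.1) (𝓝 k.1.1) := continuous_fst.tendsto _
  have eT : coefT (a • Q + b • R) =ᶠ[𝓝 k.1] a • coefT Q + b • coefT R := by
    filter_upwards [t1.eventually hQ, t1.eventually hR] with j h1 h2
    simpa using (coefs_lin a b h1 h2).1
  have eX : coefX (a • Q + b • R) =ᶠ[𝓝 k.1] a • coefX Q + b • coefX R := by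
    filter_upwards [t1.eventually hQ, t1.eventually hR] with j h1 h2
    simpa using (coefs_lin a b h1 h2).2
  obtain ⟨dQ1, dQ2⟩ := differentiableAt_coefs hQ0
  obtain ⟨dR1, dR2⟩ := differentiableAt_coefs hR0
  have fT : fderiv ℝ (coefT (a • Q + b • R)) k.1
      = a • fderiv ℝ (coefT Q) k.1 + b • fderiv ℝ (coefT R) k.1 := by
    rw [eT.fderiv_eq, fderiv_add (dQ1.const_smul a) (dR1.const_smul b), fderiv_const_smul dQ1,
      fderiv_const_smul dR1]
  have fX : fderiv ℝ (coefX (a • Q + b • R)) k.1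
      = a • fderiv ℝ (coefX Q) k.1 + b • fderiv ℝ (coefX R) k.1 := by
    rw [eX.fderiv_eq, fderiv_add (dQ2.const_smul a) (dR2.const_smul b), fderiv_const_smul dQ2,
      fderiv_const_smul dR2]
  obtain ⟨h1, h2, h3⟩ := smooth_comps hQ0
  obtain ⟨k1, k2, k3⟩ := smooth_comps hR0
  have e : (∞ : WithTop ℕ∞) ≠ 0 := by simp
  have l1 := totals_lin a b (h1.differentiableAt e) (k1.differentiableAt e)
  have l2 := totals_lin a b (h2.differentiableAt e) (k2.differentiableAt e)
  have c1 : compT (a • Q + b • R) = a • compT Q + b • compT R := by ext z; simp [compT]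
  have c2 : compX (a • Q + b • R) = a • compX Q + b • compX R := by ext z; simp [compX]
  have v : ((compX (a • Q + b • R) k.1.1, coefX (a • Q + b • R) k.1) : ℝ × ℝ)
      = a • (compX Q k.1.1, coefX Q k.1) + b • (compX R k.1.1, coefX R k.1) := by
    rw [c2, (coefs_lin a b hQ0 hR0).2]
    simp
  unfold prolongedAction coefTT coefXX totalT' totalX'
  rw [v, fT, fX, c1, c2, l1.1, l1.2, l2.1, l2.2]
  simp only [map_add, map_smul, add_apply, smul_apply, smul_eq_mul]
  ring

/-- The maximal Lie invariance algebra of the equation with arbitrary elements `θ` near the jet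
`j`, as a space of germs of smooth vector fields at the base point of `j`, given by the
infinitesimal invariance criterion. -/
noncomputable def lieAlg (θ : ArbElem) (j : J1) : Submodule ℝ ((𝓝 j.1).Germ J0) where
  carrier := {q | ∃ Q : J0 → J0, (Q : (𝓝 j.1).Germ J0) = q ∧
    (∀ᶠ z in 𝓝 j.1, ContDiffAt ℝ ∞ Q z) ∧
    ∀ᶠ k in nearJet j, k ∈ θ.eqn → prolongedAction Q θ k = 0}
  zero_mem' := by
    refine ⟨0, rfl, Filter.Eventually.of_forall fun z => contDiffAt_const,
      Filter.Eventually.of_forall fun k _ => ?_⟩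
    have h : ∀ᶠ z in 𝓝 k.1.1, ContDiffAt ℝ ∞ (0 : J0 → J0) z :=
      Filter.Eventually.of_forall fun z => contDiffAt_const
    simpa using prolongedAction_lin θ 0 0 h h
  add_mem' := by
    rintro _ _ ⟨Q, rfl, hQ, iQ⟩ ⟨R, rfl, hR, iR⟩
    refine ⟨Q + R, rfl, ?_, ?_⟩
    · filter_upwards [hQ, hR] with z h1 h2 using h1.add h2
    · have t : Filter.Tendsto (fun k : J2 => k.1.1) (nearJet j) (𝓝 j.1) :=
        (continuous_fst.tendsto j).comp Filter.tendsto_comap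
      filter_upwards [iQ, iR, t.eventually hQ.eventually_nhds, t.eventually hR.eventually_nhds]
        with k h1 h2 h3 h4 hk
      simpa [h1 hk, h2 hk] using prolongedAction_lin θ 1 1 h3 h4
  smul_mem' := by
    rintro c _ ⟨Q, rfl, hQ, iQ⟩
    refine ⟨c • Q, rfl, ?_, ?_⟩
    · filter_upwards [hQ] with z h1 using h1.const_smul c
    · have t : Filter.Tendsto (fun k : J2 => k.1.1) (nearJet j) (𝓝 j.1) :=
        (continuous_fst.tendsto j).comp Filter.tendsto_comap
      filter_upwards [iQ, t.eventually hQ.eventually_nhds] with k h1 h3 hk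
      simpa [h1 hk] using prolongedAction_lin θ c 0 h3 h3

/-- The kernel of the maximal Lie invariance algebras of the equations of the class `S`, near the
jet `j`. -/
noncomputable def kernelAlg (S : Set ArbElem) (j : J1) : Submodule ℝ ((𝓝 j.1).Germ J0) :=
  ⨅ θ ∈ {θ ∈ S | jetArg j ∈ θ.dom}, lieAlg θ j

/-! ## Group classification -/

/-- An equation of the class `S` considered near a first-order jet. -/
structure LocalElem (S : Set ArbElem) where
  elem : ArbElem
  mem : elem ∈ S
  jet : J1
  jet_mem : jetArg jet ∈ elem.dom

/-- General point equivalence: a point transformation maps one equation to the other one. -/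
def PointEquiv {S : Set ArbElem} (a b : LocalElem S) : Prop :=
  ∃ φ : PointTransformation J0, AdmissibleAt a.elem b.elem φ a.jet ∧
    prolong1 φ.toFun a.jet = b.jet

/-- Equivalence with respect to the usual equivalence group of the class. -/
def GroupEquiv {S : Set ArbElem} (a b : LocalElem S) : Prop :=
  ∃ (Φ : PointTransformation (J2 × (ℝ × ℝ))) (φ : PointTransformation J0),
    IsEquivTransformation S Φ φ ∧ Transforms Φ φ a.elem b.elem (nearJet a.jet) ∧
    prolong1 φ.toFun a.jet = b.jet

/-- The equation admits a proper extension of the kernel algebra. -/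
def HasExtension {S : Set ArbElem} (a : LocalElem S) : Prop :=
  lieAlg a.elem a.jet ≠ kernelAlg S a.jet

/-- The family `𝒮` of subsets of the class is a solution of the group classification problem up
to the equivalence `R`: it consists of equations with extensions of Lie symmetry, with algebras
of the same dimension within each member of the family; every equation with an extension is
equivalent to a listed one; and different listed equations are inequivalent. -/
structure IsClassificationList {S : Set ArbElem} (R : LocalElem S → LocalElem S → Prop)
    {Γ : Type*} (𝒮 : Γ → Set (LocalElem S)) : Prop where
  extension : ∀ γ, ∀ a ∈ 𝒮 γ, HasExtension a
  dimension : ∀ γ, ∀ a ∈ 𝒮 γ, ∀ b ∈ 𝒮 γ,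
    Module.rank ℝ (lieAlg a.elem a.jet) = Module.rank ℝ (lieAlg b.elem b.jet)
  complete : ∀ a, HasExtension a → ∃ γ, ∃ b ∈ 𝒮 γ, R a b
  inequivalent : ∀ a ∈ ⋃ γ, 𝒮 γ, ∀ b ∈ ⋃ γ, 𝒮 γ, R a b → a = b

/-!
An admissible transformation `φ` between two equations of the class is fibre-preserving,
`t̃ = T(t)`, `x̃ = X(x)`, `ũ = U(t, x, u)` with `U` affine in `u`: this is what the determining
equations leave over, since for neither equation is `f` independent of `u_x` and `g` affine in `u_x`
on an open set. They also force `U_u` to be independent of `x`, and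
`U_tt - (T_tt / T_t) U_t` to depend on `t` only. Freezing `t` at the base point, `T` to first and
`U` to second order, one thus obtains
`t̃ = c₁ t + c₀`, `x̃ = X(x)`, `ũ = c₂ u + c₄ t ^ 2 + c₃ t + ψ(x)`,
which induces an equivalence transformation `E` acting on the base jet and on the arbitrary element
in the same way as `φ` does. As prolongation is functorial, `E⁻¹ ∘ φ` is a symmetry of the source
equation. An equivalence transformation is conversely admissible between any two elements it maps
to each other, so the equivalences by `G^∼` and by point transformations agree.
-/

/-! ## Directional derivatives -/

section DirDeriv

variable {E G : Type*} [NormedAddCommGroup E] [NormedSpace ℝ E] [NormedAddCommGroup G]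
  [NormedSpace ℝ G]

/-- The derivative of `F` in the direction `v`, an operator on functions so that it can be
iterated. -/
noncomputable def dirDeriv (v : E) (F : E → G) (z : E) : G := fderiv ℝ F z v

/-- The Hessian of `F` at `z`, as a bilinear form. -/
noncomputable def hess (F : E → G) (z v w : E) : G := fderiv ℝ (fderiv ℝ F) z v w

lemma contDiffAt_dirDeriv {F : E → G} {z : E} (hF : ContDiffAt ℝ ∞ F z) (v : E) :
    ContDiffAt ℝ ∞ (dirDeriv v F) z :=
  (hF.fderiv_right (m := ∞) (by norm_cast)).clm_apply contDiffAt_const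

lemma differentiableAt_of_smooth {F : E → G} {z : E} (hF : ContDiffAt ℝ ∞ F z) :
    DifferentiableAt ℝ F z :=
  hF.differentiableAt (by simp)

lemma differentiableAt_fderiv_of_smooth {F : E → G} {z : E} (hF : ContDiffAt ℝ ∞ F z) :
    DifferentiableAt ℝ (fderiv ℝ F) z :=
  (hF.fderiv_right (m := 1) (by norm_cast)).differentiableAt one_ne_zero

lemma dirDeriv_dirDeriv {F : E → G} {z : E} (hF : ContDiffAt ℝ ∞ F z) (v w : E) :
    dirDeriv v (dirDeriv w F) z = hess F z v w := by
  change fderiv ℝ (fun y => fderiv ℝ F y w) z v = _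
  rw [fderiv_clm_apply (differentiableAt_fderiv_of_smooth hF) (differentiableAt_const w)]
  simp [hess]

lemma hess_comm {F : E → G} {z : E} (hF : ContDiffAt ℝ ∞ F z) (v w : E) :
    hess F z v w = hess F z w v :=
  hF.isSymmSndFDerivAt (by simp only [minSmoothness_of_isRCLikeNormedField]; norm_cast) v w

lemma dirDeriv_comm {F : E → G} {z : E} (hF : ContDiffAt ℝ ∞ F z) (v w : E) :
    dirDeriv v (dirDeriv w F) z = dirDeriv w (dirDeriv v F) z := by
  rw [dirDeriv_dirDeriv hF, dirDeriv_dirDeriv hF, hess_comm hF]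

lemma dirDeriv_congr {F H : E → G} {z : E} (h : F =ᶠ[𝓝 z] H) (v : E) :
    dirDeriv v F z = dirDeriv v H z := by
  rw [dirDeriv, dirDeriv, h.fderiv_eq]

lemma dirDeriv_eventually_const {F : E → G} {z : E} {c : G} (h : ∀ᶠ y in 𝓝 z, F y = c) (v : E) :
    dirDeriv v F z = 0 := by
  have h' : F =ᶠ[𝓝 z] fun _ => c := h
  simp [dirDeriv, h'.fderiv_eq]

lemma dirDeriv_sub {F H : E → G} {z : E} (hF : DifferentiableAt ℝ F z)
    (hH : DifferentiableAt ℝ H z) (v : E) :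
    dirDeriv v (fun y => F y - H y) z = dirDeriv v F z - dirDeriv v H z := by
  simp [dirDeriv, fderiv_fun_sub hF hH]

lemma dirDeriv_mul {F H : E → ℝ} {z : E} (hF : DifferentiableAt ℝ F z)
    (hH : DifferentiableAt ℝ H z) (v : E) :
    dirDeriv v (fun y => F y * H y) z = dirDeriv v F z * H z + F z * dirDeriv v H z := by
  simp only [dirDeriv, fderiv_fun_mul hF hH, add_apply, smul_apply, smul_eq_mul]
  ring

lemma hasDerivAt_line {F : E → G} {z v : E} {s : ℝ} (hF : DifferentiableAt ℝ F (z + s • v)) :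
    HasDerivAt (fun r : ℝ => F (z + r • v)) (dirDeriv v F (z + s • v)) s := by
  have hline : HasDerivAt (fun r : ℝ => z + r • v) v s := by
    simpa using ((hasDerivAt_id s).smul_const v).const_add z
  exact hF.hasFDerivAt.comp_hasDerivAt s hline

end DirDeriv

/-- `∂/∂t` on functions of `(t, x, u)`. -/
notation "∂ₜ" => dirDeriv ((1, 0, 0) : J0)

/-- `∂/∂x` on functions of `(t, x, u)`. -/
notation "∂ₓ" => dirDeriv ((0, 1, 0) : J0)

/-- `∂/∂u` on functions of `(t, x, u)`. -/
notation "∂ᵤ" => dirDeriv ((0, 0, 1) : J0)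

lemma dirDeriv_coords (F : J0 → ℝ) (z : J0) (a b c : ℝ) :
    dirDeriv (a, b, c) F z = a * ∂ₜ F z + b * ∂ₓ F z + c * ∂ᵤ F z := by
  have hsum : ((a, b, c) : J0) = a • (1, 0, 0) + b • (0, 1, 0) + c • (0, 0, 1) := by simp
  simp only [hsum, dirDeriv, map_add, map_smul, smul_eq_mul]

/-! ## Total derivatives -/

/-- The horizontal direction `∂_t + u_t ∂_u` at a first-order jet. -/
def horT (j : J1) : J0 := (1, 0, j.2.1)

/-- The horizontal direction `∂_x + u_x ∂_u` at a first-order jet. -/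
def horX (j : J1) : J0 := (0, 1, j.2.2)

lemma totalT_eq (F : J0 → ℝ) (j : J1) : totalT F j = ∂ₜ F j.1 + j.2.1 * ∂ᵤ F j.1 := by
  simpa [totalT, dirDeriv] using dirDeriv_coords F j.1 1 0 j.2.1

lemma totalX_eq (F : J0 → ℝ) (j : J1) : totalX F j = ∂ₓ F j.1 + j.2.2 * ∂ᵤ F j.1 := by
  simpa [totalX, dirDeriv] using dirDeriv_coords F j.1 0 1 j.2.2

lemma totalT_congr {F H : J0 → ℝ} {j : J1} (h : F =ᶠ[𝓝 j.1] H) : totalT F j = totalT H j :=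
  dirDeriv_congr h _

lemma totalX_congr {F H : J0 → ℝ} {j : J1} (h : F =ᶠ[𝓝 j.1] H) : totalX F j = totalX H j :=
  dirDeriv_congr h _

section

variable {F : J0 → ℝ} {j : J1}

lemma contDiffAt_totalT (hF : ContDiffAt ℝ ∞ F j.1) : ContDiffAt ℝ ∞ (totalT F) j :=
  (ContDiffAt.comp (g := fderiv ℝ F) j (hF.fderiv_right (m := ∞) (by norm_cast))
    contDiffAt_fst).clm_apply (by fun_prop)

lemma contDiffAt_totalX (hF : ContDiffAt ℝ ∞ F j.1) : ContDiffAt ℝ ∞ (totalX F) j :=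
  (ContDiffAt.comp (g := fderiv ℝ F) j (hF.fderiv_right (m := ∞) (by norm_cast))
    contDiffAt_fst).clm_apply (by fun_prop)

lemma hess_horT (hF : ContDiffAt ℝ ∞ F j.1) :
    hess F j.1 (horT j) (horT j) =
      ∂ₜ (∂ₜ F) j.1 + 2 * j.2.1 * ∂ₜ (∂ᵤ F) j.1 + j.2.1 ^ 2 * ∂ᵤ (∂ᵤ F) j.1 := by
  have hsum : horT j = (1, 0, 0) + j.2.1 • (0, 0, 1) := by simp [horT]
  have hcomm := hess_comm hF (0, 0, 1) (1, 0, 0)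
  simp only [dirDeriv_dirDeriv hF, hess] at hcomm ⊢
  simp only [hsum, map_add, map_smul, add_apply, smul_apply, smul_eq_mul, hcomm]
  ring

lemma hess_horX (hF : ContDiffAt ℝ ∞ F j.1) :
    hess F j.1 (horX j) (horX j) =
      ∂ₓ (∂ₓ F) j.1 + 2 * j.2.2 * ∂ₓ (∂ᵤ F) j.1 + j.2.2 ^ 2 * ∂ᵤ (∂ᵤ F) j.1 := by
  have hsum : horX j = (0, 1, 0) + j.2.2 • (0, 0, 1) := by simp [horX]
  have hcomm := hess_comm hF (0, 0, 1) (0, 1, 0)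
  simp only [dirDeriv_dirDeriv hF, hess] at hcomm ⊢
  simp only [hsum, map_add, map_smul, add_apply, smul_apply, smul_eq_mul, hcomm]
  ring

lemma fderiv_apply_horizontal {H : J1 → J0} {L : J1 →L[ℝ] J0} (hF : ContDiffAt ℝ ∞ F j.1)
    (hH : HasFDerivAt H L j) (v : J1) :
    fderiv ℝ (fun i : J1 => fderiv ℝ F i.1 (H i)) j v =
      hess F j.1 v.1 (H j) + dirDeriv (L v) F j.1 := by
  have hd : HasFDerivAt (fun i : J1 => fderiv ℝ F i.1)
      ((fderiv ℝ (fderiv ℝ F) j.1).comp (ContinuousLinearMap.fst ℝ J0 (ℝ × ℝ))) j :=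
    (differentiableAt_fderiv_of_smooth hF).hasFDerivAt.comp j hasFDerivAt_fst
  rw [(hd.clm_apply hH).fderiv]
  simp [hess, dirDeriv, add_comm]

lemma fderiv_totalT (hF : ContDiffAt ℝ ∞ F j.1) (v : J1) :
    fderiv ℝ (totalT F) j v = hess F j.1 v.1 (horT j) + v.2.1 * ∂ᵤ F j.1 := by
  have hH : HasFDerivAt horT (.prod 0 (.prod 0 ((ContinuousLinearMap.fst ℝ ℝ ℝ).comp
      (.snd ℝ J0 (ℝ × ℝ))))) j :=
    (hasFDerivAt_const _ _).prodMk ((hasFDerivAt_const _ _).prodMk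
      (hasFDerivAt_fst.comp j hasFDerivAt_snd))
  refine (fderiv_apply_horizontal hF hH v).trans ?_
  simp [dirDeriv_coords F j.1 0 0 v.2.1]

lemma fderiv_totalX (hF : ContDiffAt ℝ ∞ F j.1) (v : J1) :
    fderiv ℝ (totalX F) j v = hess F j.1 v.1 (horX j) + v.2.2 * ∂ᵤ F j.1 := by
  have hH : HasFDerivAt horX (.prod 0 (.prod 0 ((ContinuousLinearMap.snd ℝ ℝ ℝ).comp
      (.snd ℝ J0 (ℝ × ℝ))))) j :=
    (hasFDerivAt_const _ _).prodMk ((hasFDerivAt_const _ _).prodMk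
      (hasFDerivAt_snd.comp j hasFDerivAt_snd))
  refine (fderiv_apply_horizontal hF hH v).trans ?_
  simp [dirDeriv_coords F j.1 0 0 v.2.2]

end

/-! ## Prolongation -/

section Prolongation

variable {φ : J0 → J0} {j : J1}

lemma newDeriv_solves (hJ : totalJac φ j ≠ 0) (a b : ℝ) :
    totalT (compT φ) j * newDerivT φ j a b + totalT (compX φ) j * newDerivX φ j a b = a ∧
      totalX (compT φ) j * newDerivT φ j a b + totalX (compX φ) j * newDerivX φ j a b = b := by
  unfold newDerivT newDerivX
  constructor <;> field_simp <;> unfold totalJac <;> ring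

lemma newDeriv_unique (hJ : totalJac φ j ≠ 0) {a b p q : ℝ}
    (ha : totalT (compT φ) j * p + totalT (compX φ) j * q = a)
    (hb : totalX (compT φ) j * p + totalX (compX φ) j * q = b) :
    newDerivT φ j a b = p ∧ newDerivX φ j a b = q := by
  unfold newDerivT newDerivX
  rw [div_eq_iff hJ, div_eq_iff hJ, ← ha, ← hb]
  unfold totalJac
  constructor <;> ring

lemma totalT_compU (hJ : totalJac φ j ≠ 0) :
    totalT (compU φ) j = newUt φ j * totalT (compT φ) j + newUx φ j * totalT (compX φ) j := by
  rw [← (newDeriv_solves hJ (totalT (compU φ) j) (totalX (compU φ) j)).1]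
  unfold newUt newUx
  ring

lemma totalX_compU (hJ : totalJac φ j ≠ 0) :
    totalX (compU φ) j = newUt φ j * totalX (compT φ) j + newUx φ j * totalX (compX φ) j := by
  rw [← (newDeriv_solves hJ (totalT (compU φ) j) (totalX (compU φ) j)).2]
  unfold newUt newUx
  ring

lemma contDiffAt_totalJac (hφ : ContDiffAt ℝ ∞ φ j.1) : ContDiffAt ℝ ∞ (totalJac φ) j := by
  obtain ⟨hT, hX, -⟩ := smooth_comps hφ
  exact ((contDiffAt_totalT hT).mul (contDiffAt_totalX hX)).sub
    ((contDiffAt_totalX hT).mul (contDiffAt_totalT hX))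

section Smoothness

variable {E : Type*} [NormedAddCommGroup E] [NormedSpace ℝ E] {p : E → J1} {a b : E → ℝ} {w : E}
  (hp : ContDiffAt ℝ ∞ p w) (ha : ContDiffAt ℝ ∞ a w) (hb : ContDiffAt ℝ ∞ b w)
  (hφ : ContDiffAt ℝ ∞ φ (p w).1) (hJ : totalJac φ (p w) ≠ 0)

include hp ha hb hφ hJ

lemma contDiffAt_newDerivT : ContDiffAt ℝ ∞ (fun y => newDerivT φ (p y) (a y) (b y)) w := by
  obtain ⟨-, hX, -⟩ := smooth_comps hφ
  exact ((ha.mul ((contDiffAt_totalX hX).comp w hp)).sub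
    (hb.mul ((contDiffAt_totalT hX).comp w hp))).div ((contDiffAt_totalJac hφ).comp w hp) hJ

lemma contDiffAt_newDerivX : ContDiffAt ℝ ∞ (fun y => newDerivX φ (p y) (a y) (b y)) w := by
  obtain ⟨hT, -, -⟩ := smooth_comps hφ
  exact ((hb.mul ((contDiffAt_totalT hT).comp w hp)).sub
    (ha.mul ((contDiffAt_totalX hT).comp w hp))).div ((contDiffAt_totalJac hφ).comp w hp) hJ

end Smoothness

lemma contDiffAt_newUt (hφ : ContDiffAt ℝ ∞ φ j.1) (hJ : totalJac φ j ≠ 0) :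
    ContDiffAt ℝ ∞ (newUt φ) j :=
  have hU := (smooth_comps hφ).2.2
  contDiffAt_newDerivT contDiffAt_id (contDiffAt_totalT hU) (contDiffAt_totalX hU) hφ hJ

lemma contDiffAt_newUx (hφ : ContDiffAt ℝ ∞ φ j.1) (hJ : totalJac φ j ≠ 0) :
    ContDiffAt ℝ ∞ (newUx φ) j :=
  have hU := (smooth_comps hφ).2.2
  contDiffAt_newDerivX contDiffAt_id (contDiffAt_totalT hU) (contDiffAt_totalX hU) hφ hJ

/-- `U_u - ũ_t̃ T_u - ũ_x̃ X_u`, the factor by which the prolongation of `φ` multiplies the contact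
form `du - u_t dt - u_x dx`. -/
noncomputable def contactFactor (φ : J0 → J0) (j : J1) : ℝ :=
  ∂ᵤ (compU φ) j.1 - newUt φ j * ∂ᵤ (compT φ) j.1 - newUx φ j * ∂ᵤ (compX φ) j.1

/-- The Hessian of `U - ũ_t̃ T - ũ_x̃ X` with `ũ_t̃` and `ũ_x̃` frozen at their values at `j`. -/
noncomputable def contactHess (φ : J0 → J0) (j : J1) (v w : J0) : ℝ :=
  hess (compU φ) j.1 v w - newUt φ j * hess (compT φ) j.1 v w
    - newUx φ j * hess (compX φ) j.1 v w

/-- The second total derivative `D_t D_t` of `U - ũ_t̃ T - ũ_x̃ X`, with `ũ_t̃` and `ũ_x̃` frozen at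
their values at the first-order jet. -/
noncomputable def contactTT (φ : J0 → J0) (k : J2) : ℝ :=
  contactHess φ k.1 (horT k.1) (horT k.1) + k.2.1 * contactFactor φ k.1

/-- The second total derivative `D_t D_x` of `U - ũ_t̃ T - ũ_x̃ X`, with `ũ_t̃` and `ũ_x̃` frozen at
their values at the first-order jet. -/
noncomputable def contactTX (φ : J0 → J0) (k : J2) : ℝ :=
  contactHess φ k.1 (horT k.1) (horX k.1) + k.2.2.1 * contactFactor φ k.1

/-- The second total derivative `D_x D_x` of `U - ũ_t̃ T - ũ_x̃ X`, with `ũ_t̃` and `ũ_x̃` frozen at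
their values at the first-order jet. -/
noncomputable def contactXX (φ : J0 → J0) (k : J2) : ℝ :=
  contactHess φ k.1 (horX k.1) (horX k.1) + k.2.2.2 * contactFactor φ k.1

lemma contactHess_comm (hφ : ContDiffAt ℝ ∞ φ j.1) (v w : J0) :
    contactHess φ j v w = contactHess φ j w v := by
  obtain ⟨hT, hX, hU⟩ := smooth_comps hφ
  unfold contactHess
  rw [hess_comm hT, hess_comm hX, hess_comm hU]

/-- Obtained by differentiating the two linear equations that determine `ũ_t̃` and `ũ_x̃`. -/
lemma fderiv_newUt_newUx (hφ : ContDiffAt ℝ ∞ φ j.1) (hJ : totalJac φ j ≠ 0) (v : J1) :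
    let a := contactHess φ j v.1 (horT j) + v.2.1 * contactFactor φ j
    let b := contactHess φ j v.1 (horX j) + v.2.2 * contactFactor φ j
    fderiv ℝ (newUt φ) j v = newDerivT φ j a b ∧ fderiv ℝ (newUx φ) j v = newDerivX φ j a b := by
  intro a b
  obtain ⟨hT, hX, hU⟩ := smooth_comps hφ
  have hUt := differentiableAt_of_smooth (contDiffAt_newUt hφ hJ)
  have hUx := differentiableAt_of_smooth (contDiffAt_newUx hφ hJ)
  have hJ' := (contDiffAt_totalJac hφ).continuousAt.eventually_ne hJ
  have htotalT : totalT (compU φ) =ᶠ[𝓝 j]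
      fun i => newUt φ i * totalT (compT φ) i + newUx φ i * totalT (compX φ) i :=
    hJ'.mono fun i hi => totalT_compU hi
  have htotalX : totalX (compU φ) =ᶠ[𝓝 j]
      fun i => newUt φ i * totalX (compT φ) i + newUx φ i * totalX (compX φ) i :=
    hJ'.mono fun i hi => totalX_compU hi
  have hdT := DFunLike.congr_fun (htotalT.fderiv_eq (𝕜 := ℝ)) v
  have hdX := DFunLike.congr_fun (htotalX.fderiv_eq (𝕜 := ℝ)) v
  rw [fderiv_fun_add (hUt.fun_mul (differentiableAt_totalT hT))
    (hUx.fun_mul (differentiableAt_totalT hX)), fderiv_fun_mul hUt (differentiableAt_totalT hT),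
    fderiv_fun_mul hUx (differentiableAt_totalT hX)] at hdT
  rw [fderiv_fun_add (hUt.fun_mul (differentiableAt_totalX hT))
    (hUx.fun_mul (differentiableAt_totalX hX)), fderiv_fun_mul hUt (differentiableAt_totalX hT),
    fderiv_fun_mul hUx (differentiableAt_totalX hX)] at hdX
  simp only [add_apply, smul_apply, smul_eq_mul, fderiv_totalT hT, fderiv_totalT hX,
    fderiv_totalT hU] at hdT
  simp only [add_apply, smul_apply, smul_eq_mul, fderiv_totalX hT, fderiv_totalX hX,
    fderiv_totalX hU] at hdX
  obtain ⟨hp, hq⟩ := newDeriv_unique hJ (a := a) (b := b) (p := fderiv ℝ (newUt φ) j v)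
    (q := fderiv ℝ (newUx φ) j v)
    (by unfold a contactHess contactFactor; linear_combination -hdT)
    (by unfold b contactHess contactFactor; linear_combination -hdX)
  exact ⟨hp.symm, hq.symm⟩

section

variable {k : J2} (hφ : ContDiffAt ℝ ∞ φ k.1.1) (hJ : totalJac φ k.1 ≠ 0)

include hφ hJ

lemma totalT'_newUt_newUx :
    totalT' (newUt φ) k = newDerivT φ k.1 (contactTT φ k) (contactTX φ k) ∧
      totalT' (newUx φ) k = newDerivX φ k.1 (contactTT φ k) (contactTX φ k) :=
  fderiv_newUt_newUx hφ hJ (horT k.1, (k.2.1, k.2.2.1))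

lemma totalX'_newUt_newUx :
    totalX' (newUt φ) k = newDerivT φ k.1 (contactTX φ k) (contactXX φ k) ∧
      totalX' (newUx φ) k = newDerivX φ k.1 (contactTX φ k) (contactXX φ k) := by
  have h := fderiv_newUt_newUx hφ hJ (horX k.1, (k.2.2.1, k.2.2.2))
  rw [contactHess_comm hφ _ (horT k.1)] at h
  exact h

lemma prolong2_tt :
    (prolong2 φ k).2.1 = (totalX (compX φ) k.1 ^ 2 * contactTT φ k
      - 2 * totalX (compX φ) k.1 * totalT (compX φ) k.1 * contactTX φ k
      + totalT (compX φ) k.1 ^ 2 * contactXX φ k) / totalJac φ k.1 ^ 2 := by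
  simp only [prolong2, totalT'_newUt_newUx hφ hJ, totalX'_newUt_newUx hφ hJ, newDerivT]
  field_simp
  ring

/-- `∂ũ_t̃/∂x̃`, which defines the mixed derivative in `prolong2`, equals `∂ũ_x̃/∂t̃`. -/
lemma prolong2_tx :
    (prolong2 φ k).2.2.1 = newDerivT φ k.1 (totalT' (newUx φ) k) (totalX' (newUx φ) k) := by
  simp only [prolong2, totalT'_newUt_newUx hφ hJ, totalX'_newUt_newUx hφ hJ, newDerivT, newDerivX]
  field_simp
  ring

lemma prolong2_xx :
    (prolong2 φ k).2.2.2 = (totalX (compT φ) k.1 ^ 2 * contactTT φ k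
      - 2 * totalX (compT φ) k.1 * totalT (compT φ) k.1 * contactTX φ k
      + totalT (compT φ) k.1 ^ 2 * contactXX φ k) / totalJac φ k.1 ^ 2 := by
  simp only [prolong2, totalT'_newUt_newUx hφ hJ, totalX'_newUt_newUx hφ hJ, newDerivX]
  field_simp
  ring

end

lemma fderiv_eq_dirDeriv_comps {z : J0} (hφ : DifferentiableAt ℝ φ z) (v : J0) :
    fderiv ℝ φ z v = (dirDeriv v (compT φ) z, dirDeriv v (compX φ) z, dirDeriv v (compU φ) z) := by
  have hT : HasFDerivAt (compT φ) _ z := hφ.hasFDerivAt.fst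
  have hX : HasFDerivAt (compX φ) _ z := hφ.hasFDerivAt.snd.fst
  have hU : HasFDerivAt (compU φ) _ z := hφ.hasFDerivAt.snd.snd
  simp [dirDeriv, hT.fderiv, hX.fderiv, hU.fderiv]

lemma contactFactor_ne_zero (hφ : DifferentiableAt ℝ φ j.1)
    (hsurj : Function.Surjective (fderiv ℝ φ j.1)) (hJ : totalJac φ j ≠ 0) :
    contactFactor φ j ≠ 0 := by
  intro hzero
  obtain ⟨⟨a, b, c⟩, hv⟩ := hsurj (0, 0, 1)
  rw [fderiv_eq_dirDeriv_comps hφ, Prod.mk.injEq, Prod.mk.injEq] at hv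
  obtain ⟨hT, hX, hU⟩ := hv
  rw [dirDeriv_coords] at hT hX hU
  have htotalT := totalT_compU hJ
  have htotalX := totalX_compU hJ
  simp only [totalT_eq, totalX_eq] at htotalT htotalX
  unfold contactFactor at hzero
  -- The form `dU - ũ_t̃ dT - ũ_x̃ dX` vanishes on both horizontal directions and on `∂_u`.
  have h_one : (1 : ℝ) = 0 := by
    linear_combination -hU + newUt φ j * hT + newUx φ j * hX + a * htotalT + b * htotalX
      + (c - a * j.2.1 - b * j.2.2) * hzero
  exact one_ne_zero h_one

end Prolongation

/-! ## Functoriality of prolongation -/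

section Composition

variable {φ ψ : J0 → J0} {j : J1}

lemma fderiv_horT (hφ : DifferentiableAt ℝ φ j.1) (hJ : totalJac φ j ≠ 0) :
    fderiv ℝ φ j.1 (horT j) = totalT (compT φ) j • horT (prolong1 φ j)
      + totalT (compX φ) j • horX (prolong1 φ j) := by
  have htotal : fderiv ℝ φ j.1 (horT j)
      = (totalT (compT φ) j, totalT (compX φ) j, totalT (compU φ) j) :=
    fderiv_eq_dirDeriv_comps hφ _
  rw [htotal, totalT_compU hJ]
  ext <;> simp [horT, horX, prolong1, mul_comm]

lemma fderiv_horX (hφ : DifferentiableAt ℝ φ j.1) (hJ : totalJac φ j ≠ 0) :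
    fderiv ℝ φ j.1 (horX j) = totalX (compT φ) j • horT (prolong1 φ j)
      + totalX (compX φ) j • horX (prolong1 φ j) := by
  have htotal : fderiv ℝ φ j.1 (horX j)
      = (totalX (compT φ) j, totalX (compX φ) j, totalX (compU φ) j) :=
    fderiv_eq_dirDeriv_comps hφ _
  rw [htotal, totalX_compU hJ]
  ext <;> simp [horT, horX, prolong1, mul_comm]

lemma totalT_comp {F : J0 → ℝ} (hF : DifferentiableAt ℝ F (φ j.1))
    (hφ : DifferentiableAt ℝ φ j.1) (hJ : totalJac φ j ≠ 0) :
    totalT (F ∘ φ) j = totalT (compT φ) j * totalT F (prolong1 φ j)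
      + totalT (compX φ) j * totalX F (prolong1 φ j) := by
  change fderiv ℝ (F ∘ φ) j.1 (horT j) = _
  rw [fderiv_comp j.1 hF hφ, ContinuousLinearMap.comp_apply, fderiv_horT hφ hJ, map_add, map_smul,
    map_smul]
  rfl

lemma totalX_comp {F : J0 → ℝ} (hF : DifferentiableAt ℝ F (φ j.1))
    (hφ : DifferentiableAt ℝ φ j.1) (hJ : totalJac φ j ≠ 0) :
    totalX (F ∘ φ) j = totalX (compT φ) j * totalT F (prolong1 φ j)
      + totalX (compX φ) j * totalX F (prolong1 φ j) := by
  change fderiv ℝ (F ∘ φ) j.1 (horX j) = _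
  rw [fderiv_comp j.1 hF hφ, ContinuousLinearMap.comp_apply, fderiv_horX hφ hJ, map_add, map_smul,
    map_smul]
  rfl

section

variable (hφ : ContDiffAt ℝ ∞ φ j.1) (hψ : ContDiffAt ℝ ∞ ψ (φ j.1)) (hJ : totalJac φ j ≠ 0)

include hφ hψ hJ

lemma total_comp_comps :
    (totalT (compT (ψ ∘ φ)) j = totalT (compT φ) j * totalT (compT ψ) (prolong1 φ j)
        + totalT (compX φ) j * totalX (compT ψ) (prolong1 φ j) ∧
      totalX (compT (ψ ∘ φ)) j = totalX (compT φ) j * totalT (compT ψ) (prolong1 φ j)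
        + totalX (compX φ) j * totalX (compT ψ) (prolong1 φ j)) ∧
    totalT (compX (ψ ∘ φ)) j = totalT (compT φ) j * totalT (compX ψ) (prolong1 φ j)
        + totalT (compX φ) j * totalX (compX ψ) (prolong1 φ j) ∧
      totalX (compX (ψ ∘ φ)) j = totalX (compT φ) j * totalT (compX ψ) (prolong1 φ j)
        + totalX (compX φ) j * totalX (compX ψ) (prolong1 φ j) := by
  obtain ⟨hT, hX, -⟩ := smooth_comps hψ
  have hφ' := differentiableAt_of_smooth hφ
  exact ⟨⟨totalT_comp (differentiableAt_of_smooth hT) hφ' hJ,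
      totalX_comp (differentiableAt_of_smooth hT) hφ' hJ⟩,
    totalT_comp (differentiableAt_of_smooth hX) hφ' hJ,
    totalX_comp (differentiableAt_of_smooth hX) hφ' hJ⟩

lemma totalJac_comp : totalJac (ψ ∘ φ) j = totalJac ψ (prolong1 φ j) * totalJac φ j := by
  obtain ⟨⟨hTT, hTX⟩, hXT, hXX⟩ := total_comp_comps hφ hψ hJ
  unfold totalJac
  rw [hTT, hTX, hXT, hXX]
  ring

lemma newDeriv_comp (a b : ℝ) :
    newDerivT (ψ ∘ φ) j (totalT (compT φ) j * a + totalT (compX φ) j * b)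
        (totalX (compT φ) j * a + totalX (compX φ) j * b) = newDerivT ψ (prolong1 φ j) a b ∧
      newDerivX (ψ ∘ φ) j (totalT (compT φ) j * a + totalT (compX φ) j * b)
        (totalX (compT φ) j * a + totalX (compX φ) j * b) = newDerivX ψ (prolong1 φ j) a b := by
  obtain ⟨⟨hTT, hTX⟩, hXT, hXX⟩ := total_comp_comps hφ hψ hJ
  unfold newDerivT newDerivX
  rw [totalJac_comp hφ hψ hJ, hTT, hTX, hXT, hXX, ← mul_div_mul_right _ (totalJac ψ _) hJ,
    ← mul_div_mul_right _ (totalJac ψ _) hJ]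
  constructor <;> congr 1 <;> unfold totalJac <;> ring

lemma newUt_newUx_comp :
    newUt (ψ ∘ φ) j = newUt ψ (prolong1 φ j) ∧ newUx (ψ ∘ φ) j = newUx ψ (prolong1 φ j) := by
  have hφ' := differentiableAt_of_smooth hφ
  have hU := differentiableAt_of_smooth (smooth_comps hψ).2.2
  have h := newDeriv_comp hφ hψ hJ (totalT (compU ψ) (prolong1 φ j))
    (totalX (compU ψ) (prolong1 φ j))
  rwa [← totalT_comp hU hφ' hJ, ← totalX_comp hU hφ' hJ] at h

lemma prolong1_comp : prolong1 (ψ ∘ φ) j = prolong1 ψ (prolong1 φ j) :=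
  Prod.ext rfl (Prod.ext_iff.2 (newUt_newUx_comp hφ hψ hJ))

end

lemma hasFDerivAt_prolong1 (hφ : ContDiffAt ℝ ∞ φ j.1) (hJ : totalJac φ j ≠ 0) :
    HasFDerivAt (prolong1 φ) (((fderiv ℝ φ j.1).comp (.fst ℝ J0 (ℝ × ℝ))).prod
      ((fderiv ℝ (newUt φ) j).prod (fderiv ℝ (newUx φ) j))) j :=
  ((differentiableAt_of_smooth hφ).hasFDerivAt.comp j hasFDerivAt_fst).prodMk
    ((differentiableAt_of_smooth (contDiffAt_newUt hφ hJ)).hasFDerivAt.prodMk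
      (differentiableAt_of_smooth (contDiffAt_newUx hφ hJ)).hasFDerivAt)

/-- The horizontal direction at a second-order jet that lifts `horT`, so that
`totalT' F k = fderiv ℝ F k.1 (horT' k)`. -/
def horT' (k : J2) : J1 := (horT k.1, (k.2.1, k.2.2.1))

/-- The horizontal direction at a second-order jet that lifts `horX`, so that
`totalX' F k = fderiv ℝ F k.1 (horX' k)`. -/
def horX' (k : J2) : J1 := (horX k.1, (k.2.2.1, k.2.2.2))

section

variable {k : J2} (hφ : ContDiffAt ℝ ∞ φ k.1.1) (hJ : totalJac φ k.1 ≠ 0)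

include hφ hJ

lemma fderiv_prolong1_horT' :
    fderiv ℝ (prolong1 φ) k.1 (horT' k) = totalT (compT φ) k.1 • horT' (prolong2 φ k)
      + totalT (compX φ) k.1 • horX' (prolong2 φ k) := by
  have hUt := (newDeriv_solves hJ (totalT' (newUt φ) k) (totalX' (newUt φ) k)).1
  have hUx := (newDeriv_solves hJ (totalT' (newUx φ) k) (totalX' (newUx φ) k)).1
  rw [← prolong2_tx hφ hJ] at hUx
  rw [(hasFDerivAt_prolong1 hφ hJ).fderiv]
  exact Prod.ext (fderiv_horT (differentiableAt_of_smooth hφ) hJ)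
    (Prod.ext_iff.2 ⟨hUt.symm, hUx.symm⟩)

lemma fderiv_prolong1_horX' :
    fderiv ℝ (prolong1 φ) k.1 (horX' k) = totalX (compT φ) k.1 • horT' (prolong2 φ k)
      + totalX (compX φ) k.1 • horX' (prolong2 φ k) := by
  have hUt := (newDeriv_solves hJ (totalT' (newUt φ) k) (totalX' (newUt φ) k)).2
  have hUx := (newDeriv_solves hJ (totalT' (newUx φ) k) (totalX' (newUx φ) k)).2
  rw [← prolong2_tx hφ hJ] at hUx
  rw [(hasFDerivAt_prolong1 hφ hJ).fderiv]
  exact Prod.ext (fderiv_horX (differentiableAt_of_smooth hφ) hJ)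
    (Prod.ext_iff.2 ⟨hUt.symm, hUx.symm⟩)

lemma total'_comp {F : J1 → ℝ} (hF : DifferentiableAt ℝ F (prolong1 φ k.1)) :
    totalT' (F ∘ prolong1 φ) k = totalT (compT φ) k.1 * totalT' F (prolong2 φ k)
        + totalT (compX φ) k.1 * totalX' F (prolong2 φ k) ∧
      totalX' (F ∘ prolong1 φ) k = totalX (compT φ) k.1 * totalT' F (prolong2 φ k)
        + totalX (compX φ) k.1 * totalX' F (prolong2 φ k) := by
  have hcomp (v : J1) : fderiv ℝ (F ∘ prolong1 φ) k.1 v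
      = fderiv ℝ F (prolong1 φ k.1) (fderiv ℝ (prolong1 φ) k.1 v) := by
    rw [fderiv_comp k.1 hF (hasFDerivAt_prolong1 hφ hJ).differentiableAt]
    rfl
  constructor
  · refine (hcomp (horT' k)).trans ?_
    rw [fderiv_prolong1_horT' hφ hJ, map_add, map_smul, map_smul]
    rfl
  · refine (hcomp (horX' k)).trans ?_
    rw [fderiv_prolong1_horX' hφ hJ, map_add, map_smul, map_smul]
    rfl

end

lemma prolong2_comp {k : J2} (hφ : ∀ᶠ z in 𝓝 k.1.1, ContDiffAt ℝ ∞ φ z)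
    (hψ : ∀ᶠ z in 𝓝 (φ k.1.1), ContDiffAt ℝ ∞ ψ z)
    (hJ : totalJac φ k.1 ≠ 0) (hJ' : totalJac ψ (prolong1 φ k.1) ≠ 0) :
    prolong2 (ψ ∘ φ) k = prolong2 ψ (prolong2 φ k) := by
  have hφk := hφ.self_of_nhds
  have hψk := hψ.self_of_nhds
  have hfst : ContinuousAt (fun j : J1 => j.1) k.1 := continuousAt_fst
  have hφfst : ContinuousAt (fun j : J1 => φ j.1) k.1 :=
    ContinuousAt.comp (g := φ) hφk.continuousAt hfst
  have hcomp : ∀ᶠ j in 𝓝 k.1, newUt (ψ ∘ φ) j = newUt ψ (prolong1 φ j) ∧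
      newUx (ψ ∘ φ) j = newUx ψ (prolong1 φ j) := by
    filter_upwards [hfst.eventually hφ, hφfst.eventually hψ,
      (contDiffAt_totalJac hφk).continuousAt.eventually_ne hJ] with j h₁ h₂ h₃
      using newUt_newUx_comp h₁ h₂ h₃
  have hUt : newUt (ψ ∘ φ) =ᶠ[𝓝 k.1] newUt ψ ∘ prolong1 φ := hcomp.mono fun _ h => h.1
  have hUx : newUx (ψ ∘ φ) =ᶠ[𝓝 k.1] newUx ψ ∘ prolong1 φ := hcomp.mono fun _ h => h.2
  obtain ⟨hUtt, hUtx⟩ :=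
    total'_comp hφk hJ (differentiableAt_of_smooth (contDiffAt_newUt (j := prolong1 φ k.1) hψk hJ'))
  obtain ⟨hUxt, hUxx⟩ :=
    total'_comp hφk hJ (differentiableAt_of_smooth (contDiffAt_newUx (j := prolong1 φ k.1) hψk hJ'))
  have hnewUt := newDeriv_comp hφk hψk hJ
    (totalT' (newUt ψ) (prolong2 φ k)) (totalX' (newUt ψ) (prolong2 φ k))
  have hnewUx := newDeriv_comp hφk hψk hJ
    (totalT' (newUx ψ) (prolong2 φ k)) (totalX' (newUx ψ) (prolong2 φ k))
  rw [← hUtt, ← hUtx] at hnewUt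
  rw [← hUxt, ← hUxx] at hnewUx
  unfold prolong2
  rw [prolong1_comp hφk hψk hJ]
  unfold totalT' totalX' at hnewUt hnewUx ⊢
  rw [hUt.fderiv_eq, hUx.fderiv_eq, hnewUt.1, hnewUt.2, hnewUx.2]
  rfl

section Congruence

variable (h : φ =ᶠ[𝓝 j.1] ψ)

include h

lemma totalJac_congr : totalJac φ j = totalJac ψ j := by
  have hT : compT φ =ᶠ[𝓝 j.1] compT ψ := h.fun_comp Prod.fst
  have hX : compX φ =ᶠ[𝓝 j.1] compX ψ := h.fun_comp fun z => z.2.1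
  simp only [totalJac, totalT_congr hT, totalX_congr hT, totalT_congr hX, totalX_congr hX]

lemma newDeriv_congr (a b : ℝ) :
    newDerivT φ j a b = newDerivT ψ j a b ∧ newDerivX φ j a b = newDerivX ψ j a b := by
  have hT : compT φ =ᶠ[𝓝 j.1] compT ψ := h.fun_comp Prod.fst
  have hX : compX φ =ᶠ[𝓝 j.1] compX ψ := h.fun_comp fun z => z.2.1
  simp only [newDerivT, newDerivX, totalJac_congr h, totalT_congr hT, totalX_congr hT,
    totalT_congr hX, totalX_congr hX, and_self]

lemma newUt_newUx_congr : newUt φ j = newUt ψ j ∧ newUx φ j = newUx ψ j := by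
  have hU : compU φ =ᶠ[𝓝 j.1] compU ψ := h.fun_comp fun z => z.2.2
  simp only [newUt, newUx, newDeriv_congr h, totalT_congr hU, totalX_congr hU, and_self]

lemma prolong1_congr : prolong1 φ j = prolong1 ψ j :=
  Prod.ext h.self_of_nhds (Prod.ext_iff.2 (newUt_newUx_congr h))

end Congruence

lemma prolong2_congr {k : J2} (h : φ =ᶠ[𝓝 k.1.1] ψ) : prolong2 φ k = prolong2 ψ k := by
  have hfst : Filter.Tendsto (fun j : J1 => j.1) (𝓝 k.1) (𝓝 k.1.1) := continuousAt_fst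
  have hnear := hfst.eventually h.eventually_nhds
  have hUt : newUt φ =ᶠ[𝓝 k.1] newUt ψ := hnear.mono fun _ hi => (newUt_newUx_congr hi).1
  have hUx : newUx φ =ᶠ[𝓝 k.1] newUx ψ := hnear.mono fun _ hi => (newUt_newUx_congr hi).2
  simp only [prolong2, totalT', totalX', prolong1_congr h, hUt.fderiv_eq, hUx.fderiv_eq,
    newDeriv_congr h]

end Composition

/-! ## Determining equations of admissible transformations -/

namespace PointTransformation

variable {E : Type} [NormedAddCommGroup E] [NormedSpace ℝ E] (φ : PointTransformation E) {z : E}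

lemma contDiffAt (hz : z ∈ φ.source) : ContDiffAt ℝ ∞ φ.toFun z :=
  φ.smooth_toFun.contDiffAt (φ.open_source.mem_nhds hz)

lemma fderiv_surjective (hz : z ∈ φ.source) : Function.Surjective (fderiv ℝ φ.toFun z) := by
  have hmem : φ.toFun z ∈ φ.target := φ.map_source' hz
  have hinv : φ.invFun (φ.toFun z) = z := φ.left_inv' hz
  have hφ : DifferentiableAt ℝ φ.toFun (φ.invFun (φ.toFun z)) := by
    rw [hinv]
    exact differentiableAt_of_smooth (φ.contDiffAt hz)
  have hφinv : DifferentiableAt ℝ φ.invFun (φ.toFun z) :=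
    differentiableAt_of_smooth (φ.inverse.contDiffAt hmem)
  have hid : φ.toFun ∘ φ.invFun =ᶠ[𝓝 (φ.toFun z)] id := by
    filter_upwards [φ.open_target.mem_nhds hmem] with y hy using φ.right_inv' hy
  have hcomp := hid.fderiv_eq (𝕜 := ℝ)
  rw [fderiv_comp _ hφ hφinv, fderiv_id, hinv] at hcomp
  exact fun v => ⟨_, DFunLike.congr_fun hcomp v⟩

end PointTransformation

namespace ArbElem

variable (θ : ArbElem) {b : ℝ × ℝ}

lemma contDiffAt_f (hb : b ∈ θ.dom) : ContDiffAt ℝ ∞ θ.f b :=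
  θ.smooth_f.contDiffAt (θ.isOpen_dom.mem_nhds hb)

lemma contDiffAt_g (hb : b ∈ θ.dom) : ContDiffAt ℝ ∞ θ.g b :=
  θ.smooth_g.contDiffAt (θ.isOpen_dom.mem_nhds hb)

end ArbElem

lemma continuous_jetArg : Continuous jetArg := by unfold jetArg; fun_prop

lemma eventually_forall_of_nearJet {j : J1} {p : J2 → Prop} (h : ∀ᶠ k in nearJet j, p k) :
    ∀ᶠ i in 𝓝 j, ∀ s, p (i, s) := by
  obtain ⟨S, hS, hp⟩ := Filter.mem_comap.mp h
  filter_upwards [hS] with i hi s using hp (show (i, s).1 ∈ S from hi)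

/-- The determining equations for an admissible transformation `φ` between the equations with
arbitrary elements `θ` and `θ'`, at the first-order jet `j`. They arise from the condition that
`prolong2 φ` maps one equation to the other by splitting with respect to `u_tx` and `u_xx`. -/
structure DeterminingEqs (θ θ' : ArbElem) (φ : PointTransformation J0) (j : J1) : Prop where
  mem_source : j.1 ∈ φ.source
  mem_dom : jetArg j ∈ θ.dom
  mem_dom' : jetArg (prolong1 φ.toFun j) ∈ θ'.dom
  jac : totalJac φ.toFun j ≠ 0
  mixed' : totalX (compX φ.toFun) j * totalT (compX φ.toFun) j
    = θ'.f (jetArg (prolong1 φ.toFun j)) * totalT (compT φ.toFun) j * totalX (compT φ.toFun) j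
  mixed : totalT (compT φ.toFun) j * totalT (compX φ.toFun) j
    = θ.f (jetArg j) * totalX (compT φ.toFun) j * totalX (compX φ.toFun) j
  offDiagonal : totalT (compX φ.toFun) j ^ 2
    = θ.f (jetArg j) * θ'.f (jetArg (prolong1 φ.toFun j)) * totalX (compT φ.toFun) j ^ 2
  diagonal : θ'.f (jetArg (prolong1 φ.toFun j)) * totalT (compT φ.toFun) j ^ 2
    = θ.f (jetArg j) * totalX (compX φ.toFun) j ^ 2
  source : (totalX (compX φ.toFun) j ^ 2
      - θ'.f (jetArg (prolong1 φ.toFun j)) * totalX (compT φ.toFun) j ^ 2)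
    * (contactFactor φ.toFun j * θ.g (jetArg j) + contactHess φ.toFun j (horT j) (horT j)
      - θ.f (jetArg j) * contactHess φ.toFun j (horX j) (horX j))
    = totalJac φ.toFun j ^ 2 * θ'.g (jetArg (prolong1 φ.toFun j))

lemma symbol_relations {A B C D f f' : ℝ} (hJ : A * D - B * C ≠ 0) (hmixed : D * C = f' * A * B)
    (hsum : D ^ 2 * f + C ^ 2 = f' * (B ^ 2 * f + A ^ 2)) :
    A * C = f * B * D ∧ C ^ 2 = f * f' * B ^ 2 ∧ f' * A ^ 2 = f * D ^ 2 := by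
  have hcross : A * C - f * B * D = 0 := by
    refine (mul_eq_zero.mp ?_).resolve_left hJ
    linear_combination (A ^ 2 + f * B ^ 2) * hmixed - A * B * hsum
  have hdiag : f' * A ^ 2 - f * D ^ 2 = 0 := by
    by_contra h
    have hB : B * (f' * A ^ 2 - f * D ^ 2) = 0 := by linear_combination D * hcross - A * hmixed
    have hA : A * (f' * A ^ 2 - f * D ^ 2) = 0 := by
      linear_combination C * hcross + f * B * hmixed - A * hsum
    have hA₀ : A = 0 := (mul_eq_zero.mp hA).resolve_right h
    have hB₀ : B = 0 := (mul_eq_zero.mp hB).resolve_right h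
    exact hJ (by rw [hA₀, hB₀]; ring)
  exact ⟨by linear_combination hcross, by linear_combination hsum + hdiag,
    by linear_combination hdiag⟩

lemma determiningEqs_of_mapsTo {θ θ' : ArbElem} {φ : PointTransformation J0} {j : J1}
    (hj : j.1 ∈ φ.source) (hdom : jetArg j ∈ θ.dom) (hJ : totalJac φ.toFun j ≠ 0)
    (h : ∀ s, (j, s) ∈ θ.eqn → prolong2 φ.toFun (j, s) ∈ θ'.eqn) : DeterminingEqs θ θ' φ j := by
  have hφ := φ.contDiffAt hj
  have hΔ := contactFactor_ne_zero (differentiableAt_of_smooth hφ) (φ.fderiv_surjective hj) hJ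
  have heqn (b c : ℝ) := h (θ.f (jetArg j) * c + θ.g (jetArg j), b, c) ⟨hdom, rfl⟩
  have hdom' : jetArg (prolong1 φ.toFun j) ∈ θ'.dom := (heqn 0 0).1
  have hval (b c : ℝ) := (heqn b c).2
  simp only [prolong2_tt (k := (j, _)) hφ hJ, prolong2_xx (k := (j, _)) hφ hJ, contactTT,
    contactTX, contactXX, show ∀ s, (prolong2 φ.toFun (j, s)).1 = prolong1 φ.toFun j from
      fun _ => rfl] at hval
  set f' := θ'.f (jetArg (prolong1 φ.toFun j))
  have hpoly (b c : ℝ) := ((div_eq_iff (pow_ne_zero 2 hJ)).1 (hval b c)).trans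
    (by rw [add_mul, mul_assoc, div_mul_cancel₀ _ (pow_ne_zero 2 hJ)])
  have hconst := hpoly 0 0
  have hmixed : totalX (compX φ.toFun) j * totalT (compX φ.toFun) j
      = f' * totalT (compT φ.toFun) j * totalX (compT φ.toFun) j := by
    refine mul_left_cancel₀ hΔ ?_
    linear_combination (hconst - hpoly 1 0) / 2
  have hsum : totalX (compX φ.toFun) j ^ 2 * θ.f (jetArg j) + totalT (compX φ.toFun) j ^ 2
      = f' * (totalX (compT φ.toFun) j ^ 2 * θ.f (jetArg j) + totalT (compT φ.toFun) j ^ 2) := by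
    refine mul_left_cancel₀ hΔ ?_
    linear_combination hpoly 0 1 - hconst
  obtain ⟨hcross, hoff, hdiag⟩ := symbol_relations hJ hmixed hsum
  refine ⟨hj, hdom, hdom', hJ, hmixed, hcross, hoff, hdiag, ?_⟩
  linear_combination hconst + 2 * contactHess φ.toFun j (horT j) (horX j) * hmixed
    + contactHess φ.toFun j (horX j) (horX j) * (hdiag - hoff)

lemma AdmissibleAt.determiningEqs {θ θ' : ArbElem} {φ : PointTransformation J0} {j : J1}
    (h : AdmissibleAt θ θ' φ j) : ∀ᶠ i in 𝓝 j, DeterminingEqs θ θ' φ i := by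
  obtain ⟨hj, hdom, hJ, heqn⟩ := h
  have hfst : ContinuousAt (fun i : J1 => i.1) j := continuousAt_fst
  filter_upwards [hfst.eventually (φ.open_source.mem_nhds hj),
    continuous_jetArg.continuousAt.eventually (θ.isOpen_dom.mem_nhds hdom),
    (contDiffAt_totalJac (φ.contDiffAt hj)).continuousAt.eventually_ne hJ,
    eventually_forall_of_nearJet heqn] with i hi hidom hiJ hieqn
  exact determiningEqs_of_mapsTo hi hidom hiJ fun s => (hieqn s).1

/-! ## Functions of an affine argument -/

lemma quadratic_eventually_zero {a b c s₀ : ℝ} (h : ∀ᶠ s in 𝓝 s₀, a * s ^ 2 + b * s + c = 0) :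
    a = 0 ∧ b = 0 ∧ c = 0 := by
  obtain ⟨ε, hε, hs⟩ := Metric.eventually_nhds_iff.mp h
  have hmid := hs (y := s₀) (by simpa using hε)
  have hright := hs (y := s₀ + ε / 2) (by simpa [abs_of_pos hε] using half_lt_self hε)
  have hleft := hs (y := s₀ - ε / 2) (by simpa [abs_of_pos hε] using half_lt_self hε)
  have ha : a = 0 := by
    refine (mul_eq_zero.mp ?_).resolve_right (pow_ne_zero 2 hε.ne')
    linear_combination 2 * hright + 2 * hleft - 4 * hmid
  have hb : b = 0 := by
    refine (mul_eq_zero.mp ?_).resolve_right hε.ne'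
    linear_combination hright - hleft - 2 * s₀ * ε * ha
  exact ⟨ha, hb, by linear_combination hmid - s₀ ^ 2 * ha - s₀ * hb⟩

lemma affine_eventually_zero {b c s₀ : ℝ} (h : ∀ᶠ s in 𝓝 s₀, b * s + c = 0) : b = 0 ∧ c = 0 :=
  (quadratic_eventually_zero (a := 0) (h.mono fun s hs => by linear_combination hs)).2

lemma deriv_deriv_quadratic {g : ℝ → ℝ} {a b c r₀ : ℝ}
    (h : ∀ᶠ r in 𝓝 r₀, g r = a * r ^ 2 + b * r + c) : deriv (deriv g) r₀ = 2 * a := by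
  have hquad (r : ℝ) : HasDerivAt (fun r : ℝ => a * r ^ 2 + b * r + c) (2 * a * r + b) r := by
    refine ((((hasDerivAt_pow 2 r).const_mul a).add
      ((hasDerivAt_id r).const_mul b)).add_const c).congr_deriv ?_
    simp only [Nat.cast_ofNat, Nat.add_one_sub_one, pow_one, mul_one]
    ring
  have hlin : HasDerivAt (fun r : ℝ => 2 * a * r + b) (2 * a) r₀ := by
    simpa using ((hasDerivAt_id r₀).const_mul (2 * a)).add_const b
  have hderiv : deriv g =ᶠ[𝓝 r₀] fun r => 2 * a * r + b :=
    (Filter.EventuallyEq.deriv h).trans (.of_forall fun r => (hquad r).deriv)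
  rw [hderiv.deriv_eq, hlin.deriv]

section AffineArgument

variable {α β γ s₀ r₀ : ℝ}

lemma eventually_affine_section {P : ℝ × ℝ → Prop} (hγ : γ ≠ 0)
    (h : ∀ᶠ q in 𝓝 ((s₀, r₀) : ℝ × ℝ), P q) :
    ∀ᶠ p in 𝓝 (α + β * r₀ + γ * s₀), P ((p - (α + β * r₀)) / γ, r₀) := by
  have hcont : ContinuousAt (fun p : ℝ => (((p - (α + β * r₀)) / γ, r₀) : ℝ × ℝ))
    (α + β * r₀ + γ * s₀) := by fun_prop
  refine hcont.eventually ?_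
  simpa only [add_sub_cancel_left, mul_div_cancel_left₀ _ hγ] using h

lemma tendsto_affine_left :
    Filter.Tendsto (fun r => α + β * r + γ * s₀) (𝓝 r₀) (𝓝 (α + β * r₀ + γ * s₀)) :=
  (by fun_prop : Continuous fun r => α + β * r + γ * s₀).tendsto r₀

lemma eventually_const_of_mul_eq_const {f f' : ℝ → ℝ} {c : ℝ} (hγ : γ ≠ 0) (hc : c ≠ 0)
    (h : ∀ᶠ q in 𝓝 ((s₀, r₀) : ℝ × ℝ), f q.2 * f' (α + β * q.2 + γ * q.1) = c) :
    (∀ᶠ r in 𝓝 r₀, f r = f r₀) ∧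
      ∀ᶠ p in 𝓝 (α + β * r₀ + γ * s₀), f' p = f' (α + β * r₀ + γ * s₀) := by
  have h₀ : f r₀ * f' (α + β * r₀ + γ * s₀) = c := h.self_of_nhds
  obtain ⟨hf, hf'⟩ := mul_ne_zero_iff.1 (h₀ ▸ hc)
  have hconst' : ∀ᶠ p in 𝓝 (α + β * r₀ + γ * s₀), f' p = f' (α + β * r₀ + γ * s₀) := by
    filter_upwards [eventually_affine_section hγ h] with p hp
    rw [mul_div_cancel₀ _ hγ, add_sub_cancel] at hp
    exact mul_left_cancel₀ hf (hp.trans h₀.symm)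
  have hline : ContinuousAt (fun r : ℝ => ((s₀, r) : ℝ × ℝ)) r₀ := by fun_prop
  refine ⟨?_, hconst'⟩
  filter_upwards [hline.eventually h, tendsto_affine_left.eventually hconst'] with r hr hr'
  rw [hr'] at hr
  exact mul_right_cancel₀ hf' (hr.trans h₀.symm)

lemma quadratic_of_affine_argument {G H : ℝ → ℝ} {a κ : ℝ} (hγ : γ ≠ 0)
    (h : ∀ᶠ q in 𝓝 ((s₀, r₀) : ℝ × ℝ),
      G (α + β * q.2 + γ * q.1) = H q.2 + a * q.1 + κ * q.1 ^ 2) :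
    β * κ = 0 ∧ (∃ b c, ∀ᶠ r in 𝓝 r₀, H r = b * r + c) ∧
      ∃ b c, ∀ᶠ p in 𝓝 (α + β * r₀ + γ * s₀), G p = κ / γ ^ 2 * p ^ 2 + b * p + c := by
  obtain ⟨b, c, hG⟩ :
      ∃ b c, ∀ᶠ p in 𝓝 (α + β * r₀ + γ * s₀), G p = κ / γ ^ 2 * p ^ 2 + b * p + c := by
    refine ⟨a / γ - 2 * κ * (α + β * r₀) / γ ^ 2,
      H r₀ - a * (α + β * r₀) / γ + κ * (α + β * r₀) ^ 2 / γ ^ 2, ?_⟩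
    filter_upwards [eventually_affine_section hγ h] with p hp
    rw [mul_div_cancel₀ _ hγ, add_sub_cancel] at hp
    rw [hp]
    field_simp
    ring
  have haff : Filter.Tendsto (fun q : ℝ × ℝ => α + β * q.2 + γ * q.1) (𝓝 (s₀, r₀))
      (𝓝 (α + β * r₀ + γ * s₀)) :=
    (by fun_prop : Continuous fun q : ℝ × ℝ => α + β * q.2 + γ * q.1).tendsto (s₀, r₀)
  have hquad : ∀ᶠ q in 𝓝 ((s₀, r₀) : ℝ × ℝ), κ / γ ^ 2 * (α + β * q.2 + γ * q.1) ^ 2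
      + b * (α + β * q.2 + γ * q.1) + c = H q.2 + a * q.1 + κ * q.1 ^ 2 := by
    filter_upwards [h, haff.eventually hG] with q hq hGq using hGq.symm.trans hq
  have hcross : β * κ = 0 := by
    rw [nhds_prod_eq, Filter.eventually_swap_iff] at hquad
    obtain ⟨hlin, -⟩ := affine_eventually_zero (s₀ := r₀) (b := 2 * κ * β / γ)
      (c := 2 * κ * α / γ + b * γ - a) (by
        filter_upwards [hquad.curry] with r hr
        obtain ⟨-, hs, -⟩ := quadratic_eventually_zero (s₀ := s₀) (a := 0)
          (b := 2 * κ * β / γ * r + (2 * κ * α / γ + b * γ - a))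
          (c := κ / γ ^ 2 * (α + β * r) ^ 2 + b * (α + β * r) + c - H r) (by
            filter_upwards [hr] with s hs
            simp only [Prod.fst_swap, Prod.snd_swap] at hs
            field_simp at hs ⊢
            linear_combination hs)
        exact hs)
    field_simp at hlin
    linear_combination hlin / 2
  refine ⟨hcross, ⟨b * β, κ / γ ^ 2 * (α + γ * s₀) ^ 2 + b * (α + γ * s₀) + c - a * s₀
    - κ * s₀ ^ 2, ?_⟩, b, c, hG⟩
  have hline : ContinuousAt (fun r : ℝ => ((s₀, r) : ℝ × ℝ)) r₀ := by fun_prop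
  filter_upwards [hline.eventually hquad] with r hr
  linear_combination -hr + (r ^ 2 * β + 2 * r * (α + γ * s₀)) / γ ^ 2 * hcross

end AffineArgument

/-! ## Derivatives with respect to `u_x` -/

lemma hasDerivAt_comp_snd {F : ℝ × ℝ → ℝ} {a p : ℝ → ℝ} {s p' : ℝ}
    (hF : DifferentiableAt ℝ F (a s, p s)) (ha : HasDerivAt a 0 s) (hp : HasDerivAt p p' s) :
    HasDerivAt (fun s => F (a s, p s)) (p' * partialUx F (a s, p s)) s := by
  have h := hF.hasFDerivAt.comp_hasDerivAt s (ha.prodMk hp)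
  have hsmul : ((0, p') : ℝ × ℝ) = p' • (0, 1) := by simp
  rwa [hsmul, map_smul] at h

lemma hasDerivAt_partialUx {F : ℝ × ℝ → ℝ} {b : ℝ × ℝ} (hF : DifferentiableAt ℝ F b) :
    HasDerivAt (fun r => F (b.1, r)) (partialUx F b) b.2 := by
  simpa using hasDerivAt_comp_snd (a := fun _ => b.1) (p := id) (s := b.2) hF
    (hasDerivAt_const _ _) (hasDerivAt_id _)

lemma contDiffAt_partialUx {F : ℝ × ℝ → ℝ} {b : ℝ × ℝ} (hF : ContDiffAt ℝ ∞ F b) :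
    ContDiffAt ℝ ∞ (partialUx F) b :=
  contDiffAt_dirDeriv hF _

lemma partialUx_partialUx {F : ℝ × ℝ → ℝ} {b : ℝ × ℝ} (hF : ∀ᶠ c in 𝓝 b, ContDiffAt ℝ ∞ F c) :
    partialUx (partialUx F) b = deriv (deriv fun r => F (b.1, r)) b.2 := by
  have hline : ContinuousAt (fun r : ℝ => ((b.1, r) : ℝ × ℝ)) b.2 := by fun_prop
  have hderiv : deriv (fun r => F (b.1, r)) =ᶠ[𝓝 b.2] fun r => partialUx F (b.1, r) := by
    filter_upwards [hline.eventually hF] with r hr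
    exact (hasDerivAt_partialUx (b := (b.1, r)) (differentiableAt_of_smooth hr)).deriv
  have hF' := differentiableAt_of_smooth (contDiffAt_partialUx hF.self_of_nhds)
  rw [hderiv.deriv_eq, (hasDerivAt_partialUx hF').deriv]

lemma not_linear_of_mem_waveClass {θ : ArbElem} (hθ : θ ∈ waveClass) {j : J1} :
    ¬∀ᶠ i in 𝓝 j, jetArg i ∈ θ.dom ∧ partialUx θ.f (jetArg i) = 0 ∧
      partialUx (partialUx θ.g) (jetArg i) = 0 := by
  intro h
  obtain ⟨O, hO, hopen, hj⟩ := mem_nhds_iff.mp h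
  let ι : ℝ × ℝ → J1 := fun b => ((j.1.1, b.1, j.1.2.2), (j.2.1, b.2))
  have hι : Continuous ι := by fun_prop
  obtain ⟨b, hb, hne⟩ := hθ.2 (ι ⁻¹' O) (hopen.preimage hι) ⟨jetArg j, hj⟩
    (fun b hb => (hO hb).1)
  exact hne (Prod.ext (hO hb).2.1 (hO hb).2.2)

/-! ## Functions that are locally constant along a direction -/

/-- Near `z` the function `F` is smooth and its derivative in the direction `v` vanishes. -/
def ConstAlong (v : J0) (F : J0 → ℝ) (z : J0) : Prop :=
  ∀ᶠ y in 𝓝 z, ContDiffAt ℝ ∞ F y ∧ dirDeriv v F y = 0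

lemma eventually_const_of_hasDerivAt_zero {g : ℝ → ℝ} {s₀ : ℝ}
    (h : ∀ᶠ s in 𝓝 s₀, HasDerivAt g 0 s) : ∀ᶠ s in 𝓝 s₀, g s = g s₀ := by
  obtain ⟨ε, hε, hs⟩ := Metric.eventually_nhds_iff_ball.mp h
  filter_upwards [Metric.ball_mem_nhds s₀ hε] with s hmem
  exact Metric.isOpen_ball.is_const_of_deriv_eq_zero (convex_ball s₀ ε).isPreconnected
    (fun x hx => (hs x hx).differentiableAt.differentiableWithinAt)
    (fun x hx => (hs x hx).deriv) hmem (Metric.mem_ball_self hε)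

lemma tendsto_line (z v : J0) : Filter.Tendsto (fun s : ℝ => z + s • v) (𝓝 0) (𝓝 z) := by
  have h : Continuous fun s : ℝ => z + s • v := by fun_prop
  simpa using h.tendsto 0

lemma hasDerivAt_line_zero {F : J0 → ℝ} {z : J0} (hF : DifferentiableAt ℝ F z) (v : J0) :
    HasDerivAt (fun s : ℝ => F (z + s • v)) (dirDeriv v F z) 0 := by
  simpa using hasDerivAt_line (z := z) (v := v) (s := 0) (by simpa using hF)

namespace ConstAlong

variable {v : J0} {F : J0 → ℝ} {z : J0}

lemma dirDeriv_right (h : ConstAlong v F z) (w : J0) : dirDeriv w (dirDeriv v F) z = 0 :=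
  dirDeriv_eventually_const (h.mono fun _ hy => hy.2) w

lemma dirDeriv_left (h : ConstAlong v F z) (w : J0) : dirDeriv v (dirDeriv w F) z = 0 := by
  rw [dirDeriv_comm h.self_of_nhds.1, h.dirDeriv_right]

lemma of_dirDeriv (h : ConstAlong v F z) (w : J0) : ConstAlong v (dirDeriv w F) z :=
  (Filter.Eventually.eventually_nhds h).mono fun _ hy =>
    ⟨contDiffAt_dirDeriv hy.self_of_nhds.1 w, dirDeriv_left hy w⟩

lemma eventually_eq_on_line (h : ConstAlong v F z) : ∀ᶠ s in 𝓝 (0 : ℝ), F (z + s • v) = F z := by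
  have hderiv : ∀ᶠ s in 𝓝 (0 : ℝ), HasDerivAt (fun s : ℝ => F (z + s • v)) 0 s := by
    filter_upwards [(tendsto_line z v).eventually h] with s hs
    exact hs.2 ▸ hasDerivAt_line (differentiableAt_of_smooth hs.1)
  simpa using eventually_const_of_hasDerivAt_zero hderiv

end ConstAlong

/-! ## Point transformations projectable to the space of `(t, x)` -/

/-- Near `z` the map `φ` is smooth and its components `T` and `X` do not depend on `u`. -/
def Projectable (φ : J0 → J0) (z : J0) : Prop :=
  ∀ᶠ y in 𝓝 z, ContDiffAt ℝ ∞ φ y ∧ ∂ᵤ (compT φ) y = 0 ∧ ∂ᵤ (compX φ) y = 0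

namespace Projectable

variable {φ : J0 → J0} {j : J1}

lemma constAlong_compT (h : Projectable φ j.1) : ConstAlong (0, 0, 1) (compT φ) j.1 :=
  h.mono fun _ hy => ⟨(smooth_comps hy.1).1, hy.2.1⟩

lemma constAlong_compX (h : Projectable φ j.1) : ConstAlong (0, 0, 1) (compX φ) j.1 :=
  h.mono fun _ hy => ⟨(smooth_comps hy.1).2.1, hy.2.2⟩

lemma totalT_compT (h : Projectable φ j.1) : totalT (compT φ) j = ∂ₜ (compT φ) j.1 := by
  rw [totalT_eq, h.self_of_nhds.2.1, mul_zero, add_zero]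

lemma totalX_compT (h : Projectable φ j.1) : totalX (compT φ) j = ∂ₓ (compT φ) j.1 := by
  rw [totalX_eq, h.self_of_nhds.2.1, mul_zero, add_zero]

lemma totalT_compX (h : Projectable φ j.1) : totalT (compX φ) j = ∂ₜ (compX φ) j.1 := by
  rw [totalT_eq, h.self_of_nhds.2.2, mul_zero, add_zero]

lemma totalX_compX (h : Projectable φ j.1) : totalX (compX φ) j = ∂ₓ (compX φ) j.1 := by
  rw [totalX_eq, h.self_of_nhds.2.2, mul_zero, add_zero]

lemma totalJac_eq (h : Projectable φ j.1) :
    totalJac φ j = ∂ₜ (compT φ) j.1 * ∂ₓ (compX φ) j.1 - ∂ₓ (compT φ) j.1 * ∂ₜ (compX φ) j.1 := by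
  rw [totalJac, h.totalT_compT, h.totalX_compT, h.totalT_compX, h.totalX_compX]

lemma contactFactor_eq (h : Projectable φ j.1) : contactFactor φ j = ∂ᵤ (compU φ) j.1 := by
  rw [contactFactor, h.self_of_nhds.2.1, h.self_of_nhds.2.2]
  ring

lemma newUt_eq (h : Projectable φ j.1) : newUt φ j =
    ((∂ₜ (compU φ) j.1 + j.2.1 * ∂ᵤ (compU φ) j.1) * ∂ₓ (compX φ) j.1
      - (∂ₓ (compU φ) j.1 + j.2.2 * ∂ᵤ (compU φ) j.1) * ∂ₜ (compX φ) j.1)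
    / (∂ₜ (compT φ) j.1 * ∂ₓ (compX φ) j.1 - ∂ₓ (compT φ) j.1 * ∂ₜ (compX φ) j.1) := by
  rw [newUt, newDerivT, h.totalJac_eq, h.totalT_compX, h.totalX_compX, totalT_eq, totalX_eq]

lemma newUx_eq (h : Projectable φ j.1) : newUx φ j =
    ((∂ₓ (compU φ) j.1 + j.2.2 * ∂ᵤ (compU φ) j.1) * ∂ₜ (compT φ) j.1
      - (∂ₜ (compU φ) j.1 + j.2.1 * ∂ᵤ (compU φ) j.1) * ∂ₓ (compT φ) j.1)
    / (∂ₜ (compT φ) j.1 * ∂ₓ (compX φ) j.1 - ∂ₓ (compT φ) j.1 * ∂ₜ (compX φ) j.1) := by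
  rw [newUx, newDerivX, h.totalJac_eq, h.totalT_compT, h.totalX_compT, totalT_eq, totalX_eq]

lemma contactHess_horT_eq (h : Projectable φ j.1) : contactHess φ j (horT j) (horT j) =
    ∂ₜ (∂ₜ (compU φ)) j.1 + 2 * j.2.1 * ∂ₜ (∂ᵤ (compU φ)) j.1 + j.2.1 ^ 2 * ∂ᵤ (∂ᵤ (compU φ)) j.1
      - newUt φ j * ∂ₜ (∂ₜ (compT φ)) j.1 - newUx φ j * ∂ₜ (∂ₜ (compX φ)) j.1 := by
  obtain ⟨hT, hX, hU⟩ := smooth_comps h.self_of_nhds.1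
  simp only [contactHess, hess_horT hT, hess_horT hX, hess_horT hU,
    h.constAlong_compT.dirDeriv_right, h.constAlong_compX.dirDeriv_right]
  ring

lemma contactHess_horX_eq (h : Projectable φ j.1) : contactHess φ j (horX j) (horX j) =
    ∂ₓ (∂ₓ (compU φ)) j.1 + 2 * j.2.2 * ∂ₓ (∂ᵤ (compU φ)) j.1 + j.2.2 ^ 2 * ∂ᵤ (∂ᵤ (compU φ)) j.1
      - newUt φ j * ∂ₓ (∂ₓ (compT φ)) j.1 - newUx φ j * ∂ₓ (∂ₓ (compX φ)) j.1 := by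
  obtain ⟨hT, hX, hU⟩ := smooth_comps h.self_of_nhds.1
  simp only [contactHess, hess_horX hT, hess_horX hX, hess_horX hU,
    h.constAlong_compT.dirDeriv_right, h.constAlong_compX.dirDeriv_right]
  ring

variable {z : J0}

lemma exists_newUx_affine (h : Projectable φ z) : ∃ α, ∀ s r, newUx φ (z, (s, r)) =
    α + ∂ₜ (compT φ) z * ∂ᵤ (compU φ) z
        / (∂ₜ (compT φ) z * ∂ₓ (compX φ) z - ∂ₓ (compT φ) z * ∂ₜ (compX φ) z) * r
      + -(∂ₓ (compT φ) z * ∂ᵤ (compU φ) z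
        / (∂ₜ (compT φ) z * ∂ₓ (compX φ) z - ∂ₓ (compT φ) z * ∂ₜ (compX φ) z)) * s := by
  refine ⟨(∂ₓ (compU φ) z * ∂ₜ (compT φ) z - ∂ₜ (compU φ) z * ∂ₓ (compT φ) z)
    / (∂ₜ (compT φ) z * ∂ₓ (compX φ) z - ∂ₓ (compT φ) z * ∂ₜ (compX φ) z), fun s r => ?_⟩
  rw [h.newUx_eq]
  ring

lemma exists_newUt_affine (h : Projectable φ z) :
    ∃ a b c, ∀ s r, newUt φ (z, (s, r)) = a * s + b * r + c := by
  set J := ∂ₜ (compT φ) z * ∂ₓ (compX φ) z - ∂ₓ (compT φ) z * ∂ₜ (compX φ) z with hJ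
  refine ⟨∂ᵤ (compU φ) z * ∂ₓ (compX φ) z / J, -(∂ᵤ (compU φ) z * ∂ₜ (compX φ) z) / J,
    (∂ₜ (compU φ) z * ∂ₓ (compX φ) z - ∂ₓ (compU φ) z * ∂ₜ (compX φ) z) / J, fun s r => ?_⟩
  rw [h.newUt_eq, ← hJ]
  ring

lemma exists_contactHess_quadratic (h : Projectable φ z) :
    (∃ a b c, ∀ s r, contactHess φ (z, (s, r)) (horT (z, (s, r))) (horT (z, (s, r))) =
        ∂ᵤ (∂ᵤ (compU φ)) z * s ^ 2 + a * s + b * r + c) ∧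
      ∃ a b c, ∀ s r, contactHess φ (z, (s, r)) (horX (z, (s, r))) (horX (z, (s, r))) =
        ∂ᵤ (∂ᵤ (compU φ)) z * r ^ 2 + a * s + b * r + c := by
  obtain ⟨a, b, c, hUt⟩ := h.exists_newUt_affine
  obtain ⟨α, hUx⟩ := h.exists_newUx_affine
  set β := ∂ₜ (compT φ) z * ∂ᵤ (compU φ) z
    / (∂ₜ (compT φ) z * ∂ₓ (compX φ) z - ∂ₓ (compT φ) z * ∂ₜ (compX φ) z)
  set γ := -(∂ₓ (compT φ) z * ∂ᵤ (compU φ) z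
    / (∂ₜ (compT φ) z * ∂ₓ (compX φ) z - ∂ₓ (compT φ) z * ∂ₜ (compX φ) z))
  constructor
  · refine ⟨2 * ∂ₜ (∂ᵤ (compU φ)) z - a * ∂ₜ (∂ₜ (compT φ)) z - γ * ∂ₜ (∂ₜ (compX φ)) z,
      -b * ∂ₜ (∂ₜ (compT φ)) z - β * ∂ₜ (∂ₜ (compX φ)) z,
      ∂ₜ (∂ₜ (compU φ)) z - c * ∂ₜ (∂ₜ (compT φ)) z - α * ∂ₜ (∂ₜ (compX φ)) z, fun s r => ?_⟩
    rw [contactHess_horT_eq (j := (z, (s, r))) h, hUt, hUx]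
    ring
  · refine ⟨-a * ∂ₓ (∂ₓ (compT φ)) z - γ * ∂ₓ (∂ₓ (compX φ)) z,
      2 * ∂ₓ (∂ᵤ (compU φ)) z - b * ∂ₓ (∂ₓ (compT φ)) z - β * ∂ₓ (∂ₓ (compX φ)) z,
      ∂ₓ (∂ₓ (compU φ)) z - c * ∂ₓ (∂ₓ (compT φ)) z - α * ∂ₓ (∂ₓ (compX φ)) z, fun s r => ?_⟩
    rw [contactHess_horX_eq (j := (z, (s, r))) h, hUt, hUx]
    ring

end Projectable

section Projectable

variable {θ θ' : ArbElem} {φ : PointTransformation J0} {j : J1}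

lemma eventually_base {p : J0 → Prop} (h : ∀ᶠ i in 𝓝 j, p i.1) : ∀ᶠ z in 𝓝 j.1, p z :=
  ((by fun_prop : Continuous fun z : J0 => ((z, j.2) : J1)).tendsto j.1).eventually h

lemma eventually_fibre {p : J1 → Prop} (h : ∀ᶠ i in 𝓝 j, p i) : ∀ᶠ q in 𝓝 j.2, p (j.1, q) :=
  ((by fun_prop : Continuous fun q : ℝ × ℝ => ((j.1, q) : J1)).tendsto j.2).eventually h

lemma eventually_of_eventually_base {p : J0 → Prop} (h : ∀ᶠ z in 𝓝 j.1, p z) :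
    ∀ᶠ i : J1 in 𝓝 j, p i.1 :=
  (continuous_fst.tendsto j).eventually h

lemma mixed_split_ut (h : ∀ᶠ i in 𝓝 j, DeterminingEqs θ θ' φ i) :
    ∂ᵤ (compT φ.toFun) j.1 * ∂ᵤ (compX φ.toFun) j.1 = 0 ∧
    ∂ₜ (compT φ.toFun) j.1 * ∂ᵤ (compX φ.toFun) j.1
      + ∂ᵤ (compT φ.toFun) j.1 * ∂ₜ (compX φ.toFun) j.1 = 0 ∧
    ∂ₜ (compT φ.toFun) j.1 * ∂ₜ (compX φ.toFun) j.1 = θ.f (jetArg j)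
      * (∂ₓ (compT φ.toFun) j.1 + j.2.2 * ∂ᵤ (compT φ.toFun) j.1)
      * (∂ₓ (compX φ.toFun) j.1 + j.2.2 * ∂ᵤ (compX φ.toFun) j.1) := by
  have hline : ContinuousAt (fun s : ℝ => ((s, j.2.2) : ℝ × ℝ)) j.2.1 := by fun_prop
  obtain ⟨hquad, hlin, hconst⟩ := quadratic_eventually_zero (s₀ := j.2.1)
    (a := ∂ᵤ (compT φ.toFun) j.1 * ∂ᵤ (compX φ.toFun) j.1)
    (b := ∂ₜ (compT φ.toFun) j.1 * ∂ᵤ (compX φ.toFun) j.1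
      + ∂ᵤ (compT φ.toFun) j.1 * ∂ₜ (compX φ.toFun) j.1)
    (c := ∂ₜ (compT φ.toFun) j.1 * ∂ₜ (compX φ.toFun) j.1 - θ.f (jetArg j)
      * (∂ₓ (compT φ.toFun) j.1 + j.2.2 * ∂ᵤ (compT φ.toFun) j.1)
      * (∂ₓ (compX φ.toFun) j.1 + j.2.2 * ∂ᵤ (compX φ.toFun) j.1)) (by
      filter_upwards [hline.eventually (eventually_fibre h)] with s hs
      have hmixed := hs.mixed
      simp only [totalT_eq, totalX_eq, show jetArg (j.1, (s, j.2.2)) = jetArg j from rfl] at hmixed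
      linear_combination hmixed)
  exact ⟨hquad, hlin, sub_eq_zero.1 hconst⟩

/-- The roles of `T` and `X` in `mixed_split_ut` are symmetric, so one lemma serves for both. -/
lemma eq_zero_of_mixed_split {f : ℝ → ℝ} {Aₜ Aₓ Aᵤ Bₜ Bₓ Bᵤ r₀ : ℝ} (hA : Aᵤ ≠ 0)
    (hquad : Aᵤ * Bᵤ = 0) (hlin : Aₜ * Bᵤ + Aᵤ * Bₜ = 0)
    (hconst : ∀ᶠ r in 𝓝 r₀, f r ≠ 0 ∧ Aₜ * Bₜ = f r * (Aₓ + r * Aᵤ) * (Bₓ + r * Bᵤ)) :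
    Bᵤ = 0 ∧ Bₜ = 0 ∧ Bₓ = 0 := by
  have hBᵤ : Bᵤ = 0 := (mul_eq_zero.mp hquad).resolve_left hA
  have hBₜ : Bₜ = 0 := (mul_eq_zero.mp (by simpa [hBᵤ] using hlin)).resolve_left hA
  obtain ⟨hprod, -⟩ := affine_eventually_zero (s₀ := r₀) (b := Aᵤ * Bₓ) (c := Aₓ * Bₓ) (by
    filter_upwards [hconst] with r ⟨hf, hr⟩
    rw [hBᵤ, hBₜ] at hr
    refine (mul_eq_zero.mp ?_).resolve_left hf
    linear_combination -hr)
  exact ⟨hBᵤ, hBₜ, (mul_eq_zero.mp hprod).resolve_left hA⟩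

lemma dirDeriv_u_compT_compX (hθ : θ ∈ waveClass) (h : ∀ᶠ i in 𝓝 j, DeterminingEqs θ θ' φ i) :
    ∂ᵤ (compT φ.toFun) j.1 = 0 ∧ ∂ᵤ (compX φ.toFun) j.1 = 0 := by
  have hline : ContinuousAt (fun r : ℝ => ((j.2.1, r) : ℝ × ℝ)) j.2.2 := by fun_prop
  have hconst : ∀ᶠ r in 𝓝 j.2.2, θ.f (j.1.2.1, r) ≠ 0 ∧
      ∂ₜ (compT φ.toFun) j.1 * ∂ₜ (compX φ.toFun) j.1 = θ.f (j.1.2.1, r)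
        * (∂ₓ (compT φ.toFun) j.1 + r * ∂ᵤ (compT φ.toFun) j.1)
        * (∂ₓ (compX φ.toFun) j.1 + r * ∂ᵤ (compX φ.toFun) j.1) := by
    filter_upwards [hline.eventually (eventually_fibre h.eventually_nhds)] with r hr
    exact ⟨hθ.1 _ hr.self_of_nhds.mem_dom, (mixed_split_ut hr).2.2⟩
  have hJ := h.self_of_nhds.jac
  rw [totalJac] at hJ
  simp only [totalT_eq, totalX_eq] at hJ
  obtain ⟨hquad, hlin, -⟩ := mixed_split_ut h
  constructor <;> by_contra hne
  · obtain ⟨hXu, hXt, hXx⟩ := eq_zero_of_mixed_split hne hquad hlin hconst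
    exact hJ (by rw [hXu, hXt, hXx]; ring)
  · obtain ⟨hTu, hTt, hTx⟩ := eq_zero_of_mixed_split hne ((mul_comm _ _).trans hquad)
      ((by ring : _ = _).trans hlin) (hconst.mono fun r hr => ⟨hr.1, (mul_comm _ _).trans
        (hr.2.trans (mul_right_comm _ _ _))⟩)
    exact hJ (by rw [hTu, hTt, hTx]; ring)

lemma projectable_of_determiningEqs (hθ : θ ∈ waveClass)
    (h : ∀ᶠ i in 𝓝 j, DeterminingEqs θ θ' φ i) : Projectable φ.toFun j.1 :=
  eventually_base (h.eventually_nhds.mono fun _ hi =>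
    ⟨φ.contDiffAt hi.self_of_nhds.mem_source, dirDeriv_u_compT_compX hθ hi⟩)

end Projectable

/-! ## Admissible transformations preserve the fibration -/

section Mixing

variable {f g f' g' : ℝ → ℝ} {A B C D J V κ α s₀ r₀ p₀ : ℝ}

lemma symbols_const_of_mixing (hJ : J = A * D - B * C) (hJ₀ : J ≠ 0) (hV : V ≠ 0) (hC : C ≠ 0)
    (hp : p₀ = α + A * V / J * r₀ + -(B * V / J) * s₀)
    (h : ∀ᶠ q in 𝓝 ((s₀, r₀) : ℝ × ℝ), A * C = f q.2 * B * D ∧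
      C ^ 2 = f q.2 * f' (α + A * V / J * q.2 + -(B * V / J) * q.1) * B ^ 2) :
    B ≠ 0 ∧ D ^ 2 - f' p₀ * B ^ 2 ≠ 0 ∧
      (∀ᶠ r in 𝓝 r₀, f r = f r₀) ∧ ∀ᶠ p in 𝓝 p₀, f' p = f' p₀ := by
  obtain ⟨hcross, hoff⟩ := h.self_of_nhds
  simp only [← hp] at hcross hoff
  have hB : B ≠ 0 := by
    rintro rfl
    exact pow_ne_zero 2 hC (by simpa using hoff)
  have hγ : -(B * V / J) ≠ 0 := neg_ne_zero.2 (div_ne_zero (mul_ne_zero hB hV) hJ₀)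
  have hconst := eventually_const_of_mul_eq_const hγ (f := f) (f' := f') (c := C ^ 2 / B ^ 2)
    (div_ne_zero (pow_ne_zero 2 hC) (pow_ne_zero 2 hB))
    (h.mono fun q hq => (eq_div_iff (pow_ne_zero 2 hB)).2 hq.2.symm)
  rw [← hp] at hconst
  refine ⟨hB, fun hM => mul_ne_zero hC hJ₀ ?_, hconst⟩
  linear_combination C * hJ + D * hcross - B * hoff + f r₀ * B * hM

/-- The second source term is a function of the single argument `ũ_x̃`, which is affine in `u_t` and
`u_x` with a nonzero coefficient of `u_t`; hence both source terms are quadratic. -/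
lemma sources_quadratic_of_mixing {M f₀ a₁ b₁ c₁ a₂ b₂ c₂ : ℝ} (hB : B ≠ 0) (hJ₀ : J ≠ 0)
    (hV : V ≠ 0) (hM : M ≠ 0) (hp : p₀ = α + A * V / J * r₀ + -(B * V / J) * s₀)
    (h : ∀ᶠ q in 𝓝 ((s₀, r₀) : ℝ × ℝ),
      M * (V * g q.2 + (κ * q.1 ^ 2 + a₁ * q.1 + b₁ * q.2 + c₁)
        - f₀ * (κ * q.2 ^ 2 + a₂ * q.1 + b₂ * q.2 + c₂))
      = J ^ 2 * g' (α + A * V / J * q.2 + -(B * V / J) * q.1)) :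
    A * κ = 0 ∧ (∃ b c, ∀ᶠ r in 𝓝 r₀, g r = f₀ * κ / V * r ^ 2 + b * r + c) ∧
      ∃ b c, ∀ᶠ p in 𝓝 p₀, g' p = M * κ / (V * B) ^ 2 * p ^ 2 + b * p + c := by
  have hγ : -(B * V / J) ≠ 0 := neg_ne_zero.2 (div_ne_zero (mul_ne_zero hB hV) hJ₀)
  obtain ⟨hβκ, ⟨b, c, hg⟩, b', c', hg'⟩ := quadratic_of_affine_argument (G := g')
    (H := fun r => M / J ^ 2 * (V * g r + b₁ * r + c₁ - f₀ * (κ * r ^ 2 + b₂ * r + c₂)))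
    (a := M / J ^ 2 * (a₁ - f₀ * a₂)) (κ := M * κ / J ^ 2) hγ (by
      filter_upwards [h] with q hq
      refine mul_left_cancel₀ (pow_ne_zero 2 hJ₀) ?_
      rw [← hq]
      field_simp
      ring)
  rw [← hp] at hg'
  refine ⟨?_, ⟨(J ^ 2 / M * b - b₁ + f₀ * b₂) / V, (J ^ 2 / M * c - c₁ + f₀ * c₂) / V, ?_⟩,
    b', c', ?_⟩
  · simpa [hV, hM, hJ₀] using hβκ
  · filter_upwards [hg] with r hr
    field_simp at hr ⊢
    linear_combination hr
  · filter_upwards [hg'] with p hp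
    rw [hp]
    field_simp

end Mixing

/-- What the determining equations imply at a jet over a point where `X_t ≠ 0`: both equations are
semilinear, and their source terms are quadratic in the first derivative, with coefficients
proportional to `U_uu`. -/
structure MixingRelations (θ θ' : ArbElem) (φ : PointTransformation J0) (j : J1) : Prop where
  partialUx_f : partialUx θ.f (jetArg j) = 0
  partialUx_g : ∂ᵤ (compU φ.toFun) j.1 * partialUx (partialUx θ.g) (jetArg j)
    = 2 * θ.f (jetArg j) * ∂ᵤ (∂ᵤ (compU φ.toFun)) j.1
  dT_mul : ∂ₜ (compT φ.toFun) j.1 * ∂ᵤ (∂ᵤ (compU φ.toFun)) j.1 = 0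
  dX_ne_zero : ∂ₓ (compT φ.toFun) j.1 ≠ 0
  dU_ne_zero : ∂ᵤ (compU φ.toFun) j.1 ≠ 0
  f'_const : ∀ᶠ p in 𝓝 (newUx φ.toFun j),
    θ'.f (compX φ.toFun j.1, p) = θ'.f (jetArg (prolong1 φ.toFun j))
  partialUx_g' : ∀ᶠ p in 𝓝 (newUx φ.toFun j),
    (∂ᵤ (compU φ.toFun) j.1 * ∂ₓ (compT φ.toFun) j.1) ^ 2
        * partialUx (partialUx θ'.g) (compX φ.toFun j.1, p)
      = 2 * (∂ₓ (compX φ.toFun) j.1 ^ 2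
        - θ'.f (jetArg (prolong1 φ.toFun j)) * ∂ₓ (compT φ.toFun) j.1 ^ 2)
        * ∂ᵤ (∂ᵤ (compU φ.toFun)) j.1

lemma partialUx_partialUx_of_quadratic {θ : ArbElem} {b : ℝ × ℝ} (hb : b ∈ θ.dom) {k l m : ℝ}
    (h : ∀ᶠ p in 𝓝 b.2, θ.g (b.1, p) = k * p ^ 2 + l * p + m) :
    ∀ᶠ p in 𝓝 b.2, partialUx (partialUx θ.g) (b.1, p) = 2 * k := by
  have hline : ContinuousAt (fun p : ℝ => ((b.1, p) : ℝ × ℝ)) b.2 := by fun_prop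
  filter_upwards [h.eventually_nhds, hline.eventually (θ.isOpen_dom.eventually_mem hb)]
    with p hp hmem
  rw [partialUx_partialUx (b := (b.1, p)) ((θ.isOpen_dom.eventually_mem hmem).mono
    fun c hc => θ.contDiffAt_g hc)]
  exact deriv_deriv_quadratic hp

section Fibre

variable {θ θ' : ArbElem} {φ : PointTransformation J0} {j : J1}

lemma dU_ne_zero_of_determiningEqs (hproj : Projectable φ.toFun j.1)
    (h : DeterminingEqs θ θ' φ j) : ∂ᵤ (compU φ.toFun) j.1 ≠ 0 :=
  hproj.contactFactor_eq ▸ contactFactor_ne_zero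
    (differentiableAt_of_smooth (φ.contDiffAt h.mem_source))
    (φ.fderiv_surjective h.mem_source) h.jac

lemma symbols_const_of_dX_ne_zero (hproj : Projectable φ.toFun j.1)
    (h : ∀ᶠ i in 𝓝 j, DeterminingEqs θ θ' φ i) (hC : ∂ₜ (compX φ.toFun) j.1 ≠ 0) :
    ∂ₓ (compT φ.toFun) j.1 ≠ 0 ∧
      ∂ₓ (compX φ.toFun) j.1 ^ 2
        - θ'.f (jetArg (prolong1 φ.toFun j)) * ∂ₓ (compT φ.toFun) j.1 ^ 2 ≠ 0 ∧
      (∀ᶠ r in 𝓝 j.2.2, θ.f (j.1.2.1, r) = θ.f (jetArg j)) ∧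
      ∀ᶠ p in 𝓝 (newUx φ.toFun j),
        θ'.f (compX φ.toFun j.1, p) = θ'.f (jetArg (prolong1 φ.toFun j)) := by
  have hj := h.self_of_nhds
  obtain ⟨α, hp⟩ := hproj.exists_newUx_affine
  have hproj' (q : ℝ × ℝ) : Projectable φ.toFun (j.1, q).1 := hproj
  refine symbols_const_of_mixing (f := fun r => θ.f (j.1.2.1, r))
    (f' := fun p => θ'.f (compX φ.toFun j.1, p)) rfl (hproj.totalJac_eq ▸ hj.jac)
    (dU_ne_zero_of_determiningEqs hproj hj) hC (hp j.2.1 j.2.2) ?_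
  filter_upwards [eventually_fibre h] with q hq
  have hcross := hq.mixed
  have hoff := hq.offDiagonal
  simp only [(hproj' q).totalT_compT, (hproj' q).totalX_compT, (hproj' q).totalT_compX,
    (hproj' q).totalX_compX] at hcross hoff
  rw [← hp]
  exact ⟨hcross, hoff⟩

lemma sources_quadratic_of_dX_ne_zero (hproj : Projectable φ.toFun j.1)
    (h : ∀ᶠ i in 𝓝 j, DeterminingEqs θ θ' φ i) (hC : ∂ₜ (compX φ.toFun) j.1 ≠ 0) :
    ∂ₜ (compT φ.toFun) j.1 * ∂ᵤ (∂ᵤ (compU φ.toFun)) j.1 = 0 ∧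
      (∃ b c, ∀ᶠ r in 𝓝 j.2.2, θ.g (j.1.2.1, r) =
        θ.f (jetArg j) * ∂ᵤ (∂ᵤ (compU φ.toFun)) j.1 / ∂ᵤ (compU φ.toFun) j.1 * r ^ 2
          + b * r + c) ∧
      ∃ b c, ∀ᶠ p in 𝓝 (newUx φ.toFun j), θ'.g (compX φ.toFun j.1, p) =
        (∂ₓ (compX φ.toFun) j.1 ^ 2
            - θ'.f (jetArg (prolong1 φ.toFun j)) * ∂ₓ (compT φ.toFun) j.1 ^ 2)
          * ∂ᵤ (∂ᵤ (compU φ.toFun)) j.1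
          / (∂ᵤ (compU φ.toFun) j.1 * ∂ₓ (compT φ.toFun) j.1) ^ 2 * p ^ 2 + b * p + c := by
  have hj := h.self_of_nhds
  obtain ⟨hB, hM, hf, hf'⟩ := symbols_const_of_dX_ne_zero hproj h hC
  obtain ⟨α, hp⟩ := hproj.exists_newUx_affine
  obtain ⟨⟨a₁, b₁, c₁, hTT⟩, a₂, b₂, c₂, hXX⟩ := hproj.exists_contactHess_quadratic
  have hproj' (q : ℝ × ℝ) : Projectable φ.toFun (j.1, q).1 := hproj
  have hUx : Filter.Tendsto (fun q => newUx φ.toFun (j.1, q)) (𝓝 j.2) (𝓝 (newUx φ.toFun j)) :=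
    Filter.Tendsto.comp (y := 𝓝 j)
      (contDiffAt_newUx (φ.contDiffAt hj.mem_source) hj.jac).continuousAt
      ((by fun_prop : Continuous fun q : ℝ × ℝ => ((j.1, q) : J1)).tendsto j.2)
  refine sources_quadratic_of_mixing (g := fun r => θ.g (j.1.2.1, r))
    (g' := fun p => θ'.g (compX φ.toFun j.1, p)) (a₁ := a₁) (b₁ := b₁) (c₁ := c₁)
    (a₂ := a₂) (b₂ := b₂) (c₂ := c₂) hB (hproj.totalJac_eq ▸ hj.jac)
    (dU_ne_zero_of_determiningEqs hproj hj) hM (hp j.2.1 j.2.2) ?_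
  filter_upwards [eventually_fibre h, (continuous_snd.tendsto j.2).eventually hf,
    hUx.eventually hf'] with q hq hfq hfq'
  have hsource := hq.source
  have hf₀ : θ.f (jetArg (j.1, q)) = θ.f (jetArg j) := hfq
  have hf₀' : θ'.f (jetArg (prolong1 φ.toFun (j.1, q))) = θ'.f (jetArg (prolong1 φ.toFun j)) := hfq'
  rw [hf₀, hf₀', (hproj' q).totalX_compT, (hproj' q).totalX_compX, (hproj' q).contactFactor_eq,
    (hproj' q).totalJac_eq, hTT, hXX] at hsource
  rw [← hp]
  exact hsource

lemma mixingRelations (hproj : Projectable φ.toFun j.1)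
    (h : ∀ᶠ i in 𝓝 j, DeterminingEqs θ θ' φ i) (hC : ∂ₜ (compX φ.toFun) j.1 ≠ 0) :
    MixingRelations θ θ' φ j := by
  have hj := h.self_of_nhds
  have hV := dU_ne_zero_of_determiningEqs hproj hj
  obtain ⟨hB, -, hf, hf'⟩ := symbols_const_of_dX_ne_zero hproj h hC
  obtain ⟨hAκ, ⟨b, c, hg⟩, b', c', hg'⟩ := sources_quadratic_of_dX_ne_zero hproj h hC
  refine ⟨?_, ?_, hAκ, hB, hV, hf', ?_⟩
  · have hderiv := hasDerivAt_partialUx (differentiableAt_of_smooth (θ.contDiffAt_f hj.mem_dom))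
    exact hderiv.unique ((hasDerivAt_const _ _).congr_of_eventuallyEq hf)
  · rw [(partialUx_partialUx_of_quadratic hj.mem_dom hg).self_of_nhds]
    field_simp
  · filter_upwards [partialUx_partialUx_of_quadratic hj.mem_dom' hg'] with p hp
    refine (congrArg _ hp).trans ?_
    field_simp

lemma dU_mul_of_mixing (hproj : Projectable φ.toFun j.1) (h : DeterminingEqs θ θ' φ j)
    (hmix : MixingRelations θ θ' φ j) (hC : ∂ₜ (compX φ.toFun) j.1 ≠ 0)
    (hκ : ∂ᵤ (∂ᵤ (compU φ.toFun)) j.1 ≠ 0) :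
    θ.f (jetArg j) * partialUx (partialUx θ'.g) (jetArg (prolong1 φ.toFun j)) ≠ 0 ∧
      ∂ᵤ (compU φ.toFun) j.1
          * (θ.f (jetArg j) * partialUx (partialUx θ'.g) (jetArg (prolong1 φ.toFun j)))
        = -(θ'.f (jetArg (prolong1 φ.toFun j)) * partialUx (partialUx θ.g) (jetArg j)) := by
  have hA := (mul_eq_zero.mp hmix.dT_mul).resolve_right hκ
  have hmixed := h.mixed'
  have hoff := h.offDiagonal
  rw [hproj.totalX_compX, hproj.totalT_compX, hproj.totalT_compT, hA, mul_zero, zero_mul] at hmixed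
  rw [hproj.totalT_compX, hproj.totalX_compT] at hoff
  have hD := (mul_eq_zero.mp hmixed).resolve_right hC
  have hff' : θ.f (jetArg j) * θ'.f (jetArg (prolong1 φ.toFun j)) ≠ 0 :=
    left_ne_zero_of_mul (hoff ▸ pow_ne_zero 2 hC)
  have hg' : ∂ᵤ (compU φ.toFun) j.1 ^ 2
      * partialUx (partialUx θ'.g) (jetArg (prolong1 φ.toFun j))
      = -2 * θ'.f (jetArg (prolong1 φ.toFun j)) * ∂ᵤ (∂ᵤ (compU φ.toFun)) j.1 := by
    have hg' := hmix.partialUx_g'.self_of_nhds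
    rw [hD, show (compX φ.toFun j.1, newUx φ.toFun j) = jetArg (prolong1 φ.toFun j) from rfl] at hg'
    refine mul_left_cancel₀ (pow_ne_zero 2 hmix.dX_ne_zero) ?_
    linear_combination hg'
  refine ⟨mul_ne_zero (left_ne_zero_of_mul hff') (right_ne_zero_of_mul (hg'.trans_ne ?_)), ?_⟩
  · exact mul_ne_zero (mul_ne_zero (by norm_num) (right_ne_zero_of_mul hff')) hκ
  · refine mul_left_cancel₀ hmix.dU_ne_zero ?_
    linear_combination θ.f (jetArg j) * hg'
      + θ'.f (jetArg (prolong1 φ.toFun j)) * hmix.partialUx_g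

lemma eventually_dU_eq_of_mixing (hθ : θ ∈ waveClass)
    (h : ∀ᶠ i in 𝓝 j, DeterminingEqs θ θ' φ i) (hC : ∂ₜ (compX φ.toFun) j.1 ≠ 0)
    (hκ : ∂ᵤ (∂ᵤ (compU φ.toFun)) j.1 ≠ 0) :
    ∀ᶠ s in 𝓝 (0 : ℝ),
      ∂ᵤ (compU φ.toFun) (j.1 + s • (0, 0, 1)) = ∂ᵤ (compU φ.toFun) j.1 := by
  have hj := h.self_of_nhds
  have hφ := φ.contDiffAt hj.mem_source
  have hproj := projectable_of_determiningEqs hθ h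
  have hmix := mixingRelations hproj h hC
  have hline : Filter.Tendsto (fun s : ℝ => ((j.1 + s • (0, 0, 1), j.2) : J1)) (𝓝 0) (𝓝 j) :=
    (tendsto_line j.1 (0, 0, 1)).prodMk_nhds tendsto_const_nhds
  have hC' := (differentiableAt_of_smooth (contDiffAt_dirDeriv
    (smooth_comps hφ).2.1 (1, 0, 0))).continuousAt.eventually_ne hC
  have hκ' := (differentiableAt_of_smooth (contDiffAt_dirDeriv (contDiffAt_dirDeriv
    (smooth_comps hφ).2.2 (0, 0, 1)) (0, 0, 1))).continuousAt.eventually_ne hκ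
  have hUx : Filter.Tendsto (fun s : ℝ => newUx φ.toFun (j.1 + s • (0, 0, 1), j.2)) (𝓝 0)
      (𝓝 (newUx φ.toFun j)) := (contDiffAt_newUx hφ hj.jac).continuousAt.tendsto.comp hline
  obtain ⟨hne, hval⟩ := dU_mul_of_mixing hproj hj hmix hC hκ
  filter_upwards [hline.eventually h.eventually_nhds, (tendsto_line j.1 (0, 0, 1)).eventually hC',
    (tendsto_line j.1 (0, 0, 1)).eventually hκ', hproj.constAlong_compX.eventually_eq_on_line,
    hUx.eventually hmix.f'_const, hUx.eventually hmix.partialUx_g'] with s hs hCs hκs hXs hfs hgs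
  have hprojs := projectable_of_determiningEqs hθ hs
  obtain ⟨-, hvals⟩ := dU_mul_of_mixing hprojs hs.self_of_nhds
    (mixingRelations hprojs hs hCs) hCs hκs
  have harg : jetArg (j.1 + s • (0, 0, 1), j.2) = jetArg j := by simp [jetArg]
  have harg' : jetArg (prolong1 φ.toFun (j.1 + s • (0, 0, 1), j.2))
      = (compX φ.toFun j.1, newUx φ.toFun (j.1 + s • (0, 0, 1), j.2)) := Prod.ext hXs rfl
  have hg : partialUx (partialUx θ'.g)
        (compX φ.toFun j.1, newUx φ.toFun (j.1 + s • (0, 0, 1), j.2))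
      = partialUx (partialUx θ'.g) (jetArg (prolong1 φ.toFun j)) :=
    mul_left_cancel₀ (pow_ne_zero 2 (mul_ne_zero hmix.dU_ne_zero hmix.dX_ne_zero))
      (hgs.trans hmix.partialUx_g'.self_of_nhds.symm)
  rw [harg, harg', hfs, hg] at hvals
  exact mul_right_cancel₀ hne (hvals.trans hval.symm)

lemma dU_dU_eq_zero_of_dX_ne_zero (hθ : θ ∈ waveClass)
    (h : ∀ᶠ i in 𝓝 j, DeterminingEqs θ θ' φ i) (hC : ∂ₜ (compX φ.toFun) j.1 ≠ 0) :
    ∂ᵤ (∂ᵤ (compU φ.toFun)) j.1 = 0 := by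
  by_contra hκ
  have hU := (smooth_comps (φ.contDiffAt h.self_of_nhds.mem_source)).2.2
  have hderiv := hasDerivAt_line_zero
    (differentiableAt_of_smooth (contDiffAt_dirDeriv hU (0, 0, 1))) (0, 0, 1)
  exact hκ (hderiv.unique ((hasDerivAt_const _ _).congr_of_eventuallyEq
    (eventually_dU_eq_of_mixing hθ h hC hκ)))

lemma dX_eq_zero (hθ : θ ∈ waveClass) (h : ∀ᶠ i in 𝓝 j, DeterminingEqs θ θ' φ i) :
    ∂ₜ (compX φ.toFun) j.1 = 0 := by
  by_contra hC
  have hX := (smooth_comps (φ.contDiffAt h.self_of_nhds.mem_source)).2.1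
  have hC' := eventually_of_eventually_base ((differentiableAt_of_smooth
    (contDiffAt_dirDeriv hX (1, 0, 0))).continuousAt.eventually_ne hC)
  refine not_linear_of_mem_waveClass hθ (j := j) ?_
  filter_upwards [h.eventually_nhds, hC'] with i hi hCi
  have hmix := mixingRelations (projectable_of_determiningEqs hθ hi) hi hCi
  refine ⟨hi.self_of_nhds.mem_dom, hmix.partialUx_f,
    (mul_eq_zero.mp ?_).resolve_left hmix.dU_ne_zero⟩
  rw [hmix.partialUx_g, dU_dU_eq_zero_of_dX_ne_zero hθ hi hCi, mul_zero]

lemma dT_eq_zero (hθ : θ ∈ waveClass) (h : ∀ᶠ i in 𝓝 j, DeterminingEqs θ θ' φ i) :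
    ∂ₓ (compT φ.toFun) j.1 = 0 := by
  have hproj := projectable_of_determiningEqs hθ h
  have hj := h.self_of_nhds
  have hJ := hj.jac
  have hmixed := hj.mixed
  rw [hproj.totalJac_eq, dX_eq_zero hθ h, mul_zero, sub_zero] at hJ
  rw [hproj.totalT_compX, dX_eq_zero hθ h, mul_zero, hproj.totalX_compX, hproj.totalX_compT]
    at hmixed
  exact (mul_eq_zero.mp ((mul_eq_zero.mp hmixed.symm).resolve_right
    (right_ne_zero_of_mul hJ))).resolve_left (hθ.1 _ hj.mem_dom)

end Fibre

/-! ## Fibre-preserving transformations -/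

/-- Near `z` the map `φ` is smooth and of the form `(T(t), X(x), U(t, x, u))`. -/
def FibrePreserving (φ : J0 → J0) (z : J0) : Prop :=
  ∀ᶠ y in 𝓝 z, ContDiffAt ℝ ∞ φ y ∧ (∂ₓ (compT φ) y = 0 ∧ ∂ᵤ (compT φ) y = 0) ∧
    ∂ₜ (compX φ) y = 0 ∧ ∂ᵤ (compX φ) y = 0

/-- The logarithmic derivative `T_tt / T_t` of `T_t`. -/
noncomputable def rateT (φ : J0 → J0) (z : J0) : ℝ := ∂ₜ (∂ₜ (compT φ)) z / ∂ₜ (compT φ) z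

/-- The logarithmic derivative `X_xx / X_x` of `X_x`. -/
noncomputable def rateX (φ : J0 → J0) (z : J0) : ℝ := ∂ₓ (∂ₓ (compX φ)) z / ∂ₓ (compX φ) z

/-- The part `U_tt - (T_tt / T_t) U_t` of the transformed second derivative `ũ_t̃t̃ T_t ^ 2` that is
free of the derivatives of `u`. -/
noncomputable def accelU (φ : J0 → J0) (z : J0) : ℝ :=
  ∂ₜ (∂ₜ (compU φ)) z - rateT φ z * ∂ₜ (compU φ) z

/-- The transformed derivative `ũ_x̃` for a fibre-preserving transformation. -/
noncomputable def fibreSlope (φ : J0 → J0) (j : J1) : ℝ :=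
  (∂ₓ (compU φ) j.1 + j.2.2 * ∂ᵤ (compU φ) j.1) / ∂ₓ (compX φ) j.1

namespace FibrePreserving

variable {φ : J0 → J0} {z v : J0} {j : J1}

lemma projectable (h : FibrePreserving φ z) : Projectable φ z :=
  h.mono fun _ hy => ⟨hy.1, hy.2.1.2, hy.2.2.2⟩

lemma constAlong_compT (h : FibrePreserving φ z) (hv : v.1 = 0) : ConstAlong v (compT φ) z :=
  h.mono fun y hy => ⟨(smooth_comps hy.1).1, by
    rw [dirDeriv_coords _ _ v.1 v.2.1 v.2.2, hv, hy.2.1.1, hy.2.1.2]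
    ring⟩

lemma constAlong_compX (h : FibrePreserving φ z) (hv : v.2.1 = 0) : ConstAlong v (compX φ) z :=
  h.mono fun y hy => ⟨(smooth_comps hy.1).2.1, by
    rw [dirDeriv_coords _ _ v.1 v.2.1 v.2.2, hv, hy.2.2.1, hy.2.2.2]
    ring⟩

lemma totalJac_eq (h : FibrePreserving φ j.1) :
    totalJac φ j = ∂ₜ (compT φ) j.1 * ∂ₓ (compX φ) j.1 := by
  rw [h.projectable.totalJac_eq, h.self_of_nhds.2.2.1, mul_zero, sub_zero]

lemma newUt_eq (h : FibrePreserving φ j.1) (hX : ∂ₓ (compX φ) j.1 ≠ 0) :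
    newUt φ j = (∂ₜ (compU φ) j.1 + j.2.1 * ∂ᵤ (compU φ) j.1) / ∂ₜ (compT φ) j.1 := by
  rw [h.projectable.newUt_eq, h.self_of_nhds.2.2.1, mul_zero, mul_zero, sub_zero, sub_zero,
    mul_div_mul_right _ _ hX]

lemma newUx_eq (h : FibrePreserving φ j.1) (hT : ∂ₜ (compT φ) j.1 ≠ 0) :
    newUx φ j = fibreSlope φ j := by
  rw [h.projectable.newUx_eq, h.self_of_nhds.2.1.1, mul_zero, zero_mul, sub_zero, sub_zero,
    mul_comm (∂ₜ (compT φ) j.1), mul_div_mul_right _ _ hT, fibreSlope]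

lemma jetArg_prolong1 (h : FibrePreserving φ j.1) (hT : ∂ₜ (compT φ) j.1 ≠ 0) :
    jetArg (prolong1 φ j) = (compX φ j.1, fibreSlope φ j) :=
  Prod.ext rfl (h.newUx_eq hT)

lemma contactHess_horT_eq (h : FibrePreserving φ j.1) (hX : ∂ₓ (compX φ) j.1 ≠ 0) :
    contactHess φ j (horT j) (horT j) = accelU φ j.1
      + j.2.1 * (2 * ∂ₜ (∂ᵤ (compU φ)) j.1 - rateT φ j.1 * ∂ᵤ (compU φ) j.1)
      + j.2.1 ^ 2 * ∂ᵤ (∂ᵤ (compU φ)) j.1 := by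
  rw [h.projectable.contactHess_horT_eq, (h.constAlong_compX rfl).dirDeriv_right, h.newUt_eq hX,
    accelU, rateT]
  ring

lemma contactHess_horX_eq (h : FibrePreserving φ j.1) (hT : ∂ₜ (compT φ) j.1 ≠ 0) :
    contactHess φ j (horX j) (horX j) = ∂ₓ (∂ₓ (compU φ)) j.1
      - rateX φ j.1 * (∂ₓ (compU φ) j.1 + j.2.2 * ∂ᵤ (compU φ) j.1)
      + 2 * j.2.2 * ∂ₓ (∂ᵤ (compU φ)) j.1 + j.2.2 ^ 2 * ∂ᵤ (∂ᵤ (compU φ)) j.1 := by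
  rw [h.projectable.contactHess_horX_eq, (h.constAlong_compT rfl).dirDeriv_right, h.newUx_eq hT,
    fibreSlope, rateX]
  ring

lemma constAlong_dT (h : FibrePreserving φ z) (hv : v.1 = 0) : ConstAlong v (∂ₜ (compT φ)) z :=
  (h.constAlong_compT hv).of_dirDeriv _

lemma constAlong_dX (h : FibrePreserving φ z) (hv : v.2.1 = 0) : ConstAlong v (∂ₓ (compX φ)) z :=
  (h.constAlong_compX hv).of_dirDeriv _

lemma rateX_eventually_eq_on_line (h : FibrePreserving φ z) (hv : v.2.1 = 0) :
    ∀ᶠ s in 𝓝 (0 : ℝ), rateX φ (z + s • v) = rateX φ z := by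
  filter_upwards [(h.constAlong_dX hv).eventually_eq_on_line,
    ((h.constAlong_dX hv).of_dirDeriv (0, 1, 0)).eventually_eq_on_line] with s hs hs'
  rw [rateX, rateX, hs, hs']

lemma contDiffAt_rateT (h : FibrePreserving φ z) (hT : ∂ₜ (compT φ) z ≠ 0) :
    ContDiffAt ℝ ∞ (rateT φ) z :=
  have hT' := contDiffAt_dirDeriv (smooth_comps h.self_of_nhds.1).1 (1, 0, 0)
  (contDiffAt_dirDeriv hT' (1, 0, 0)).div hT' hT

lemma contDiffAt_accelU (h : FibrePreserving φ z) (hT : ∂ₜ (compT φ) z ≠ 0) :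
    ContDiffAt ℝ ∞ (accelU φ) z :=
  have hU' := contDiffAt_dirDeriv (smooth_comps h.self_of_nhds.1).2.2 (1, 0, 0)
  (contDiffAt_dirDeriv hU' (1, 0, 0)).sub ((h.contDiffAt_rateT hT).mul hU')

lemma dirDeriv_rateT (h : FibrePreserving φ z) (hT : ∂ₜ (compT φ) z ≠ 0) (hv : v.1 = 0) :
    dirDeriv v (rateT φ) z = 0 := by
  have hline := hasDerivAt_line_zero (differentiableAt_of_smooth (h.contDiffAt_rateT hT)) v
  refine hline.unique ((hasDerivAt_const (0 : ℝ) (rateT φ z)).congr_of_eventuallyEq ?_)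
  filter_upwards [(h.constAlong_dT hv).eventually_eq_on_line,
    ((h.constAlong_dT hv).of_dirDeriv (1, 0, 0)).eventually_eq_on_line] with s hs hs'
  rw [rateT, rateT, hs, hs']

lemma dirDeriv_accelU (h : FibrePreserving φ z) (hT : ∂ₜ (compT φ) z ≠ 0) (hv : v.1 = 0) :
    dirDeriv v (accelU φ) z = ∂ₜ (∂ₜ (dirDeriv v (compU φ))) z
      - rateT φ z * ∂ₜ (dirDeriv v (compU φ)) z := by
  have hU := (smooth_comps h.self_of_nhds.1).2.2
  have hU' := contDiffAt_dirDeriv hU (1, 0, 0)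
  have hrate := differentiableAt_of_smooth (h.contDiffAt_rateT hT)
  have hcomm : dirDeriv v (∂ₜ (compU φ)) =ᶠ[𝓝 z] ∂ₜ (dirDeriv v (compU φ)) :=
    h.mono fun _ hy => dirDeriv_comm (smooth_comps hy.1).2.2 _ _
  unfold accelU
  rw [dirDeriv_sub (differentiableAt_of_smooth (contDiffAt_dirDeriv hU' _))
      (hrate.fun_mul (differentiableAt_of_smooth hU')),
    dirDeriv_mul hrate (differentiableAt_of_smooth hU'), h.dirDeriv_rateT hT hv,
    dirDeriv_comm hU', dirDeriv_congr hcomm, hcomm.self_of_nhds]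
  ring

lemma hasDerivAt_slope_line (h : FibrePreserving φ j.1) (hv : v.2.1 = 0) :
    HasDerivAt (fun s : ℝ => fibreSlope φ (j.1 + s • v, j.2))
      ((dirDeriv v (∂ₓ (compU φ)) j.1 + j.2.2 * dirDeriv v (∂ᵤ (compU φ)) j.1)
        / ∂ₓ (compX φ) j.1) 0 := by
  have hU := (smooth_comps h.self_of_nhds.1).2.2
  have hUx := hasDerivAt_line_zero
    (differentiableAt_of_smooth (contDiffAt_dirDeriv hU (0, 1, 0))) v
  have hUu := hasDerivAt_line_zero
    (differentiableAt_of_smooth (contDiffAt_dirDeriv hU (0, 0, 1))) v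
  refine ((hUx.add (hUu.const_mul j.2.2)).div_const
    (∂ₓ (compX φ) j.1)).congr_of_eventuallyEq ?_
  filter_upwards [(h.constAlong_dX hv).eventually_eq_on_line] with s hs
  simp only [fibreSlope, hs, Pi.add_apply]

lemma hasDerivAt_comp_slope_line (h : FibrePreserving φ j.1) (hv : v.2.1 = 0) {F : ℝ × ℝ → ℝ}
    (hF : DifferentiableAt ℝ F (compX φ j.1, fibreSlope φ j)) :
    HasDerivAt (fun s : ℝ => F (compX φ (j.1 + s • v), fibreSlope φ (j.1 + s • v, j.2)))
      ((dirDeriv v (∂ₓ (compU φ)) j.1 + j.2.2 * dirDeriv v (∂ᵤ (compU φ)) j.1)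
        / ∂ₓ (compX φ) j.1 * partialUx F (compX φ j.1, fibreSlope φ j)) 0 := by
  have hX := h.constAlong_compX hv
  have hline := hasDerivAt_line_zero (differentiableAt_of_smooth hX.self_of_nhds.1) v
  rw [hX.self_of_nhds.2] at hline
  have hcomp := hasDerivAt_comp_snd (s := 0) (by simpa using hF) hline (h.hasDerivAt_slope_line hv)
  simpa using hcomp

lemma hasDerivAt_comp_slope_fibre {F : ℝ × ℝ → ℝ}
    (hF : DifferentiableAt ℝ F (compX φ j.1, fibreSlope φ j)) :
    HasDerivAt (fun r : ℝ => F (compX φ j.1, fibreSlope φ (j.1, (j.2.1, r))))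
      (∂ᵤ (compU φ) j.1 / ∂ₓ (compX φ) j.1 * partialUx F (compX φ j.1, fibreSlope φ j)) j.2.2 := by
  have hslope : HasDerivAt (fun r : ℝ => fibreSlope φ (j.1, (j.2.1, r)))
      (∂ᵤ (compU φ) j.1 / ∂ₓ (compX φ) j.1) j.2.2 := by
    simpa [fibreSlope] using (((hasDerivAt_id j.2.2).mul_const (∂ᵤ (compU φ) j.1)).const_add
      (∂ₓ (compU φ) j.1)).div_const (∂ₓ (compX φ) j.1)
  exact hasDerivAt_comp_snd hF (hasDerivAt_const _ _) hslope

end FibrePreserving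

lemma fibrePreserving_of_determiningEqs {θ θ' : ArbElem} {φ : PointTransformation J0} {j : J1}
    (hθ : θ ∈ waveClass) (h : ∀ᶠ i in 𝓝 j, DeterminingEqs θ θ' φ i) :
    FibrePreserving φ.toFun j.1 :=
  eventually_base (h.eventually_nhds.mono fun _ hi =>
    have hproj := (projectable_of_determiningEqs hθ hi).self_of_nhds
    ⟨hproj.1, ⟨dT_eq_zero hθ hi, hproj.2.1⟩, dX_eq_zero hθ hi, hproj.2.2⟩)

/-- The determining equations for a fibre-preserving transformation `φ` between the equations with
arbitrary elements `θ` and `θ'`, at the first-order jet `j`. -/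
structure FibreEqs (θ θ' : ArbElem) (φ : J0 → J0) (j : J1) : Prop where
  fibre : FibrePreserving φ j.1
  mem_dom : jetArg j ∈ θ.dom
  mem_dom' : (compX φ j.1, fibreSlope φ j) ∈ θ'.dom
  dT_ne : ∂ₜ (compT φ) j.1 ≠ 0
  dX_ne : ∂ₓ (compX φ) j.1 ≠ 0
  dU_ne : ∂ᵤ (compU φ) j.1 ≠ 0
  symbol : θ'.f (compX φ j.1, fibreSlope φ j) * ∂ₜ (compT φ) j.1 ^ 2
    = θ.f (jetArg j) * ∂ₓ (compX φ) j.1 ^ 2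
  source : ∂ᵤ (compU φ) j.1 * θ.g (jetArg j) + contactHess φ j (horT j) (horT j)
      - θ.f (jetArg j) * contactHess φ j (horX j) (horX j)
    = ∂ₜ (compT φ) j.1 ^ 2 * θ'.g (compX φ j.1, fibreSlope φ j)

lemma DeterminingEqs.fibreEqs {θ θ' : ArbElem} {φ : PointTransformation J0} {j : J1}
    (h : DeterminingEqs θ θ' φ j) (hfib : FibrePreserving φ.toFun j.1) :
    FibreEqs θ θ' φ.toFun j := by
  have hproj := hfib.projectable
  have hJ := h.jac
  rw [hfib.totalJac_eq] at hJ
  obtain ⟨hT, hX⟩ := mul_ne_zero_iff.1 hJ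
  have harg := hfib.jetArg_prolong1 hT
  refine ⟨hfib, h.mem_dom, harg ▸ h.mem_dom', hT, hX, dU_ne_zero_of_determiningEqs hproj h, ?_, ?_⟩
  · have hdiag := h.diagonal
    rwa [harg, hproj.totalT_compT, hproj.totalX_compX] at hdiag
  · have hsource := h.source
    rw [harg, hfib.totalJac_eq, hproj.totalX_compX, hproj.totalX_compT, hfib.self_of_nhds.2.1.1,
      hproj.contactFactor_eq] at hsource
    refine mul_left_cancel₀ (pow_ne_zero 2 hX) ?_
    linear_combination hsource

lemma eventually_fibreEqs {θ θ' : ArbElem} {φ : PointTransformation J0} {j : J1}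
    (hθ : θ ∈ waveClass) (h : ∀ᶠ i in 𝓝 j, DeterminingEqs θ θ' φ i) :
    ∀ᶠ i in 𝓝 j, FibreEqs θ θ' φ.toFun i :=
  h.eventually_nhds.mono fun _ hi =>
    hi.self_of_nhds.fibreEqs (fibrePreserving_of_determiningEqs hθ hi)

section FibreEqs

variable {θ θ' : ArbElem} {φ : J0 → J0} {j : J1} {v : J0}

lemma eventually_line {p : J1 → Prop} (h : ∀ᶠ i in 𝓝 j, p i) (v : J0) :
    ∀ᶠ s in 𝓝 (0 : ℝ), p (j.1 + s • v, j.2) :=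
  ((tendsto_line j.1 v).prodMk_nhds tendsto_const_nhds).eventually h

lemma eventually_ux {p : J1 → Prop} (h : ∀ᶠ i in 𝓝 j, p i) :
    ∀ᶠ r in 𝓝 j.2.2, p (j.1, (j.2.1, r)) :=
  ((by fun_prop : Continuous fun r : ℝ => ((j.1, (j.2.1, r)) : J1)).tendsto j.2.2).eventually h

lemma jetArg_line (hv : v.2.1 = 0) (s : ℝ) : jetArg (j.1 + s • v, j.2) = jetArg j := by
  simp [jetArg, hv]

lemma quadratic_in_ut (h : ∀ᶠ i in 𝓝 j, FibreEqs θ θ' φ i) :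
    ∂ᵤ (∂ᵤ (compU φ)) j.1 = 0 ∧
      2 * ∂ₜ (∂ᵤ (compU φ)) j.1 = rateT φ j.1 * ∂ᵤ (compU φ) j.1 := by
  have hline : ContinuousAt (fun s : ℝ => ((s, j.2.2) : ℝ × ℝ)) j.2.1 := by fun_prop
  have hj := h.self_of_nhds
  obtain ⟨hquad, hlin, -⟩ := quadratic_eventually_zero (s₀ := j.2.1)
    (a := ∂ᵤ (∂ᵤ (compU φ)) j.1)
    (b := 2 * ∂ₜ (∂ᵤ (compU φ)) j.1 - rateT φ j.1 * ∂ᵤ (compU φ) j.1)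
    (c := ∂ᵤ (compU φ) j.1 * θ.g (jetArg j) + accelU φ j.1
      - θ.f (jetArg j) * contactHess φ j (horX j) (horX j)
      - ∂ₜ (compT φ) j.1 ^ 2 * θ'.g (compX φ j.1, fibreSlope φ j)) (by
      filter_upwards [hline.eventually (eventually_fibre h)] with s hs
      have hsource := hs.source
      rw [hs.fibre.contactHess_horT_eq hs.dX_ne, hs.fibre.contactHess_horX_eq hs.dT_ne] at hsource
      rw [hj.fibre.contactHess_horX_eq hj.dT_ne]
      simp only [show jetArg (j.1, (s, j.2.2)) = jetArg j from rfl,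
        show fibreSlope φ (j.1, (s, j.2.2)) = fibreSlope φ j from rfl] at hsource
      linear_combination hsource)
  exact ⟨hquad, sub_eq_zero.1 hlin⟩

/-! ## Differential consequences of the determining equations -/

lemma partialUx_symbol (h : ∀ᶠ i in 𝓝 j, FibreEqs θ θ' φ i) :
    partialUx θ'.f (compX φ j.1, fibreSlope φ j) * ∂ᵤ (compU φ) j.1 * ∂ₜ (compT φ) j.1 ^ 2
      = partialUx θ.f (jetArg j) * ∂ₓ (compX φ) j.1 ^ 3 := by
  have hj := h.self_of_nhds
  have hleft := (FibrePreserving.hasDerivAt_comp_slope_fibre (differentiableAt_of_smooth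
    (θ'.contDiffAt_f hj.mem_dom'))).mul_const (∂ₜ (compT φ) j.1 ^ 2)
  have hright := (hasDerivAt_partialUx (differentiableAt_of_smooth
    (θ.contDiffAt_f hj.mem_dom))).mul_const (∂ₓ (compX φ) j.1 ^ 2)
  have heq := hleft.unique (hright.congr_of_eventuallyEq
    ((eventually_ux h).mono fun _ hr => hr.symbol))
  have hX := hj.dX_ne
  field_simp at heq
  linear_combination heq

/-- The symbol equation is differentiated along `v` and with respect to `u_x`, and the two
derivatives of `θ'.f` are eliminated. -/
lemma dirDeriv_symbol (h : ∀ᶠ i in 𝓝 j, FibreEqs θ θ' φ i) (hv : v.2.1 = 0) :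
    partialUx θ.f (jetArg j) * ∂ₜ (compT φ) j.1
        * (dirDeriv v (∂ₓ (compU φ)) j.1 + j.2.2 * dirDeriv v (∂ᵤ (compU φ)) j.1)
      + 2 * θ.f (jetArg j) * ∂ᵤ (compU φ) j.1 * dirDeriv v (∂ₜ (compT φ)) j.1 = 0 := by
  have hj := h.self_of_nhds
  have hT := hasDerivAt_line_zero (differentiableAt_of_smooth
    (contDiffAt_dirDeriv (smooth_comps hj.fibre.self_of_nhds.1).1 (1, 0, 0))) v
  have hderiv := (hj.fibre.hasDerivAt_comp_slope_line hv (differentiableAt_of_smooth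
    (θ'.contDiffAt_f hj.mem_dom'))).mul (hT.pow 2)
  have hconst := hderiv.unique ((hasDerivAt_const (0 : ℝ)
    (θ.f (jetArg j) * ∂ₓ (compX φ) j.1 ^ 2)).congr_of_eventuallyEq (by
      filter_upwards [eventually_line h v, (hj.fibre.constAlong_dX hv).eventually_eq_on_line]
        with s hs hXs
      have hsymbol := hs.symbol
      rw [jetArg_line hv] at hsymbol
      simpa [hXs] using hsymbol))
  have hux := partialUx_symbol h
  have hsymbol := hj.symbol
  have hX := hj.dX_ne
  simp only [zero_smul, add_zero, Nat.cast_ofNat, Nat.add_one_sub_one, pow_one, Pi.pow_apply,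
    Prod.mk.eta] at hconst
  field_simp at hconst
  refine mul_left_cancel₀ (pow_ne_zero 3 hX) ?_
  linear_combination ∂ᵤ (compU φ) j.1 * ∂ₜ (compT φ) j.1 * hconst
    - ∂ₜ (compT φ) j.1 * (dirDeriv v (∂ₓ (compU φ)) j.1 + j.2.2 * dirDeriv v (∂ᵤ (compU φ)) j.1)
      * hux
    - 2 * ∂ₓ (compX φ) j.1 * ∂ᵤ (compU φ) j.1 * dirDeriv v (∂ₜ (compT φ)) j.1 * hsymbol

lemma partialUx_f_mul_dX_dU (h : ∀ᶠ i in 𝓝 j, FibreEqs θ θ' φ i) :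
    partialUx θ.f (jetArg j) * ∂ₓ (∂ᵤ (compU φ)) j.1 = 0 := by
  have hj := h.self_of_nhds
  have hsymbol := dirDeriv_symbol (v := (0, 0, 1)) h rfl
  rw [(quadratic_in_ut h).1, (hj.fibre.constAlong_dT (v := (0, 0, 1)) rfl).self_of_nhds.2,
    dirDeriv_comm (smooth_comps hj.fibre.self_of_nhds.1).2.2] at hsymbol
  refine mul_left_cancel₀ hj.dT_ne ?_
  linear_combination hsymbol

lemma dirDeriv_t_symbol (h : ∀ᶠ i in 𝓝 j, FibreEqs θ θ' φ i) :
    partialUx θ.f (jetArg j) * (∂ₜ (∂ₓ (compU φ)) j.1 + j.2.2 * ∂ₜ (∂ᵤ (compU φ)) j.1)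
      + 4 * θ.f (jetArg j) * ∂ₜ (∂ᵤ (compU φ)) j.1 = 0 := by
  have hT := h.self_of_nhds.dT_ne
  have hrate := (quadratic_in_ut h).2
  rw [rateT] at hrate
  field_simp at hrate
  refine mul_left_cancel₀ hT ?_
  linear_combination dirDeriv_symbol (v := (1, 0, 0)) h rfl + 2 * θ.f (jetArg j) * hrate

lemma source_eq (h : ∀ᶠ i in 𝓝 j, FibreEqs θ θ' φ i) :
    ∂ᵤ (compU φ) j.1 * θ.g (jetArg j) + accelU φ j.1 - θ.f (jetArg j) * (∂ₓ (∂ₓ (compU φ)) j.1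
        - rateX φ j.1 * (∂ₓ (compU φ) j.1 + j.2.2 * ∂ᵤ (compU φ) j.1)
        + 2 * j.2.2 * ∂ₓ (∂ᵤ (compU φ)) j.1)
      = ∂ₜ (compT φ) j.1 ^ 2 * θ'.g (compX φ j.1, fibreSlope φ j) := by
  have hj := h.self_of_nhds
  have hsource := hj.source
  obtain ⟨hquad, hlin⟩ := quadratic_in_ut h
  rw [hj.fibre.contactHess_horT_eq hj.dX_ne, hj.fibre.contactHess_horX_eq hj.dT_ne, hquad]
    at hsource
  linear_combination hsource - j.2.1 * hlin

lemma partialUx_source (h : ∀ᶠ i in 𝓝 j, FibreEqs θ θ' φ i)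
    (hf : partialUx θ.f (jetArg j) = 0) :
    ∂ₓ (compX φ) j.1 * (∂ᵤ (compU φ) j.1 * partialUx θ.g (jetArg j)
        + θ.f (jetArg j) * (rateX φ j.1 * ∂ᵤ (compU φ) j.1 - 2 * ∂ₓ (∂ᵤ (compU φ)) j.1))
      = ∂ₜ (compT φ) j.1 ^ 2 * ∂ᵤ (compU φ) j.1
        * partialUx θ'.g (compX φ j.1, fibreSlope φ j) := by
  have hj := h.self_of_nhds
  have hfr := hasDerivAt_partialUx (differentiableAt_of_smooth (θ.contDiffAt_f hj.mem_dom))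
  have hgr := hasDerivAt_partialUx (differentiableAt_of_smooth (θ.contDiffAt_g hj.mem_dom))
  have hid := hasDerivAt_id j.2.2
  have hright := (FibrePreserving.hasDerivAt_comp_slope_fibre (differentiableAt_of_smooth
    (θ'.contDiffAt_g hj.mem_dom'))).const_mul (∂ₜ (compT φ) j.1 ^ 2)
  have hbracket := (((hid.mul_const (∂ᵤ (compU φ) j.1)).const_add (∂ₓ (compU φ) j.1)).const_mul
    (rateX φ j.1)).const_sub (∂ₓ (∂ₓ (compU φ)) j.1)
    |>.add ((hid.const_mul 2).mul_const (∂ₓ (∂ᵤ (compU φ)) j.1))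
  have hleft := ((hgr.const_mul (∂ᵤ (compU φ) j.1)).add_const (accelU φ j.1)).sub
    (hfr.mul hbracket)
  have heq := hleft.unique (hright.congr_of_eventuallyEq
    ((eventually_ux h.eventually_nhds).mono fun _ hr => source_eq hr))
  have hX := hj.dX_ne
  rw [hf] at heq
  field_simp at heq
  linear_combination heq

lemma partialUx_partialUx_source (h : ∀ᶠ i in 𝓝 j, FibreEqs θ θ' φ i)
    (hf : ∀ᶠ i in 𝓝 j, partialUx θ.f (jetArg i) = 0) :
    ∂ₓ (compX φ) j.1 ^ 2 * partialUx (partialUx θ.g) (jetArg j)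
      = ∂ₜ (compT φ) j.1 ^ 2 * ∂ᵤ (compU φ) j.1
        * partialUx (partialUx θ'.g) (compX φ j.1, fibreSlope φ j) := by
  have hj := h.self_of_nhds
  have hfr := hasDerivAt_partialUx (differentiableAt_of_smooth (θ.contDiffAt_f hj.mem_dom))
  have hgr := hasDerivAt_partialUx (differentiableAt_of_smooth
    (contDiffAt_partialUx (θ.contDiffAt_g hj.mem_dom)))
  have hleft := ((hgr.const_mul (∂ᵤ (compU φ) j.1)).add (hfr.mul_const (rateX φ j.1
    * ∂ᵤ (compU φ) j.1 - 2 * ∂ₓ (∂ᵤ (compU φ)) j.1))).const_mul (∂ₓ (compX φ) j.1)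
  have hright := (FibrePreserving.hasDerivAt_comp_slope_fibre (differentiableAt_of_smooth
    (contDiffAt_partialUx (θ'.contDiffAt_g hj.mem_dom')))).const_mul
      (∂ₜ (compT φ) j.1 ^ 2 * ∂ᵤ (compU φ) j.1)
  have heq := hleft.unique (hright.congr_of_eventuallyEq
    ((eventually_ux (h.eventually_nhds.and hf)).mono fun _ hr => partialUx_source hr.1 hr.2))
  have hX := hj.dX_ne
  rw [hf.self_of_nhds] at heq
  field_simp at heq
  refine mul_left_cancel₀ hj.dU_ne ?_
  linear_combination heq

lemma partialUx_partialUx_g_mul (h : ∀ᶠ i in 𝓝 j, FibreEqs θ θ' φ i)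
    (hf : ∀ᶠ i in 𝓝 j, partialUx θ.f (jetArg i) = 0) (hv : v.2.1 = 0)
    (hT : ConstAlong v (∂ₜ (compT φ)) j.1) (hU : ConstAlong v (∂ᵤ (compU φ)) j.1) :
    partialUx (partialUx θ.g) (jetArg j) * dirDeriv v (∂ₓ (compU φ)) j.1 = 0 := by
  have hj := h.self_of_nhds
  have hderiv := hj.fibre.hasDerivAt_comp_slope_line hv (differentiableAt_of_smooth
    (contDiffAt_partialUx (θ'.contDiffAt_g hj.mem_dom')))
  have hright := hderiv.const_mul (∂ₜ (compT φ) j.1 ^ 2 * ∂ᵤ (compU φ) j.1)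
  have hconst := hright.unique ((hasDerivAt_const (0 : ℝ) _).congr_of_eventuallyEq (by
    filter_upwards [eventually_line (h.eventually_nhds.and hf) v, hT.eventually_eq_on_line,
      hU.eventually_eq_on_line, (hU.of_dirDeriv (0, 1, 0)).eventually_eq_on_line,
      (hj.fibre.constAlong_dX hv).eventually_eq_on_line,
      hj.fibre.rateX_eventually_eq_on_line hv] with s hs hTs hUs hUxs hXs hrate
    have hsource := partialUx_source hs.1 hs.2
    rw [jetArg_line hv] at hsource
    simp only [hTs, hUs, hUxs, hXs, hrate] at hsource
    exact hsource.symm))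
  have hgpp := partialUx_partialUx_source h hf
  have hX := hj.dX_ne
  rw [hU.self_of_nhds.2, mul_zero, add_zero] at hconst
  field_simp at hconst
  refine mul_left_cancel₀ (pow_ne_zero 2 hX) ?_
  linear_combination dirDeriv v (∂ₓ (compU φ)) j.1 * hgpp + hconst

lemma constAlong_u_dU (h : ∀ᶠ i in 𝓝 j, FibreEqs θ θ' φ i) :
    ConstAlong (0, 0, 1) (∂ᵤ (compU φ)) j.1 :=
  eventually_base (h.eventually_nhds.mono fun _ hi =>
    ⟨contDiffAt_dirDeriv (smooth_comps hi.self_of_nhds.fibre.self_of_nhds.1).2.2 _,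
      (quadratic_in_ut hi).1⟩)

lemma dX_dU_eq_zero (hθ : θ ∈ waveClass) (h : ∀ᶠ i in 𝓝 j, FibreEqs θ θ' φ i) :
    ∂ₓ (∂ᵤ (compU φ)) j.1 = 0 := by
  by_contra hne
  have hU := (smooth_comps h.self_of_nhds.fibre.self_of_nhds.1).2.2
  have hne' := eventually_of_eventually_base ((differentiableAt_of_smooth (contDiffAt_dirDeriv
    (contDiffAt_dirDeriv hU (0, 0, 1)) (0, 1, 0))).continuousAt.eventually_ne hne)
  have hf : ∀ᶠ i in 𝓝 j, partialUx θ.f (jetArg i) = 0 := by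
    filter_upwards [h.eventually_nhds, hne'] with i hi hnei
    exact (mul_eq_zero.mp (partialUx_f_mul_dX_dU hi)).resolve_right hnei
  refine not_linear_of_mem_waveClass hθ (j := j) ?_
  filter_upwards [h.eventually_nhds, hne', hf.eventually_nhds] with i hi hnei hfi
  have hg := partialUx_partialUx_g_mul hi hfi rfl
    (hi.self_of_nhds.fibre.constAlong_dT rfl) (constAlong_u_dU hi)
  rw [dirDeriv_comm (smooth_comps hi.self_of_nhds.fibre.self_of_nhds.1).2.2] at hg
  exact ⟨hi.self_of_nhds.mem_dom, hfi.self_of_nhds, (mul_eq_zero.mp hg).resolve_right hnei⟩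

lemma constAlong_x_dU (hθ : θ ∈ waveClass) (h : ∀ᶠ i in 𝓝 j, FibreEqs θ θ' φ i) :
    ConstAlong (0, 1, 0) (∂ᵤ (compU φ)) j.1 :=
  eventually_base (h.eventually_nhds.mono fun _ hi =>
    ⟨contDiffAt_dirDeriv (smooth_comps hi.self_of_nhds.fibre.self_of_nhds.1).2.2 _,
      dX_dU_eq_zero hθ hi⟩)

lemma constAlong_u_dX (hθ : θ ∈ waveClass) (h : ∀ᶠ i in 𝓝 j, FibreEqs θ θ' φ i) :
    ConstAlong (0, 0, 1) (∂ₓ (compU φ)) j.1 :=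
  eventually_base (h.eventually_nhds.mono fun _ hi =>
    have hU := (smooth_comps hi.self_of_nhds.fibre.self_of_nhds.1).2.2
    ⟨contDiffAt_dirDeriv hU _, (dirDeriv_comm hU _ _).trans (dX_dU_eq_zero hθ hi)⟩)

lemma dU_accelU (hθ : θ ∈ waveClass) (h : ∀ᶠ i in 𝓝 j, FibreEqs θ θ' φ i) :
    ∂ᵤ (accelU φ) j.1 = 0 := by
  have hj := h.self_of_nhds
  have hline := hasDerivAt_line_zero (differentiableAt_of_smooth (hj.fibre.contDiffAt_accelU
    hj.dT_ne)) (0, 0, 1)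
  refine hline.unique ((hasDerivAt_const (0 : ℝ) (accelU φ j.1)).congr_of_eventuallyEq ?_)
  have hUx := constAlong_u_dX hθ h
  filter_upwards [eventually_line h.eventually_nhds (0, 0, 1),
    (hj.fibre.projectable.constAlong_compX).eventually_eq_on_line,
    (hj.fibre.constAlong_dT (v := (0, 0, 1)) rfl).eventually_eq_on_line,
    (hj.fibre.constAlong_dX (v := (0, 0, 1)) rfl).eventually_eq_on_line,
    hj.fibre.rateX_eventually_eq_on_line (v := (0, 0, 1)) rfl,
    (constAlong_u_dU h).eventually_eq_on_line,
    hUx.eventually_eq_on_line, (hUx.of_dirDeriv (0, 1, 0)).eventually_eq_on_line]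
    with s hs hX hTt hXx hrate hUu hUx hUxx
  have hsource := source_eq hs
  have hslope : fibreSlope φ (j.1 + s • (0, 0, 1), j.2) = fibreSlope φ j := by
    simp only [fibreSlope, hUx, hUu, hXx]
  rw [jetArg_line rfl, hslope] at hsource
  simp only [hX, hTt, hrate, hUu, hUx, hUxx, dX_dU_eq_zero hθ hs] at hsource
  linear_combination hsource - source_eq h
    + 2 * θ.f (jetArg j) * j.2.2 * -dX_dU_eq_zero hθ h

lemma dTT_dU_eq (hθ : θ ∈ waveClass) (h : ∀ᶠ i in 𝓝 j, FibreEqs θ θ' φ i) :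
    ∂ₜ (∂ₜ (∂ᵤ (compU φ))) j.1 = rateT φ j.1 * ∂ₜ (∂ᵤ (compU φ)) j.1 :=
  have hj := h.self_of_nhds
  sub_eq_zero.1 ((hj.fibre.dirDeriv_accelU hj.dT_ne rfl).symm.trans (dU_accelU hθ h))

lemma partialUx_f_mul_dX_accelU (hθ : θ ∈ waveClass) (h : ∀ᶠ i in 𝓝 j, FibreEqs θ θ' φ i) :
    partialUx θ.f (jetArg j) * ∂ₓ (accelU φ) j.1 = 0 := by
  have hj := h.self_of_nhds
  have hU := (smooth_comps hj.fibre.self_of_nhds.1).2.2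
  have hUtx := hasDerivAt_line_zero (differentiableAt_of_smooth (contDiffAt_dirDeriv
    (contDiffAt_dirDeriv hU (0, 1, 0)) (1, 0, 0))) (1, 0, 0)
  have hUtu := hasDerivAt_line_zero (differentiableAt_of_smooth (contDiffAt_dirDeriv
    (contDiffAt_dirDeriv hU (0, 0, 1)) (1, 0, 0))) (1, 0, 0)
  have hderiv := ((hUtx.add (hUtu.const_mul j.2.2)).const_mul (partialUx θ.f (jetArg j))).add
    (hUtu.const_mul (4 * θ.f (jetArg j)))
  have hconst := hderiv.unique ((hasDerivAt_const (0 : ℝ) (0 : ℝ)).congr_of_eventuallyEq (by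
    filter_upwards [eventually_line h.eventually_nhds (1, 0, 0)] with s hs
    simpa [jetArg] using dirDeriv_t_symbol hs))
  rw [hj.fibre.dirDeriv_accelU hj.dT_ne rfl]
  linear_combination hconst - rateT φ j.1 * dirDeriv_t_symbol h
    - (partialUx θ.f (jetArg j) * j.2.2 + 4 * θ.f (jetArg j)) * dTT_dU_eq hθ h

lemma dT_dU_eq_zero (hθ : θ ∈ waveClass) (h : ∀ᶠ i in 𝓝 j, FibreEqs θ θ' φ i)
    (hf : partialUx θ.f (jetArg j) = 0) : ∂ₜ (∂ᵤ (compU φ)) j.1 = 0 := by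
  have hsymbol := dirDeriv_t_symbol h
  rw [hf, zero_mul, zero_add] at hsymbol
  have hne := hθ.1 (jetArg j) h.self_of_nhds.mem_dom
  exact (mul_eq_zero.mp hsymbol).resolve_left (mul_ne_zero four_ne_zero hne)

lemma dT_dT_eq_zero (h : ∀ᶠ i in 𝓝 j, FibreEqs θ θ' φ i)
    (hU : ∂ₜ (∂ᵤ (compU φ)) j.1 = 0) : ∂ₜ (∂ₜ (compT φ)) j.1 = 0 := by
  have hj := h.self_of_nhds
  have hrate := (quadratic_in_ut h).2
  rw [hU, mul_zero] at hrate
  exact (div_eq_zero_iff.1 ((mul_eq_zero.1 hrate.symm).resolve_right hj.dU_ne)).resolve_right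
    hj.dT_ne

lemma partialUx_partialUx_g_mul_dX_dT (hθ : θ ∈ waveClass)
    (h : ∀ᶠ i in 𝓝 j, FibreEqs θ θ' φ i) (hf : ∀ᶠ i in 𝓝 j, partialUx θ.f (jetArg i) = 0) :
    partialUx (partialUx θ.g) (jetArg j) * ∂ₜ (∂ₓ (compU φ)) j.1 = 0 := by
  have hUtu : ∀ᶠ i in 𝓝 j, ∂ₜ (∂ᵤ (compU φ)) i.1 = 0 := by
    filter_upwards [h.eventually_nhds, hf] with i hi hfi using dT_dU_eq_zero hθ hi hfi
  have hU : ConstAlong (1, 0, 0) (∂ᵤ (compU φ)) j.1 :=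
    eventually_base ((h.and hUtu).mono fun _ hi =>
      ⟨contDiffAt_dirDeriv (smooth_comps hi.1.fibre.self_of_nhds.1).2.2 _, hi.2⟩)
  have hT : ConstAlong (1, 0, 0) (∂ₜ (compT φ)) j.1 :=
    eventually_base ((h.eventually_nhds.and hUtu).mono fun _ hi =>
      ⟨contDiffAt_dirDeriv (smooth_comps hi.1.self_of_nhds.fibre.self_of_nhds.1).1 _,
        dT_dT_eq_zero hi.1 hi.2⟩)
  exact partialUx_partialUx_g_mul h hf rfl hT hU

lemma partialUx_partialUx_g_mul_dX_accelU (hθ : θ ∈ waveClass)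
    (h : ∀ᶠ i in 𝓝 j, FibreEqs θ θ' φ i) (hf : ∀ᶠ i in 𝓝 j, partialUx θ.f (jetArg i) = 0) :
    partialUx (partialUx θ.g) (jetArg j) * ∂ₓ (accelU φ) j.1 = 0 := by
  refine mul_eq_zero.2 (or_iff_not_imp_left.2 fun hg => ?_)
  have hj := h.self_of_nhds
  have hg' : ∀ᶠ i in 𝓝 j, partialUx (partialUx θ.g) (jetArg i) ≠ 0 :=
    (continuous_jetArg.tendsto j).eventually ((contDiffAt_partialUx (contDiffAt_partialUx
      (θ.contDiffAt_g hj.mem_dom))).continuousAt.eventually_ne hg)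
  have hUtx : ∀ᶠ y in 𝓝 j.1, ∂ₜ (∂ₓ (compU φ)) y = 0 := eventually_base (by
    filter_upwards [h.eventually_nhds, hf.eventually_nhds, hg'] with i hi hfi hgi
    exact (mul_eq_zero.mp (partialUx_partialUx_g_mul_dX_dT hθ hi hfi)).resolve_left hgi)
  rw [hj.fibre.dirDeriv_accelU hj.dT_ne rfl, hUtx.self_of_nhds,
    dirDeriv_eventually_const hUtx, mul_zero, sub_zero]

lemma dX_accelU (hθ : θ ∈ waveClass) (h : ∀ᶠ i in 𝓝 j, FibreEqs θ θ' φ i) :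
    ∂ₓ (accelU φ) j.1 = 0 := by
  by_contra hne
  have hj := h.self_of_nhds
  have hne' := eventually_of_eventually_base ((differentiableAt_of_smooth (contDiffAt_dirDeriv
    (hj.fibre.contDiffAt_accelU hj.dT_ne) (0, 1, 0))).continuousAt.eventually_ne hne)
  have hf : ∀ᶠ i in 𝓝 j, partialUx θ.f (jetArg i) = 0 := by
    filter_upwards [h.eventually_nhds, hne'] with i hi hnei
    exact (mul_eq_zero.mp (partialUx_f_mul_dX_accelU hθ hi)).resolve_right hnei
  refine not_linear_of_mem_waveClass hθ (j := j) ?_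
  filter_upwards [h.eventually_nhds, hne', hf.eventually_nhds] with i hi hnei hfi
  exact ⟨hi.self_of_nhds.mem_dom, hfi.self_of_nhds,
    (mul_eq_zero.mp (partialUx_partialUx_g_mul_dX_accelU hθ hi hfi)).resolve_right hnei⟩

end FibreEqs

section Identity

variable (j : J1) (a b : ℝ)

lemma total_comps_id :
    (totalT (compT id) j = 1 ∧ totalX (compT id) j = 0) ∧
      (totalT (compX id) j = 0 ∧ totalX (compX id) j = 1) ∧
      totalT (compU id) j = j.2.1 ∧ totalX (compU id) j = j.2.2 := by
  have hT : compT id = ContinuousLinearMap.fst ℝ ℝ (ℝ × ℝ) := rfl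
  have hX : compX id = (ContinuousLinearMap.fst ℝ ℝ ℝ).comp (.snd ℝ ℝ (ℝ × ℝ)) := rfl
  have hU : compU id = (ContinuousLinearMap.snd ℝ ℝ ℝ).comp (.snd ℝ ℝ (ℝ × ℝ)) := rfl
  simp only [totalT, totalX, hT, hX, hU, ContinuousLinearMap.fderiv]
  simp

lemma totalJac_id : totalJac id j = 1 := by
  simp [totalJac, total_comps_id]

lemma newDeriv_id : newDerivT id j a b = a ∧ newDerivX id j a b = b := by
  simp [newDerivT, newDerivX, totalJac_id, total_comps_id]

lemma newUt_newUx_id : newUt id j = j.2.1 ∧ newUx id j = j.2.2 := by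
  simp [newUt, newUx, newDeriv_id, total_comps_id]

lemma prolong2_id (k : J2) : prolong2 id k = k := by
  have hUt : newUt id = (ContinuousLinearMap.fst ℝ ℝ ℝ).comp (.snd ℝ J0 (ℝ × ℝ)) :=
    funext fun j => (newUt_newUx_id j).1
  have hUx : newUx id = (ContinuousLinearMap.snd ℝ ℝ ℝ).comp (.snd ℝ J0 (ℝ × ℝ)) :=
    funext fun j => (newUt_newUx_id j).2
  simp only [prolong2, prolong1, newDeriv_id, totalT', totalX', newUt_newUx_id]
  simp only [hUt, hUx, ContinuousLinearMap.fderiv]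
  simp

end Identity

section Smoothness

variable {F : J1 → ℝ} {φ : J0 → J0} {k : J2}

lemma contDiffAt_totalT' (hF : ContDiffAt ℝ ∞ F k.1) : ContDiffAt ℝ ∞ (totalT' F) k :=
  (ContDiffAt.comp (g := fderiv ℝ F) k (hF.fderiv_right (m := ∞) (by norm_cast))
    contDiffAt_fst).clm_apply (by fun_prop)

lemma contDiffAt_totalX' (hF : ContDiffAt ℝ ∞ F k.1) : ContDiffAt ℝ ∞ (totalX' F) k :=
  (ContDiffAt.comp (g := fderiv ℝ F) k (hF.fderiv_right (m := ∞) (by norm_cast))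
    contDiffAt_fst).clm_apply (by fun_prop)

lemma contDiffAt_prolong1 {j : J1} (hφ : ContDiffAt ℝ ∞ φ j.1) (hJ : totalJac φ j ≠ 0) :
    ContDiffAt ℝ ∞ (prolong1 φ) j :=
  (hφ.comp j contDiffAt_fst).prodMk ((contDiffAt_newUt hφ hJ).prodMk (contDiffAt_newUx hφ hJ))

lemma contDiffAt_prolong2 (hφ : ContDiffAt ℝ ∞ φ k.1.1) (hJ : totalJac φ k.1 ≠ 0) :
    ContDiffAt ℝ ∞ (prolong2 φ) k := by
  have hUt := contDiffAt_newUt hφ hJ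
  have hUx := contDiffAt_newUx hφ hJ
  exact (ContDiffAt.comp (g := prolong1 φ) k (contDiffAt_prolong1 hφ hJ) contDiffAt_fst).prodMk
    ((contDiffAt_newDerivT contDiffAt_fst (contDiffAt_totalT' hUt) (contDiffAt_totalX' hUt)
      hφ hJ).prodMk
    ((contDiffAt_newDerivX contDiffAt_fst (contDiffAt_totalT' hUt) (contDiffAt_totalX' hUt)
      hφ hJ).prodMk
    (contDiffAt_newDerivX contDiffAt_fst (contDiffAt_totalT' hUx) (contDiffAt_totalX' hUx)
      hφ hJ)))

end Smoothness

/-! ## Sufficiency of the determining equations -/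

/-- The action of a fibre-preserving transformation on the values `(f, g)` of the arbitrary
elements: the prolongation of `φ` maps the line `u_tt = f u_xx + g` over the first-order jet `j`
to the line with coefficients `fibreVal φ j (f, g)`. -/
noncomputable def fibreVal (φ : J0 → J0) (j : J1) (y : ℝ × ℝ) : ℝ × ℝ :=
  (∂ₓ (compX φ) j.1 ^ 2 * y.1 / ∂ₜ (compT φ) j.1 ^ 2,
    (∂ᵤ (compU φ) j.1 * y.2 + contactHess φ j (horT j) (horT j)
      - y.1 * contactHess φ j (horX j) (horX j)) / ∂ₜ (compT φ) j.1 ^ 2)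

lemma FibrePreserving.prolong2_mem_line_iff {φ : J0 → J0} {k : J2} (h : FibrePreserving φ k.1.1)
    (hT : ∂ₜ (compT φ) k.1.1 ≠ 0) (hX : ∂ₓ (compX φ) k.1.1 ≠ 0) (hU : ∂ᵤ (compU φ) k.1.1 ≠ 0)
    (y : ℝ × ℝ) :
    (prolong2 φ k).2.1 = (fibreVal φ k.1 y).1 * (prolong2 φ k).2.2.2 + (fibreVal φ k.1 y).2 ↔
      k.2.1 = y.1 * k.2.2.2 + y.2 := by
  have hJ : totalJac φ k.1 ≠ 0 := h.totalJac_eq ▸ mul_ne_zero hT hX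
  have hφ := h.self_of_nhds.1
  have hproj := h.projectable
  have htt : (prolong2 φ k).2.1 * ∂ₜ (compT φ) k.1.1 ^ 2 = contactTT φ k := by
    rw [prolong2_tt hφ hJ, hproj.totalT_compX, hproj.totalX_compX, h.totalJac_eq,
      h.self_of_nhds.2.2.1]
    field_simp
    ring
  have hxx : (prolong2 φ k).2.2.2 * ∂ₓ (compX φ) k.1.1 ^ 2 = contactXX φ k := by
    rw [prolong2_xx hφ hJ, hproj.totalT_compT, hproj.totalX_compT, h.totalJac_eq,
      h.self_of_nhds.2.1.1]
    field_simp
    ring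
  rw [contactTT, hproj.contactFactor_eq] at htt
  rw [contactXX, hproj.contactFactor_eq] at hxx
  simp only [fibreVal]
  field_simp
  refine ⟨fun hline => mul_left_cancel₀ hU ?_, fun hline => ?_⟩
  · linear_combination hline - htt + y.1 * hxx
  · linear_combination htt - y.1 * hxx + ∂ᵤ (compU φ) k.1.1 * hline

namespace FibreEqs

variable {θ θ' : ArbElem} {φ : J0 → J0} {j : J1}

lemma jetArg_prolong1 (h : FibreEqs θ θ' φ j) :
    jetArg (prolong1 φ j) = (compX φ j.1, fibreSlope φ j) :=
  h.fibre.jetArg_prolong1 h.dT_ne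

lemma val_prolong1 (h : FibreEqs θ θ' φ j) :
    θ'.val (prolong1 φ j) = fibreVal φ j (θ.val j) := by
  have hT := h.dT_ne
  simp only [ArbElem.val, h.jetArg_prolong1, fibreVal]
  refine Prod.ext ?_ ?_
  · field_simp
    linear_combination h.symbol
  · field_simp
    linear_combination -h.source

lemma prolong2_mem_eqn_iff {k : J2} (h : FibreEqs θ θ' φ k.1) :
    k ∈ θ.eqn ↔ prolong2 φ k ∈ θ'.eqn := by
  have hline := h.fibre.prolong2_mem_line_iff h.dT_ne h.dX_ne h.dU_ne (θ.val k.1)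
  rw [← h.val_prolong1] at hline
  have hdom' : jetArg (prolong1 φ k.1) ∈ θ'.dom := h.jetArg_prolong1 ▸ h.mem_dom'
  exact ⟨fun hk => ⟨hdom', hline.2 hk.2⟩, fun hk => ⟨h.mem_dom, hline.1 hk.2⟩⟩

end FibreEqs

lemma admissibleAt_of_fibreEqs {θ θ' : ArbElem} {φ : PointTransformation J0} {j : J1}
    (hj : j.1 ∈ φ.source) (h : ∀ᶠ i in 𝓝 j, FibreEqs θ θ' φ.toFun i) : AdmissibleAt θ θ' φ j := by
  have hj' := h.self_of_nhds
  exact ⟨hj, hj'.mem_dom, hj'.fibre.totalJac_eq ▸ mul_ne_zero hj'.dT_ne hj'.dX_ne,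
    (Filter.tendsto_comap.eventually h).mono fun _ hk => hk.prolong2_mem_eqn_iff⟩

/-! ## Equivalence transformations -/

/-- The parameters of an equivalence transformation
`t̃ = c₁ t + c₀`, `x̃ = X(x)`, `ũ = c₂ u + c₄ t ^ 2 + c₃ t + ψ(x)` of the class. -/
structure EquivParams where
  (c₀ c₁ c₂ c₃ c₄ : ℝ)
  X : PointTransformation ℝ
  ψ : ℝ → ℝ
  c₁_ne : c₁ ≠ 0
  c₂_ne : c₂ ≠ 0
  smooth_ψ : ContDiffOn ℝ ∞ ψ X.source

lemma PointTransformation.deriv_ne_zero (X : PointTransformation ℝ) {x : ℝ} (hx : x ∈ X.source) :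
    deriv X.toFun x ≠ 0 := by
  intro hzero
  obtain ⟨v, hv⟩ := X.fderiv_surjective hx 1
  rw [← mul_one v, ← smul_eq_mul v, map_smul, fderiv_apply_one_eq_deriv, hzero] at hv
  simp at hv

lemma dirDeriv_separated {a b : ℝ → ℝ} {z : J0} (ha : DifferentiableAt ℝ a z.1)
    (hb : DifferentiableAt ℝ b z.2.1) (c : ℝ) (v : J0) :
    dirDeriv v (fun y => a y.1 + b y.2.1 + c * y.2.2) z
      = v.1 * deriv a z.1 + v.2.1 * deriv b z.2.1 + v.2.2 * c := by
  let T := ContinuousLinearMap.fst ℝ ℝ (ℝ × ℝ)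
  let X := (ContinuousLinearMap.fst ℝ ℝ ℝ).comp (.snd ℝ ℝ (ℝ × ℝ))
  let U := (ContinuousLinearMap.snd ℝ ℝ ℝ).comp (.snd ℝ ℝ (ℝ × ℝ))
  have ha' : HasFDerivAt (fun y : J0 => a y.1) (deriv a z.1 • T) z :=
    HasDerivAt.comp_hasFDerivAt (h₂ := a) z ha.hasDerivAt T.hasFDerivAt
  have hb' : HasFDerivAt (fun y : J0 => b y.2.1) (deriv b z.2.1 • X) z :=
    HasDerivAt.comp_hasFDerivAt (h₂ := b) z hb.hasDerivAt X.hasFDerivAt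
  have hc' : HasFDerivAt (fun y : J0 => c * y.2.2) (c • U) z := U.hasFDerivAt.const_mul c
  rw [dirDeriv, ((ha'.fun_add hb').fun_add hc').fderiv]
  simp [T, X, U, mul_comm]

lemma dX_eq_deriv {F : J0 → ℝ} {b : ℝ → ℝ} {z : J0} (hF : ∀ᶠ y in 𝓝 z, F y = b y.2.1)
    (hb : DifferentiableAt ℝ b z.2.1) : ∂ₓ F z = deriv b z.2.1 := by
  have hF' : F =ᶠ[𝓝 z] fun y => 0 + b y.2.1 + 0 * y.2.2 := hF.mono fun y hy => by simp [hy]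
  rw [dirDeriv_congr hF', dirDeriv_separated (a := fun _ => 0) (by fun_prop) hb]
  simp

namespace EquivParams

variable (E : EquivParams) {x : ℝ} {z : J0} {j : J1}

/-- The transformation with parameters `E` of the space of `(t, x, u)`. -/
def map (z : J0) : J0 :=
  (E.c₁ * z.1 + E.c₀, E.X.toFun z.2.1, E.c₂ * z.2.2 + (E.c₄ * z.1 ^ 2 + E.c₃ * z.1 + E.ψ z.2.1))

/-- The parameters of the inverse of `E.map`. -/
noncomputable def inverse : EquivParams where
  c₀ := -E.c₀ / E.c₁
  c₁ := E.c₁⁻¹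
  c₂ := E.c₂⁻¹
  c₃ := (2 * E.c₄ * E.c₀ / E.c₁ - E.c₃) / (E.c₂ * E.c₁)
  c₄ := -E.c₄ / (E.c₂ * E.c₁ ^ 2)
  X := E.X.inverse
  ψ y := -(E.ψ (E.X.invFun y) + E.c₄ * (E.c₀ / E.c₁) ^ 2 - E.c₃ * (E.c₀ / E.c₁)) / E.c₂
  c₁_ne := inv_ne_zero E.c₁_ne
  c₂_ne := inv_ne_zero E.c₂_ne
  smooth_ψ := by
    have hψ : ContDiffOn ℝ ∞ (fun y => E.ψ (E.X.invFun y)) E.X.target :=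
      E.smooth_ψ.comp E.X.smooth_invFun E.X.map_target'
    exact ((hψ.add contDiffOn_const).sub contDiffOn_const).neg.div_const E.c₂

variable {E}

lemma inverse_map_map (hz : z.2.1 ∈ E.X.source) : E.inverse.map (E.map z) = z := by
  have hc₁ := E.c₁_ne
  have hc₂ := E.c₂_ne
  have hX : E.X.invFun (E.X.toFun z.2.1) = z.2.1 := E.X.left_inv' hz
  refine Prod.ext ?_ (Prod.ext hX ?_)
  · simp only [map, inverse]
    field_simp
    ring
  · simp only [map, inverse, hX]
    field_simp
    ring

lemma map_inverse_map (hz : z.2.1 ∈ E.X.target) : E.map (E.inverse.map z) = z := by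
  have hmem : (E.map (E.inverse.map z)).2.1 ∈ E.X.target :=
    E.X.map_source' (E.X.map_target' hz)
  have hinj := inverse_map_map (E := E.inverse) hmem
  rw [inverse_map_map (E := E) (z := E.inverse.map z) (E.X.map_target' hz)] at hinj
  rw [← hinj, inverse_map_map (E := E.inverse) hz]

section Derivatives

lemma contDiffAt_ψ (hx : x ∈ E.X.source) : ContDiffAt ℝ ∞ E.ψ x :=
  E.smooth_ψ.contDiffAt (E.X.open_source.mem_nhds hx)

lemma eventually_mem_source (hz : z.2.1 ∈ E.X.source) : ∀ᶠ y in 𝓝 z, y.2.1 ∈ E.X.source :=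
  (E.X.open_source.preimage (by fun_prop : Continuous fun y : J0 => y.2.1)).mem_nhds hz

lemma dirDeriv_compT (v : J0) : dirDeriv v (compT E.map) z = v.1 * E.c₁ := by
  have hT : compT E.map = fun y => (E.c₁ * y.1 + E.c₀) + 0 + 0 * y.2.2 := by
    ext y
    simp [compT, map]
  rw [hT, dirDeriv_separated (a := fun t => E.c₁ * t + E.c₀) (b := fun _ => 0) (by fun_prop)
    (by fun_prop)]
  simp

lemma dirDeriv_compX (hz : z.2.1 ∈ E.X.source) (v : J0) :
    dirDeriv v (compX E.map) z = v.2.1 * deriv E.X.toFun z.2.1 := by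
  have hX : compX E.map = fun y => 0 + E.X.toFun y.2.1 + 0 * y.2.2 := by
    ext y
    simp [compX, map]
  rw [hX, dirDeriv_separated (a := fun _ => 0) (by fun_prop)
    (differentiableAt_of_smooth (E.X.contDiffAt hz))]
  simp

lemma dirDeriv_compU (hz : z.2.1 ∈ E.X.source) (v : J0) : dirDeriv v (compU E.map) z =
    v.1 * (2 * E.c₄ * z.1 + E.c₃) + v.2.1 * deriv E.ψ z.2.1 + v.2.2 * E.c₂ := by
  have hU : compU E.map = fun y => (E.c₄ * y.1 ^ 2 + E.c₃ * y.1) + E.ψ y.2.1 + E.c₂ * y.2.2 := by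
    ext y
    simp only [compU, map]
    ring
  have hderiv : deriv (fun t => E.c₄ * t ^ 2 + E.c₃ * t) z.1 = 2 * E.c₄ * z.1 + E.c₃ := by
    refine (((hasDerivAt_pow 2 z.1).const_mul E.c₄).add
      ((hasDerivAt_id z.1).const_mul E.c₃)).deriv.trans ?_
    ring
  rw [hU, dirDeriv_separated (a := fun t => E.c₄ * t ^ 2 + E.c₃ * t) (by fun_prop)
    (differentiableAt_of_smooth (contDiffAt_ψ hz)), hderiv]

lemma dX_ne_zero (hz : z.2.1 ∈ E.X.source) : ∂ₓ (compX E.map) z ≠ 0 := by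
  simpa [dirDeriv_compX hz] using E.X.deriv_ne_zero hz

lemma contDiffAt_map (hz : z.2.1 ∈ E.X.source) : ContDiffAt ℝ ∞ E.map z := by
  have hX : ContDiffAt ℝ ∞ (fun y : J0 => E.X.toFun y.2.1) z :=
    (E.X.contDiffAt hz).comp z (by fun_prop)
  have hψ : ContDiffAt ℝ ∞ (fun y : J0 => E.ψ y.2.1) z := (contDiffAt_ψ hz).comp z (by fun_prop)
  unfold map
  fun_prop

lemma fibrePreserving_map (hz : z.2.1 ∈ E.X.source) : FibrePreserving E.map z :=
  (eventually_mem_source hz).mono fun _ hy => ⟨contDiffAt_map hy,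
    by simp [dirDeriv_compT], by simp [dirDeriv_compX hy]⟩

lemma totalJac_map_ne_zero (hj : j.1.2.1 ∈ E.X.source) : totalJac E.map j ≠ 0 := by
  rw [(fibrePreserving_map hj).totalJac_eq, dirDeriv_compT, one_mul]
  exact mul_ne_zero E.c₁_ne (dX_ne_zero hj)

lemma rateT_map : rateT E.map z = 0 := by
  rw [rateT, dirDeriv_eventually_const (.of_forall fun _ => dirDeriv_compT _), zero_div]

lemma dirDeriv_dU (hz : z.2.1 ∈ E.X.source) (v : J0) : dirDeriv v (∂ᵤ (compU E.map)) z = 0 :=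
  dirDeriv_eventually_const (c := E.c₂)
    ((eventually_mem_source hz).mono fun _ hy => by simp [dirDeriv_compU hy]) v

lemma accelU_map (hz : z.2.1 ∈ E.X.source) : accelU E.map z = 2 * E.c₄ := by
  have hU : ∂ₜ (compU E.map) =ᶠ[𝓝 z] fun y => (2 * E.c₄ * y.1 + E.c₃) + 0 + 0 * y.2.2 :=
    (eventually_mem_source hz).mono fun _ hy => by simp [dirDeriv_compU hy]
  rw [accelU, rateT_map, dirDeriv_congr hU, dirDeriv_separated
    (a := fun t => 2 * E.c₄ * t + E.c₃) (b := fun _ => 0) (by fun_prop) (by fun_prop)]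
  simp

lemma dX_dX (hz : z.2.1 ∈ E.X.source) :
    ∂ₓ (∂ₓ (compX E.map)) z = deriv (deriv E.X.toFun) z.2.1 :=
  dX_eq_deriv ((eventually_mem_source hz).mono fun _ hy => by simp [dirDeriv_compX hy])
    (differentiableAt_of_smooth ((E.X.contDiffAt hz).derivWithin (by norm_cast)))

lemma dX_dX_compU (hz : z.2.1 ∈ E.X.source) :
    ∂ₓ (∂ₓ (compU E.map)) z = deriv (deriv E.ψ) z.2.1 :=
  dX_eq_deriv ((eventually_mem_source hz).mono fun _ hy => by simp [dirDeriv_compU hy])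
    (differentiableAt_of_smooth ((contDiffAt_ψ hz).derivWithin (by norm_cast)))

end Derivatives

end EquivParams

namespace EquivParams

variable {E : EquivParams} {z : J0} {j : J1} {k : J2} {w : J2 × (ℝ × ℝ)} {b : ℝ × ℝ}

section Action

variable (E)

/-- The action of `E` on the arguments `(x, u_x)` of the arbitrary elements. -/
noncomputable def argMap (b : ℝ × ℝ) : ℝ × ℝ :=
  (E.X.toFun b.1, (deriv E.ψ b.1 + b.2 * E.c₂) / deriv E.X.toFun b.1)

/-- The action of `E` on the values `(f, g)` of the arbitrary elements with argument `b`. -/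
noncomputable def valMap (b y : ℝ × ℝ) : ℝ × ℝ :=
  (deriv E.X.toFun b.1 ^ 2 * y.1 / E.c₁ ^ 2,
    (E.c₂ * y.2 + 2 * E.c₄ - y.1 * (deriv (deriv E.ψ) b.1
      - deriv (deriv E.X.toFun) b.1 / deriv E.X.toFun b.1 * (deriv E.ψ b.1 + b.2 * E.c₂)))
      / E.c₁ ^ 2)

/-- The transformation with parameters `E` of the space of `(t, x, u₍₂₎, f, g)`. -/
noncomputable def bigMap (w : J2 × (ℝ × ℝ)) : J2 × (ℝ × ℝ) :=
  (prolong2 E.map w.1, E.valMap (jetArg w.1.1) w.2)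

end Action

lemma compX_fibreSlope_map (hj : j.1.2.1 ∈ E.X.source) :
    (compX E.map j.1, fibreSlope E.map j) = E.argMap (jetArg j) := by
  simp [fibreSlope, dirDeriv_compX hj, dirDeriv_compU hj, argMap, jetArg, compX, map]

lemma jetArg_prolong1_map (hj : j.1.2.1 ∈ E.X.source) :
    jetArg (prolong1 E.map j) = E.argMap (jetArg j) := by
  rw [(fibrePreserving_map hj).jetArg_prolong1 (by simpa [dirDeriv_compT] using E.c₁_ne),
    compX_fibreSlope_map hj]

lemma fibreVal_map (hj : j.1.2.1 ∈ E.X.source) (y : ℝ × ℝ) :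
    fibreVal E.map j y = E.valMap (jetArg j) y := by
  have hfib := fibrePreserving_map hj
  have hT : ∂ₜ (compT E.map) j.1 = E.c₁ := by simp [dirDeriv_compT]
  have hX : ∂ₓ (compX E.map) j.1 = deriv E.X.toFun j.1.2.1 := by simp [dirDeriv_compX hj]
  have hU : ∂ᵤ (compU E.map) j.1 = E.c₂ := by simp [dirDeriv_compU hj]
  have hUx : ∂ₓ (compU E.map) j.1 = deriv E.ψ j.1.2.1 := by simp [dirDeriv_compU hj]
  rw [fibreVal, hfib.contactHess_horT_eq (dX_ne_zero hj),
    hfib.contactHess_horX_eq (hT ▸ E.c₁_ne), rateX, dX_dX hj, dX_dX_compU hj, accelU_map hj,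
    rateT_map, dirDeriv_dU hj, dirDeriv_dU hj, dirDeriv_dU hj, hT, hX, hU, hUx]
  simp [valMap, jetArg]

lemma prolong2_mem_line_iff (hk : k.1.1.2.1 ∈ E.X.source) (y : ℝ × ℝ) :
    (prolong2 E.map k).2.1 = (E.valMap (jetArg k.1) y).1 * (prolong2 E.map k).2.2.2
        + (E.valMap (jetArg k.1) y).2 ↔
      k.2.1 = y.1 * k.2.2.2 + y.2 := by
  rw [← fibreVal_map hk]
  exact (fibrePreserving_map hk).prolong2_mem_line_iff (by simpa [dirDeriv_compT] using E.c₁_ne)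
    (dX_ne_zero hk) (by simpa [dirDeriv_compU hk] using E.c₂_ne) y

section Inverse

lemma map_mem_inverse_source (hz : z.2.1 ∈ E.X.source) : (E.map z).2.1 ∈ E.inverse.X.source :=
  E.X.map_source' hz

lemma inverse_comp_map (hz : z.2.1 ∈ E.X.source) : E.inverse.map ∘ E.map =ᶠ[𝓝 z] id :=
  (eventually_mem_source hz).mono fun _ hy => inverse_map_map hy

lemma prolong1_inverse_prolong1 (hj : j.1.2.1 ∈ E.X.source) :
    prolong1 E.inverse.map (prolong1 E.map j) = j := by
  rw [← prolong1_comp (contDiffAt_map hj) (contDiffAt_map (map_mem_inverse_source hj))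
    (totalJac_map_ne_zero hj), prolong1_congr (inverse_comp_map hj)]
  exact Prod.ext rfl (Prod.ext_iff.2 (newUt_newUx_id j))

lemma prolong2_inverse_prolong2 (hk : k.1.1.2.1 ∈ E.X.source) :
    prolong2 E.inverse.map (prolong2 E.map k) = k := by
  rw [← prolong2_comp ((eventually_mem_source hk).mono fun _ hy => contDiffAt_map hy)
    ((eventually_mem_source (map_mem_inverse_source hk)).mono fun _ hy => contDiffAt_map hy)
    (totalJac_map_ne_zero hk) (totalJac_map_ne_zero (map_mem_inverse_source hk)),
    prolong2_congr (inverse_comp_map hk), prolong2_id]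

lemma inverse_argMap_argMap (hb : b.1 ∈ E.X.source) : E.inverse.argMap (E.argMap b) = b := by
  have hinv := prolong1_inverse_prolong1 (j := ((0, b.1, 0), (0, b.2))) hb
  replace hinv := congrArg jetArg hinv
  rw [jetArg_prolong1_map (j := prolong1 E.map _) (map_mem_inverse_source hb),
    jetArg_prolong1_map hb] at hinv
  exact hinv

lemma argMap_inverse_argMap (hb : b.1 ∈ E.X.target) : E.argMap (E.inverse.argMap b) = b := by
  have hmem : (E.argMap (E.inverse.argMap b)).1 ∈ E.X.target :=
    E.X.map_source' (E.X.map_target' hb)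
  have hinj := inverse_argMap_argMap (E := E.inverse) hmem
  rw [inverse_argMap_argMap (E := E) (b := E.inverse.argMap b) (E.X.map_target' hb)] at hinj
  rw [← hinj, inverse_argMap_argMap (E := E.inverse) hb]

/-- A value `(f, g)` is determined by the line `u_tt = f u_xx + g` of second-order jets, and the
prolongations of `E.map` and `E.inverse.map` are inverse to each other on these lines. -/
lemma inverse_valMap_valMap (hb : b.1 ∈ E.X.source) (y : ℝ × ℝ) :
    E.inverse.valMap (E.argMap b) (E.valMap b y) = y := by
  have hline : ∀ s, y.1 * s + y.2 = (E.inverse.valMap (E.argMap b) (E.valMap b y)).1 * s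
      + (E.inverse.valMap (E.argMap b) (E.valMap b y)).2 := fun s => by
    let k : J2 := (((0, b.1, 0), (0, b.2)), (y.1 * s + y.2, 0, s))
    have hk : k.1.1.2.1 ∈ E.X.source := hb
    have hinv := (prolong2_mem_line_iff (E := E.inverse) (k := prolong2 E.map k)
      (map_mem_inverse_source hk) _).2 ((prolong2_mem_line_iff hk y).2 rfl)
    rw [prolong2_inverse_prolong2 hk,
      show jetArg (prolong2 E.map k).1 = E.argMap b from jetArg_prolong1_map hk] at hinv
    exact hinv
  have hzero := hline 0
  have hone := hline 1
  exact Prod.ext (by linarith) (by linarith)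

lemma inverse_bigMap_bigMap (hw : w.1.1.1.2.1 ∈ E.X.source) :
    E.inverse.bigMap (E.bigMap w) = w := by
  refine Prod.ext (prolong2_inverse_prolong2 hw) ?_
  change E.inverse.valMap (jetArg (prolong1 E.map w.1.1)) _ = _
  rw [jetArg_prolong1_map hw]
  exact inverse_valMap_valMap (b := jetArg w.1.1) hw w.2

lemma bigMap_inverse_bigMap (hw : w.1.1.1.2.1 ∈ E.X.target) :
    E.bigMap (E.inverse.bigMap w) = w := by
  have hsource : (E.inverse.bigMap w).1.1.1.2.1 ∈ E.X.source := E.X.map_target' hw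
  have hmem : (E.bigMap (E.inverse.bigMap w)).1.1.1.2.1 ∈ E.inverse.X.source :=
    map_mem_inverse_source hsource
  have hinj := inverse_bigMap_bigMap (E := E.inverse) hmem
  rw [inverse_bigMap_bigMap hsource] at hinj
  rw [← hinj, inverse_bigMap_bigMap (E := E.inverse) hw]

end Inverse

lemma contDiffAt_argMap (hb : b.1 ∈ E.X.source) : ContDiffAt ℝ ∞ E.argMap b := by
  have hX : ContDiffAt ℝ ∞ (fun b : ℝ × ℝ => E.X.toFun b.1) b :=
    ContDiffAt.comp b (E.X.contDiffAt hb) contDiffAt_fst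
  have hdX : ContDiffAt ℝ ∞ (fun b : ℝ × ℝ => deriv E.X.toFun b.1) b :=
    ContDiffAt.comp b ((E.X.contDiffAt hb).derivWithin (by norm_cast)) contDiffAt_fst
  have hdψ : ContDiffAt ℝ ∞ (fun b : ℝ × ℝ => deriv E.ψ b.1) b :=
    ContDiffAt.comp b ((contDiffAt_ψ hb).derivWithin (by norm_cast)) contDiffAt_fst
  exact hX.prodMk ((hdψ.add (contDiffAt_snd.mul contDiffAt_const)).div hdX (E.X.deriv_ne_zero hb))

lemma contDiffAt_valMap {p : (ℝ × ℝ) × (ℝ × ℝ)} (hp : p.1.1 ∈ E.X.source) :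
    ContDiffAt ℝ ∞ (fun q : (ℝ × ℝ) × (ℝ × ℝ) => E.valMap q.1 q.2) p := by
  have hX : ContDiffAt ℝ ∞ (deriv E.X.toFun) p.1.1 :=
    (E.X.contDiffAt hp).derivWithin (by norm_cast)
  have hψ : ContDiffAt ℝ ∞ (deriv E.ψ) p.1.1 := (contDiffAt_ψ hp).derivWithin (by norm_cast)
  have comp_x {F : ℝ → ℝ} (hF : ContDiffAt ℝ ∞ F p.1.1) :
      ContDiffAt ℝ ∞ (fun q : (ℝ × ℝ) × (ℝ × ℝ) => F q.1.1) p :=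
    ContDiffAt.comp (g := F) p hF (by fun_prop)
  have hc₁ := pow_ne_zero 2 E.c₁_ne
  have hslope := (comp_x hψ).add
    ((by fun_prop : ContDiffAt ℝ ∞ (fun q : (ℝ × ℝ) × (ℝ × ℝ) => q.1.2 * E.c₂) p))
  have hcurv := (comp_x (hψ.derivWithin (by norm_cast))).sub
    (((comp_x (hX.derivWithin (by norm_cast))).div (comp_x hX) (E.X.deriv_ne_zero hp)).mul hslope)
  exact ((((comp_x hX).pow 2).mul (by fun_prop)).div contDiffAt_const hc₁).prodMk
    (((by fun_prop : ContDiffAt ℝ ∞ (fun q : (ℝ × ℝ) × (ℝ × ℝ) => E.c₂ * q.2.2 + 2 * E.c₄) p).sub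
      (ContDiffAt.mul (by fun_prop) hcurv)).div contDiffAt_const hc₁)

lemma contDiffAt_bigMap (hw : w.1.1.1.2.1 ∈ E.X.source) : ContDiffAt ℝ ∞ E.bigMap w :=
  ((contDiffAt_prolong2 (contDiffAt_map hw) (totalJac_map_ne_zero hw)).comp w
      contDiffAt_fst).prodMk
    (ContDiffAt.comp (g := fun q : (ℝ × ℝ) × (ℝ × ℝ) => E.valMap q.1 q.2)
      (f := fun w : J2 × (ℝ × ℝ) => (jetArg w.1.1, w.2)) w (contDiffAt_valMap hw)
      (by unfold jetArg; fun_prop))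

variable (E)

/-- The transformation with parameters `E` as a point transformation of the space of
`(t, x, u)`. -/
noncomputable def toPoint : PointTransformation J0 where
  toFun := E.map
  invFun := E.inverse.map
  source := {z | z.2.1 ∈ E.X.source}
  target := {z | z.2.1 ∈ E.X.target}
  map_source' _ hz := E.X.map_source' hz
  map_target' _ hz := E.X.map_target' hz
  left_inv' _ hz := inverse_map_map hz
  right_inv' _ hz := map_inverse_map hz
  open_source := E.X.open_source.preimage (by fun_prop)
  open_target := E.X.open_target.preimage (by fun_prop)
  continuousOn_toFun _ hz := (contDiffAt_map hz).continuousAt.continuousWithinAt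
  continuousOn_invFun _ hz := (contDiffAt_map (E := E.inverse) hz).continuousAt.continuousWithinAt
  smooth_toFun _ hz := (contDiffAt_map hz).contDiffWithinAt
  smooth_invFun _ hz := (contDiffAt_map (E := E.inverse) hz).contDiffWithinAt

/-- The transformation with parameters `E` as a point transformation of the space of
`(t, x, u₍₂₎, f, g)`. -/
noncomputable def toBig : PointTransformation (J2 × (ℝ × ℝ)) where
  toFun := E.bigMap
  invFun := E.inverse.bigMap
  source := {w | w.1.1.1.2.1 ∈ E.X.source}
  target := {w | w.1.1.1.2.1 ∈ E.X.target}
  map_source' _ hw := E.X.map_source' hw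
  map_target' _ hw := E.X.map_target' hw
  left_inv' _ hw := inverse_bigMap_bigMap hw
  right_inv' _ hw := bigMap_inverse_bigMap hw
  open_source := E.X.open_source.preimage (by fun_prop)
  open_target := E.X.open_target.preimage (by fun_prop)
  continuousOn_toFun _ hw := (contDiffAt_bigMap hw).continuousAt.continuousWithinAt
  continuousOn_invFun _ hw :=
    (contDiffAt_bigMap (E := E.inverse) hw).continuousAt.continuousWithinAt
  smooth_toFun _ hw := (contDiffAt_bigMap hw).contDiffWithinAt
  smooth_invFun _ hw := (contDiffAt_bigMap (E := E.inverse) hw).contDiffWithinAt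

end EquivParams

namespace EquivParams

variable {E : EquivParams} {θ θ' : ArbElem} {j : J1} {b : ℝ × ℝ}

lemma fibreEqs_map (hj : j.1.2.1 ∈ E.X.source) (hdom : jetArg j ∈ θ.dom)
    (hdom' : E.argMap (jetArg j) ∈ θ'.dom)
    (hval : (θ'.f (E.argMap (jetArg j)), θ'.g (E.argMap (jetArg j)))
      = E.valMap (jetArg j) (θ.val j)) : FibreEqs θ θ' E.map j := by
  have hT : ∂ₜ (compT E.map) j.1 ≠ 0 := by simpa [dirDeriv_compT] using E.c₁_ne
  rw [← fibreVal_map hj, fibreVal, Prod.ext_iff] at hval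
  obtain ⟨hf, hg⟩ := hval
  rw [eq_div_iff (pow_ne_zero 2 hT), ← compX_fibreSlope_map hj] at hf hg
  exact ⟨fibrePreserving_map hj, hdom, compX_fibreSlope_map hj ▸ hdom', hT, dX_ne_zero hj,
    by simpa [dirDeriv_compU hj] using E.c₂_ne, by rw [hf, mul_comm]; rfl,
    by rw [mul_comm _ (θ'.g _), hg]; rfl⟩

lemma contDiffAt_pushforward (hb : b.1 ∈ E.X.target) (hdom : E.inverse.argMap b ∈ θ.dom) :
    ContDiffAt ℝ ∞ (fun b => E.valMap (E.inverse.argMap b)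
      (θ.f (E.inverse.argMap b), θ.g (E.inverse.argMap b))) b := by
  have harg := contDiffAt_argMap (E := E.inverse) hb
  exact (contDiffAt_valMap (E.X.map_target' hb)).comp b
    (harg.prodMk (((θ.contDiffAt_f hdom).comp b harg).prodMk ((θ.contDiffAt_g hdom).comp b harg)))

/-- The image of the arbitrary elements `θ` under the transformation with parameters `E`. -/
noncomputable def pushforward (E : EquivParams) (θ : ArbElem) : ArbElem where
  dom := {b | b.1 ∈ E.X.target ∧ E.inverse.argMap b ∈ θ.dom}
  isOpen_dom := by
    have hcont : ContinuousOn E.inverse.argMap {b | b.1 ∈ E.X.target} := fun b hb =>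
      (contDiffAt_argMap (E := E.inverse) hb).continuousAt.continuousWithinAt
    exact hcont.isOpen_inter_preimage (E.X.open_target.preimage continuous_fst) θ.isOpen_dom
  f b := (E.valMap (E.inverse.argMap b) (θ.f (E.inverse.argMap b), θ.g (E.inverse.argMap b))).1
  g b := (E.valMap (E.inverse.argMap b) (θ.f (E.inverse.argMap b), θ.g (E.inverse.argMap b))).2
  smooth_f b hb := (contDiffAt_pushforward hb.1 hb.2).fst.contDiffWithinAt
  smooth_g b hb := (contDiffAt_pushforward hb.1 hb.2).snd.contDiffWithinAt

lemma fibreEqs_pushforward (hj : j.1.2.1 ∈ E.X.source) (hdom : jetArg j ∈ θ.dom) :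
    FibreEqs θ (E.pushforward θ) E.map j := by
  have hinv := inverse_argMap_argMap (b := jetArg j) hj
  refine fibreEqs_map hj hdom ⟨E.X.map_source' hj, hinv.symm ▸ hdom⟩ ?_
  simp only [pushforward, hinv, ArbElem.val]

lemma eventually_fibreEqs_pushforward (hj : j.1.2.1 ∈ E.X.source) (hdom : jetArg j ∈ θ.dom) :
    ∀ᶠ i in 𝓝 j, FibreEqs θ (E.pushforward θ) E.map i := by
  filter_upwards [continuousAt_fst.eventually (eventually_mem_source hj),
    continuous_jetArg.continuousAt.eventually (θ.isOpen_dom.mem_nhds hdom)] with i hi hdom_i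
  exact fibreEqs_pushforward hi hdom_i

lemma linear_of_pushforward (hj : j.1.2.1 ∈ E.X.source) (hdom : jetArg j ∈ θ.dom)
    (h : ∀ᶠ b in 𝓝 (E.argMap (jetArg j)), partialUx (E.pushforward θ).f b = 0 ∧
      partialUx (partialUx (E.pushforward θ).g) b = 0) :
    ∀ᶠ i in 𝓝 j, jetArg i ∈ θ.dom ∧ partialUx θ.f (jetArg i) = 0 ∧
      partialUx (partialUx θ.g) (jetArg i) = 0 := by
  have harg : ContinuousAt (fun i => E.argMap (jetArg i)) j :=
    (contDiffAt_argMap (E := E) (b := jetArg j) hj).continuousAt.comp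
      continuous_jetArg.continuousAt
  have hlin : ∀ᶠ i in 𝓝 j, FibreEqs θ (E.pushforward θ) E.map i ∧
      partialUx (E.pushforward θ).f (compX E.map i.1, fibreSlope E.map i) = 0 ∧
      partialUx (partialUx (E.pushforward θ).g) (compX E.map i.1, fibreSlope E.map i) = 0 := by
    filter_upwards [eventually_fibreEqs_pushforward hj hdom, harg.eventually h,
      continuousAt_fst.eventually (eventually_mem_source hj)] with i hi hi' hmem
    exact ⟨hi, compX_fibreSlope_map hmem ▸ hi'⟩
  have hf : ∀ᶠ i in 𝓝 j, partialUx θ.f (jetArg i) = 0 := by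
    filter_upwards [hlin.eventually_nhds] with i hi
    have hsymbol := partialUx_symbol (hi.mono fun _ => And.left)
    rw [hi.self_of_nhds.2.1, zero_mul, zero_mul, eq_comm] at hsymbol
    exact (mul_eq_zero.1 hsymbol).resolve_right (pow_ne_zero 3 hi.self_of_nhds.1.dX_ne)
  filter_upwards [hlin.eventually_nhds, hf.eventually_nhds] with i hi hfi
  have hsource := partialUx_partialUx_source (hi.mono fun _ => And.left) hfi
  rw [hi.self_of_nhds.2.2, mul_zero] at hsource
  exact ⟨hi.self_of_nhds.1.mem_dom, hfi.self_of_nhds,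
    (mul_eq_zero.1 hsource).resolve_left (pow_ne_zero 2 hi.self_of_nhds.1.dX_ne)⟩

lemma pushforward_mem_waveClass (hθ : θ ∈ waveClass) : E.pushforward θ ∈ waveClass := by
  refine ⟨fun b hb => ?_, fun V hV ⟨b, hb⟩ hsub => ?_⟩
  · exact div_ne_zero (mul_ne_zero (pow_ne_zero 2 (E.X.deriv_ne_zero (E.X.map_target' hb.1)))
      (hθ.1 _ hb.2)) (pow_ne_zero 2 E.c₁_ne)
  · by_contra! hlin
    have hmem := hsub hb
    let j : J1 := ((0, (E.inverse.argMap b).1, 0), (0, (E.inverse.argMap b).2))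
    refine not_linear_of_mem_waveClass hθ (linear_of_pushforward (j := j)
      (E.X.map_target' hmem.1) hmem.2 ?_)
    change ∀ᶠ c in 𝓝 (E.argMap (E.inverse.argMap b)), _
    rw [argMap_inverse_argMap hmem.1]
    filter_upwards [hV.mem_nhds hb] with c hc
    exact Prod.ext_iff.1 (hlin c hc)

section Equivalence

variable {Φ : PointTransformation (J2 × (ℝ × ℝ))} {φ : PointTransformation J0}

lemma transforms_of_fibreEqs (hΦ : Φ.toFun = E.bigMap) (hφ : φ.toFun = E.map)
    (hsource : Φ.source = {w | w.1.1.1.2.1 ∈ E.X.source}) (hj : j.1.2.1 ∈ E.X.source)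
    (h : ∀ᶠ i in 𝓝 j, FibreEqs θ θ' E.map i) {l : Filter J2}
    (hl : Filter.Tendsto Prod.fst l (𝓝 j)) : Transforms Φ φ θ θ' l := by
  filter_upwards [hl.eventually h, hl.eventually
    (continuousAt_fst.eventually (eventually_mem_source hj))] with k hk hmem
  rw [hΦ, hφ, hsource]
  exact ⟨hmem, hk.jetArg_prolong1 ▸ hk.mem_dom',
    Prod.ext rfl (by rw [hk.val_prolong1, fibreVal_map hmem]; rfl)⟩

lemma preservesClass (hΦ : Φ.toFun = E.bigMap) (hφ : φ.toFun = E.map)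
    (hΦsource : Φ.source = {w | w.1.1.1.2.1 ∈ E.X.source})
    (hφsource : φ.source = {z | z.2.1 ∈ E.X.source}) : PreservesClass waveClass Φ φ := by
  intro θ hθ k hdom hk
  rw [hΦsource] at hk
  have h := eventually_fibreEqs_pushforward (j := k.1) hk hdom
  refine ⟨E.pushforward θ, pushforward_mem_waveClass hθ,
    transforms_of_fibreEqs hΦ hφ hΦsource hk h continuousAt_fst,
    admissibleAt_of_fibreEqs (hφsource ▸ hk) (hφ ▸ h)⟩

lemma isEquivTransformation (E : EquivParams) :
    IsEquivTransformation waveClass E.toBig E.toPoint where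
  prolongs _ hw := ⟨hw, totalJac_map_ne_zero hw, rfl⟩
  preserves := preservesClass rfl rfl rfl rfl
  preserves_inverse := preservesClass (E := E.inverse) rfl rfl rfl rfl

end Equivalence

end EquivParams

/-! ## Semi-normalization -/

section Slice

variable {F : J0 → ℝ} {z : J0} {x : ℝ}

/-- The restriction of `F` to the line through `z` in the direction of the `x`-axis. -/
def xSlice (F : J0 → ℝ) (z : J0) (x : ℝ) : ℝ := F (z.1, x, z.2.2)

lemma tendsto_xLine (z : J0) :
    Filter.Tendsto (fun x => ((z.1, x, z.2.2) : J0)) (𝓝 z.2.1) (𝓝 z) :=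
  (by fun_prop : Continuous fun x => ((z.1, x, z.2.2) : J0)).tendsto z.2.1

lemma contDiffAt_xSlice (hF : ContDiffAt ℝ ∞ F (z.1, x, z.2.2)) : ContDiffAt ℝ ∞ (xSlice F z) x :=
  ContDiffAt.comp (g := F) x hF (by fun_prop)

lemma deriv_xSlice (hF : DifferentiableAt ℝ F (z.1, x, z.2.2)) :
    deriv (xSlice F z) x = xSlice (∂ₓ F) z x :=
  (hF.hasFDerivAt.comp_hasDerivAt x ((hasDerivAt_const x z.1).prodMk
    ((hasDerivAt_id x).prodMk (hasDerivAt_const x z.2.2)))).deriv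

lemma deriv_deriv_xSlice (hF : ContDiffAt ℝ ∞ F (z.1, x, z.2.2))
    (hF' : ∀ᶠ y in 𝓝 x, deriv (xSlice F z) y = xSlice (∂ₓ F) z y) :
    deriv (deriv (xSlice F z)) x = xSlice (∂ₓ (∂ₓ F)) z x := by
  rw [Filter.EventuallyEq.deriv_eq hF',
    deriv_xSlice (differentiableAt_of_smooth (contDiffAt_dirDeriv hF _))]

lemma ConstAlong.eventually_xSlice_eq (h : ConstAlong (0, 1, 0) F z) :
    ∀ᶠ x in 𝓝 z.2.1, xSlice F z x = F z := by
  have hsub : Filter.Tendsto (fun x => x - z.2.1) (𝓝 z.2.1) (𝓝 0) :=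
    (by fun_prop : Continuous fun x => x - z.2.1).tendsto' _ _ (sub_self _)
  filter_upwards [hsub.eventually h.eventually_eq_on_line] with x hx
  rw [← hx, xSlice]
  congr 1
  simp [Prod.ext_iff]

end Slice

lemma exists_pointTransformation {a : ℝ → ℝ} {x₀ : ℝ} {p : ℝ → Prop}
    (ha : ∀ᶠ x in 𝓝 x₀, ContDiffAt ℝ ∞ a x) (hderiv : deriv a x₀ ≠ 0) (hp : ∀ᶠ x in 𝓝 x₀, p x) :
    ∃ X : PointTransformation ℝ, x₀ ∈ X.source ∧ X.toFun = a ∧ ∀ x ∈ X.source, p x := by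
  have ha₀ := ha.self_of_nhds
  have hderiv' : ContDiffAt ℝ ∞ (deriv a) x₀ := ha₀.derivWithin (by norm_cast)
  obtain ⟨W, hW, hWopen, hxW⟩ := eventually_nhds_iff.mp
    ((ha.and (hderiv'.continuousAt.eventually_ne hderiv)).and hp)
  have hstrict := (ha₀.hasStrictDerivAt (by norm_num)).hasStrictFDerivAt_equiv hderiv
  let Y := (hstrict.toOpenPartialHomeomorph a).restrOpen W hWopen
  refine ⟨⟨Y, fun x hx => (hW x hx.2).1.1.contDiffWithinAt, fun y hy => ?_⟩,
    ⟨hstrict.mem_toOpenPartialHomeomorph_source, hxW⟩, rfl, fun x hx => (hW x hx.2).2⟩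
  obtain ⟨⟨hsmooth, hne⟩, -⟩ := hW (Y.symm y) (Y.map_target hy).2
  exact (Y.contDiffAt_symm_deriv hne hy (differentiableAt_of_smooth hsmooth).hasDerivAt
    hsmooth).contDiffWithinAt

section Osculating

variable {θ θ' : ArbElem} {φ : J0 → J0} {z : J0} {i j : J1} {E : EquivParams}

/-- At `z`, the transformation with parameters `E` agrees with the fibre-preserving transformation
`φ` in all the quantities on which the action of `φ` on the arbitrary elements depends. -/
structure Osculates (E : EquivParams) (φ : J0 → J0) (z : J0) : Prop where
  dT : E.c₁ = ∂ₜ (compT φ) z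
  dU : E.c₂ = ∂ᵤ (compU φ) z
  accel : 2 * E.c₄ = accelU φ z
  val : E.X.toFun z.2.1 = compX φ z
  dX : deriv E.X.toFun z.2.1 = ∂ₓ (compX φ) z
  dX_dX : deriv (deriv E.X.toFun) z.2.1 = ∂ₓ (∂ₓ (compX φ)) z
  dψ : deriv E.ψ z.2.1 = ∂ₓ (compU φ) z
  dψ_dψ : deriv (deriv E.ψ) z.2.1 = ∂ₓ (∂ₓ (compU φ)) z

lemma Osculates.argMap_eq (h : Osculates E φ j.1) :
    E.argMap (jetArg j) = (compX φ j.1, fibreSlope φ j) := by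
  simp only [EquivParams.argMap, jetArg, fibreSlope, h.val, h.dX, h.dψ, h.dU]

/-- The action on the arbitrary elements only depends on `(x, u_x)`, whence the two jets. -/
lemma Osculates.fibreEqs_map (hosc : Osculates E φ i.1) (hθ : θ ∈ waveClass)
    (h : ∀ᶠ k in 𝓝 i, FibreEqs θ θ' φ k) (hj : j.1.2.1 ∈ E.X.source) (hij : jetArg i = jetArg j) :
    FibreEqs θ θ' E.map j := by
  have hi := h.self_of_nhds
  have hsymbol := hi.symbol
  have hsource := source_eq h
  have harg := hij ▸ hosc.argMap_eq
  have hT : ∂ₜ (compT φ) i.1 ^ 2 ≠ 0 := pow_ne_zero 2 hi.dT_ne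
  refine EquivParams.fibreEqs_map hj (hij ▸ hi.mem_dom) (harg ▸ hi.mem_dom') ?_
  simp only [EquivParams.valMap, ArbElem.val]
  rw [harg, ← hij]
  change _ = (deriv E.X.toFun i.1.2.1 ^ 2 * θ.f (jetArg i) / E.c₁ ^ 2, (E.c₂ * θ.g (jetArg i)
    + 2 * E.c₄ - θ.f (jetArg i) * (deriv (deriv E.ψ) i.1.2.1 - deriv (deriv E.X.toFun) i.1.2.1
      / deriv E.X.toFun i.1.2.1 * (deriv E.ψ i.1.2.1 + i.2.2 * E.c₂))) / E.c₁ ^ 2)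
  rw [hosc.dT, hosc.dU, hosc.accel, hosc.dX, hosc.dX_dX, hosc.dψ, hosc.dψ_dψ, Prod.ext_iff,
    eq_div_iff hT, eq_div_iff hT]
  rw [rateX, dX_dU_eq_zero hθ h] at hsource
  exact ⟨by linear_combination hsymbol, by linear_combination -hsource⟩

/-- Freezing `t` and `u` at `z` in a fibre-preserving transformation `φ`, to second order in `t`
and to first order in `u`. -/
noncomputable def osculating (φ : J0 → J0) (z : J0) (X : PointTransformation ℝ)
    (hT : ∂ₜ (compT φ) z ≠ 0) (hU : ∂ᵤ (compU φ) z ≠ 0)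
    (hsmooth : ∀ x ∈ X.source, ContDiffAt ℝ ∞ (xSlice (compU φ) z) x) : EquivParams where
  c₀ := compT φ z - ∂ₜ (compT φ) z * z.1
  c₁ := ∂ₜ (compT φ) z
  c₂ := ∂ᵤ (compU φ) z
  c₃ := ∂ₜ (compU φ) z - accelU φ z * z.1
  c₄ := accelU φ z / 2
  X := X
  ψ x := xSlice (compU φ) z x - (∂ᵤ (compU φ) z * z.2.2 + accelU φ z / 2 * z.1 ^ 2
    + (∂ₜ (compU φ) z - accelU φ z * z.1) * z.1)
  c₁_ne := hT
  c₂_ne := hU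
  smooth_ψ x hx := ((hsmooth x hx).sub contDiffAt_const).contDiffWithinAt

lemma exists_osculates (hθ : θ ∈ waveClass) (h : ∀ᶠ i in 𝓝 j, FibreEqs θ θ' φ i) :
    ∃ E : EquivParams, j.1.2.1 ∈ E.X.source ∧ E.map j.1 = φ j.1 ∧
      2 * E.c₄ * j.1.1 + E.c₃ = ∂ₜ (compU φ) j.1 ∧
      ∀ᶠ x in 𝓝 j.1.2.1, Osculates E φ (j.1.1, x, j.1.2.2) := by
  have hj := h.self_of_nhds
  have hsmooth : ∀ᶠ x in 𝓝 j.1.2.1, ContDiffAt ℝ ∞ φ (j.1.1, x, j.1.2.2) :=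
    (tendsto_xLine j.1).eventually (hj.fibre.mono fun _ => And.left)
  have hX : ∀ᶠ x in 𝓝 j.1.2.1, deriv (xSlice (compX φ) j.1) x = xSlice (∂ₓ (compX φ)) j.1 x :=
    hsmooth.mono fun _ hx => deriv_xSlice (differentiableAt_of_smooth (smooth_comps hx).2.1)
  have hU : ∀ᶠ x in 𝓝 j.1.2.1, deriv (xSlice (compU φ) j.1) x = xSlice (∂ₓ (compU φ)) j.1 x :=
    hsmooth.mono fun _ hx => deriv_xSlice (differentiableAt_of_smooth (smooth_comps hx).2.2)
  obtain ⟨X, hmem, hXfun, hXsmooth⟩ := exists_pointTransformation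
    (hsmooth.mono fun _ hx => contDiffAt_xSlice (smooth_comps hx).2.1)
    (hX.self_of_nhds ▸ hj.dX_ne)
    (hsmooth.mono fun _ hx => contDiffAt_xSlice (smooth_comps hx).2.2)
  let E := osculating φ j.1 X hj.dT_ne hj.dU_ne hXsmooth
  have hEX : E.X.toFun = xSlice (compX φ) j.1 := hXfun
  have hEψ : deriv E.ψ = deriv (xSlice (compU φ) j.1) := funext fun _ => deriv_sub_const _
  have haccel : ConstAlong (0, 1, 0) (accelU φ) j.1 :=
    eventually_base (h.eventually_nhds.mono fun _ hi =>
      ⟨hi.self_of_nhds.fibre.contDiffAt_accelU hi.self_of_nhds.dT_ne, dX_accelU hθ hi⟩)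
  refine ⟨E, hmem, ?_, ?_, ?_⟩
  · refine Prod.ext ?_ (Prod.ext (congrFun hEX _) ?_) <;>
      simp only [EquivParams.map, E, osculating, compT, compU, xSlice] <;> ring
  · simp only [E, osculating]
    ring
  filter_upwards [hsmooth, hX.eventually_nhds, hU.eventually_nhds,
    (hj.fibre.constAlong_dT rfl).eventually_xSlice_eq, (constAlong_x_dU hθ h).eventually_xSlice_eq,
    haccel.eventually_xSlice_eq] with x hx hXx hUx hTx hUux hAx
  exact ⟨hTx.symm, hUux.symm, (mul_div_cancel₀ _ two_ne_zero).trans hAx.symm, congrFun hEX x,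
    hEX ▸ hXx.self_of_nhds, hEX ▸ deriv_deriv_xSlice (smooth_comps hx).2.1 hXx,
    hEψ ▸ hUx.self_of_nhds, hEψ ▸ deriv_deriv_xSlice (smooth_comps hx).2.2 hUx⟩

end Osculating

section Factorization

variable {θ θ' : ArbElem} {φ : PointTransformation J0} {j : J1} {E : EquivParams}

lemma exists_equivParams (hθ : θ ∈ waveClass) (hadm : AdmissibleAt θ θ' φ j) :
    ∃ E : EquivParams, j.1.2.1 ∈ E.X.source ∧ prolong1 E.map j = prolong1 φ.toFun j ∧
      ∀ᶠ i in 𝓝 j, FibreEqs θ θ' E.map i := by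
  have h := eventually_fibreEqs hθ hadm.determiningEqs
  have hj := h.self_of_nhds
  obtain ⟨E, hmem, hmap, hdT, hosc⟩ := exists_osculates hθ h
  refine ⟨E, hmem, ?_, ?_⟩
  · have hosc₀ : Osculates E φ.toFun j.1 := hosc.self_of_nhds
    have hfib := EquivParams.fibrePreserving_map hmem
    have hdT' : ∂ₜ (compT E.map) j.1 = E.c₁ := by simp [EquivParams.dirDeriv_compT]
    refine Prod.ext hmap (Prod.ext ?_ ?_)
    · change newUt E.map j = newUt φ.toFun j
      rw [hfib.newUt_eq (EquivParams.dX_ne_zero hmem), hj.fibre.newUt_eq hj.dX_ne, hdT', hosc₀.dT,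
        ← hdT, ← hosc₀.dU]
      simp [EquivParams.dirDeriv_compU hmem]
    · change newUx E.map j = newUx φ.toFun j
      rw [hfib.newUx_eq (hdT' ▸ E.c₁_ne), hj.fibre.newUx_eq hj.dT_ne]
      exact congrArg Prod.snd ((EquivParams.compX_fibreSlope_map hmem).trans hosc₀.argMap_eq)
  · have hx : Filter.Tendsto (fun i : J1 => i.1.2.1) (𝓝 j) (𝓝 j.1.2.1) :=
      (by fun_prop : Continuous fun i : J1 => i.1.2.1).tendsto j
    have hfreeze : Filter.Tendsto
        (fun i : J1 => (((j.1.1, i.1.2.1, j.1.2.2), (j.2.1, i.2.2)) : J1)) (𝓝 j) (𝓝 j) :=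
      (by fun_prop : Continuous fun i : J1 =>
        (((j.1.1, i.1.2.1, j.1.2.2), (j.2.1, i.2.2)) : J1)).tendsto j
    filter_upwards [hfreeze.eventually h.eventually_nhds, hx.eventually hosc,
      hx.eventually (E.X.open_source.mem_nhds hmem)] with i hi hosc_i hmem_i
    exact hosc_i.fibreEqs_map hθ hi hmem_i rfl

/-- The composition of point transformations. -/
noncomputable def PointTransformation.trans {V : Type} [NormedAddCommGroup V] [NormedSpace ℝ V]
    (φ ψ : PointTransformation V) : PointTransformation V where
  toOpenPartialHomeomorph := φ.toOpenPartialHomeomorph.trans ψ.toOpenPartialHomeomorph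
  smooth_toFun := ContDiffOn.comp (g := ψ.toFun) (f := φ.toFun) (t := ψ.source) ψ.smooth_toFun
    (φ.smooth_toFun.mono fun _ hz => hz.1) fun _ hz => hz.2
  smooth_invFun := ContDiffOn.comp (g := φ.invFun) (f := ψ.invFun) (t := φ.target) φ.smooth_invFun
    (ψ.smooth_invFun.mono fun _ hz => hz.1) fun _ hz => hz.2

lemma tendsto_prolong2_nearJet (hj : j.1 ∈ φ.source) (hJ : totalJac φ.toFun j ≠ 0) :
    Filter.Tendsto (prolong2 φ.toFun) (nearJet j) (nearJet (prolong1 φ.toFun j)) :=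
  Filter.tendsto_comap_iff.2 <|
    (contDiffAt_prolong1 (φ.contDiffAt hj) hJ).continuousAt.tendsto.comp Filter.tendsto_comap

namespace EquivParams

lemma transforms (hj : j.1.2.1 ∈ E.X.source) (h : ∀ᶠ i in 𝓝 j, FibreEqs θ θ' E.map i) :
    Transforms E.toBig E.toPoint θ θ' (nearJet j) :=
  transforms_of_fibreEqs rfl rfl rfl hj h Filter.tendsto_comap

/-- The factor `E⁻¹ ∘ φ` that remains of `φ` when the transformation with parameters `E` is split
off. -/
noncomputable def residual (E : EquivParams) (φ : PointTransformation J0) :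
    PointTransformation J0 :=
  φ.trans E.toPoint.inverse

lemma map_residual {z : J0} (hz : z ∈ (E.residual φ).source) :
    E.map ((E.residual φ).toFun z) = φ.toFun z :=
  map_inverse_map hz.2

lemma residual_mem_source {z : J0} (hz : z ∈ (E.residual φ).source) :
    ((E.residual φ).toFun z).2.1 ∈ E.X.source :=
  E.X.map_target' hz.2

lemma totalJac_residual_ne_zero (hj : j.1 ∈ (E.residual φ).source)
    (hJ : totalJac φ.toFun j ≠ 0) : totalJac (E.residual φ).toFun j ≠ 0 := by
  change totalJac (E.inverse.map ∘ φ.toFun) j ≠ 0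
  rw [totalJac_comp (φ.contDiffAt hj.1) (contDiffAt_map hj.2) hJ]
  exact mul_ne_zero (totalJac_map_ne_zero hj.2) hJ

lemma prolong1_residual (hj : j.1 ∈ (E.residual φ).source) (hJ : totalJac φ.toFun j ≠ 0)
    (hmem : j.1.2.1 ∈ E.X.source) (hjet : prolong1 E.map j = prolong1 φ.toFun j) :
    prolong1 (E.residual φ).toFun j = j := by
  change prolong1 (E.inverse.map ∘ φ.toFun) j = j
  rw [prolong1_comp (φ.contDiffAt hj.1) (contDiffAt_map hj.2) hJ, ← hjet,
    prolong1_inverse_prolong1 hmem]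

lemma prolong2_map_residual {k : J2} (hk : k.1.1 ∈ (E.residual φ).source)
    (hJ : totalJac (E.residual φ).toFun k.1 ≠ 0) :
    prolong2 E.map (prolong2 (E.residual φ).toFun k) = prolong2 φ.toFun k := by
  have hsource := (E.residual φ).open_source.mem_nhds hk
  have hmem := residual_mem_source hk
  rw [← prolong2_comp (Filter.eventually_of_mem hsource fun _ hz => (E.residual φ).contDiffAt hz)
    ((eventually_mem_source hmem).mono fun _ hz => contDiffAt_map hz) hJ
    (totalJac_map_ne_zero hmem)]
  exact prolong2_congr (Filter.eventually_of_mem hsource fun _ hz => map_residual hz)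

end EquivParams

lemma AdmissibleAt.residual (hadm : AdmissibleAt θ θ' φ j) (hmem : j.1.2.1 ∈ E.X.source)
    (hjet : prolong1 E.map j = prolong1 φ.toFun j) (hE : AdmissibleAt θ θ' E.toPoint j)
    (hj : j.1 ∈ (E.residual φ).source) : AdmissibleAt θ θ (E.residual φ) j := by
  obtain ⟨-, hdom, hJφ, hφ⟩ := hadm
  have hJ := EquivParams.totalJac_residual_ne_zero hj hJφ
  have hlim := tendsto_prolong2_nearJet hj hJ
  rw [EquivParams.prolong1_residual hj hJφ hmem hjet] at hlim
  have hbase : Filter.Tendsto Prod.fst (nearJet j) (𝓝 j) := Filter.tendsto_comap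
  have hsmooth := contDiffAt_totalJac ((E.residual φ).contDiffAt hj)
  refine ⟨hj, hdom, hJ, ?_⟩
  filter_upwards [hφ, hlim.eventually hE.2.2.2,
    ((continuous_fst.tendsto j).comp hbase).eventually ((E.residual φ).open_source.mem_nhds hj),
    hbase.eventually (hsmooth.continuousAt.eventually_ne hJ)] with k hk hk' hsource hJk
  rw [hk, ← EquivParams.prolong2_map_residual hsource hJk]
  exact hk'.symm

lemma semiNormalized_waveClass : SemiNormalized waveClass := by
  intro θ hθ θ' _ φ j hadm
  obtain ⟨E, hmem, hjet, hE⟩ := exists_equivParams hθ hadm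
  have hj : j.1 ∈ (E.residual φ).source := by
    refine ⟨hadm.1, ?_⟩
    change (φ.toFun j.1).2.1 ∈ E.X.target
    rw [← show E.map j.1 = φ.toFun j.1 from congrArg Prod.fst hjet]
    exact E.X.map_source' hmem
  refine ⟨E.toBig, E.toPoint, E.residual φ, E.isEquivTransformation,
    hadm.residual hmem hjet (admissibleAt_of_fibreEqs hmem hE) hj, ?_,
    Filter.eventually_of_mem ((E.residual φ).open_source.mem_nhds hj) fun z hz =>
      (EquivParams.map_residual hz).symm⟩
  rw [EquivParams.prolong1_residual hj hadm.2.2.1 hmem hjet]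
  exact E.transforms hmem hE

end Factorization

lemma IsEquivTransformation.admissibleAt {S : Set ArbElem}
    {Φ : PointTransformation (J2 × (ℝ × ℝ))} {φ : PointTransformation J0} {θ θ' : ArbElem} {j : J1}
    (h : IsEquivTransformation S Φ φ) (hθ : θ ∈ S) (hj : jetArg j ∈ θ.dom)
    (hΦ : Transforms Φ φ θ θ' (nearJet j)) : AdmissibleAt θ θ' φ j := by
  have hline := eventually_forall_of_nearJet hΦ
  obtain ⟨θ'', -, hΦ'', hsource, hdom, hJ, heqn⟩ :=
    h.preserves θ hθ (j, 0) hj (hline.self_of_nhds 0).1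
  have hbase : Filter.Tendsto Prod.fst (nearJet j) (𝓝 j) := Filter.tendsto_comap
  have hzero : Filter.Tendsto (fun i : J1 => ((i, 0) : J2)) (𝓝 j) (𝓝 (j, 0)) :=
    (by fun_prop : Continuous fun i : J1 => ((i, 0) : J2)).tendsto j
  refine ⟨hsource, hdom, hJ, ?_⟩
  filter_upwards [heqn, hbase.eventually (hzero.eventually hΦ''), hbase.eventually hline]
    with k hk ⟨_, hdom'', hval''⟩ hk'
  obtain ⟨-, hdom', hval'⟩ := hk' 0
  have hval : θ''.val (prolong1 φ.toFun k.1) = θ'.val (prolong1 φ.toFun k.1) :=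
    congrArg Prod.snd (hval''.symm.trans hval')
  have hf : θ''.f (jetArg (prolong1 φ.toFun k.1)) = θ'.f (jetArg (prolong1 φ.toFun k.1)) :=
    congrArg Prod.fst hval
  have hg : θ''.g (jetArg (prolong1 φ.toFun k.1)) = θ'.g (jetArg (prolong1 φ.toFun k.1)) :=
    congrArg Prod.snd hval
  rw [hk]
  change _ ∈ _ ∧ _ = θ''.f (jetArg (prolong1 φ.toFun k.1)) * _
      + θ''.g (jetArg (prolong1 φ.toFun k.1)) ↔ _
  rw [hf, hg]
  exact and_congr_left fun _ => iff_of_true hdom'' hdom'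

lemma groupEquiv_iff_pointEquiv (a b : LocalElem waveClass) :
    GroupEquiv a b ↔ PointEquiv a b := by
  constructor
  · rintro ⟨Φ, φ, h, hΦ, hjet⟩
    exact ⟨φ, h.admissibleAt a.mem a.jet_mem hΦ, hjet⟩
  · rintro ⟨φ, hadm, hjet⟩
    obtain ⟨E, hmem, hjet', hE⟩ := exists_equivParams a.mem hadm
    exact ⟨E.toBig, E.toPoint, E.isEquivTransformation, E.transforms hmem hE, hjet'.trans hjet⟩

theorem mainTheorem4 :
    SemiNormalized waveClass ∧
    (∀ a b : LocalElem waveClass, GroupEquiv a b ↔ PointEquiv a b) ∧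
    (∀ {Γ : Type*} (𝒮 : Γ → Set (LocalElem waveClass)),
      IsClassificationList GroupEquiv 𝒮 ↔ IsClassificationList PointEquiv 𝒮) := by
  have hequiv : @GroupEquiv waveClass = PointEquiv := by
    ext a b
    exact groupEquiv_iff_pointEquiv a b
  exact ⟨semiNormalized_waveClass, groupEquiv_iff_pointEquiv, fun 𝒮 => by rw [hequiv]⟩
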